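/- **Quantum Finner rigidity.** Consider a network with finitely many sources $S_i$ and parties $A_j$ and adjacency matrix $E_{ij}\in\{0,1\}$. Each source is bipartite, i.e. connected to exactly two parties, and no source is redundant, i.e. no two distinct sources are connected to the same pair of parties. Consider a finite-dimensional quantum model on this network. Each source $S_i$ prepares a density operator $\rho^{(i)}$ on $\bigotimes_{j:E_{ij}=1}Q^{(i)}_j$ and sends $Q_j^{(i)}$ to $A_j$. Each party $A_j$ performs on $\mathbf Q_j=\bigotimes_{i:E_{ij}=1}Q_j^{(i)}$ a POVM $\{M_j^{a}\}$ with outcomes $a_j\in O_j^{\checkmark}\cup\{\varnothing\}$ ($O_j^\checkmark$ finite), and $\mathrm P(a)=\operatorname{tr}\big[(\bigotimes_i\rho^{(i)})(\bigotimes_jM_j^{a_j})\big]$. Put $M_j^{\checkmark}=\sum_{a\ne\varnothing}M_j^a$, and let $\rho_{\mathbf Q_j}$ be the marginal state of $\mathbf Q_j$. Assume $\mathbb P[a_j\neq\varnothing]>0$ for every $j$. Call the Finner inequality *saturated* if $$\mathbb P[a_1,\dots,a_M\neq\varnothing]=\sqrt{\prod_{j}\mathbb P[a_j\neq\varnothing]}.$$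 (a) Let $|\Psi^{(i)}\rangle$, with a purifying system $E^{(i)}$, be any purifications of the $\rho^{(i)}$. The Finner inequality is saturated if and only if there are isometries $V_j^{(i)}:Q_j^{(i)}\to F_j^{(i)}\otimes\widetilde Q_j^{(i)}$ (for $E_{ij}=1$) into a flag qubit $F_j^{(i)}$ and a finite-dimensional system $\widetilde Q_j^{(i)}$, numbers $e^{(i)}\in[0,1]$ and unit vectors $|\widetilde\Psi^{(i)}\rangle,|\Theta^{(i)}\rangle$ on $\widetilde Q_j^{(i)}\widetilde Q_{j'}^{(i)}E^{(i)}$ such that, for each source $S_i$, with $A_j,A_{j'}$ its two parties, $$(V_j^{(i)}\otimes V_{j'}^{(i)}\otimes\mathbb 1)|\Psi^{(i)}\rangle=\sqrt{1-e^{(i)}}\,|11\rangle_{F_j^{(i)}F_{j'}^{(i)}}|\widetilde\Psi^{(i)}\rangle+\sqrt{e^{(i)}}\,|00\rangle_{F_j^{(i)}F_{j'}^{(i)}}|\Theta^{(i)}\rangle,$$ and, for each party $A_j$, on the support of $\rho_{\mathbf Q_j}$, $$\Big(\bigotimes_iV_j^{(i)}\Big)M_j^{\checkmark}=\Big(\bigotimes_{i}|1\rangle\langle1|_{F_j^{(i)}}\otimes\mathbb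 1_{\widetilde Q_j^{(i)}}\Big)\Big(\bigotimes_iV_j^{(i)}\Big)\qquad(\text{products over }i\text{ with }E_{ij}=1).$$ Moreover, whenever the model has this form, for every source $S_i$ with parties $A_j,A_{j'}$, $$1-e^{(i)}=\frac{\mathbb P[a_j\ne\varnothing]\,\mathbb P[a_{j'}\ne\varnothing]}{\mathbb P[a_j,a_{j'}\ne\varnothing]}.$$ (b) Let $|\Psi^{(i)}\rangle$ be any purifications of the $\rho^{(i)}$ whose purifying systems are absorbed in the systems sent to the parties: the purifying system of $S_i$ is a tensor product of two parts (one may be trivial), one part joined to each of the two systems sent by $S_i$, so that $|\Psi^{(i)}\rangle$ is a vector of two enlarged systems $\widehat Q_j^{(i)},\widehat Q_{j'}^{(i)}$, with $M_j^\checkmark$ acting trivially on the absorbed parts. The Finner inequality is saturated if and only if there are, for each $i$, a Schmidt decomposition $$|\Psi^{(i)}\rangle=\sum_{\ell=1}^{d_i}\lambda^{(i)}_\ell\,|\ell\rangle_{\widehat Q_j^{(i)}}|\ell\rangle_{\widehat Q_{j'}^{(i)}},\qquad \lambda_\ell^{(i)}>0,$$ and an indicator function $\chi^{(i)}:\{1,\dots,d_i\}\to\{0,1\}$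 such that, for each party $A_j$, on the support of the marginal state of $\bigotimes_{i:E_{ij}=1}\widehat Q_j^{(i)}$, $$M_j^{\checkmark}\otimes\mathbb 1=\bigotimes_{i:E_{ij}=1}\Big(\sum_{\ell=1}^{d_i}\chi^{(i)}(\ell)\,|\ell\rangle\langle\ell|_{\widehat Q_j^{(i)}}\Big).$$ Moreover, whenever the model has this form, $$\sum_{\ell}(\lambda_\ell^{(i)})^2\chi^{(i)}(\ell)=\frac{\mathbb P[a_j\ne\varnothing]\,\mathbb P[a_{j'}\ne\varnothing]}{\mathbb P[a_j,a_{j'}\ne\varnothing]}$$ for every source $S_i$ with parties $A_j,A_{j'}$. -/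

import Mathlib

open scoped BigOperators

noncomputable section

namespace FinnerRigidity

section Tensor

variable {κ : Type*} [Fintype κ]

/-- Tensor product of a finite family of operators, in the product bases:
`⟨x| ⨂ₖ A k |y⟩ = ∏ₖ ⟨x k| A k |y k⟩`. -/
def tensor {α β : κ → Type*} (A : ∀ k, Matrix (α k) (β k) ℂ) :
    Matrix (∀ k, α k) (∀ k, β k) ℂ :=
  Matrix.of fun x y => ∏ k, A k (x k) (y k)

/-- The partial trace of an operator on `⨂ₖ ℂ^(α k)` over all factors except `k₀`. -/
def marginal [DecidableEq κ] {α : κ → Type*} [∀ k, Fintype (α k)] [∀ k, DecidableEq (α k)]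
    (σ : Matrix (∀ k, α k) (∀ k, α k) ℂ) (k₀ : κ) : Matrix (α k₀) (α k₀) ℂ :=
  Matrix.of fun s t => ∑ x : ∀ k, α k, if x k₀ = s then σ x (Function.update x k₀ t) else 0

/-- Two operators with the same domain agree on the support of the positive operator `σ`,
i.e. on its range. -/
def AgreeOnSupport {α β : Type*} [Fintype α] (σ : Matrix α α ℂ) (A B : Matrix β α ℂ) : Prop :=
  ∀ v ∈ LinearMap.range σ.mulVecLin, A.mulVec v = B.mulVec v

end Tensor

/-- A network with bipartite sources `i : I` and parties `j : J`, given by its adjacency matrix: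
every source is connected to exactly two parties, and no source is redundant, i.e. the set of
parties connected to a source is not contained in that of another source. -/
structure BipartiteNetwork (I J : Type*) [Fintype J] where
  E : I → J → Bool
  two_parties : ∀ i, Fintype.card {j // E i j = true} = 2
  nonredundant : ∀ i i', (∀ j, E i j = true → E i' j = true) → i = i'

namespace BipartiteNetwork

variable {I J : Type*} [Fintype J]

/-- The parties connected to the source `i`. -/
abbrev Parties (N : BipartiteNetwork I J) (i : I) : Type _ := {j : J // N.E i j = true}

/-- The sources connected to the party `j`. -/
abbrev Sources (N : BipartiteNetwork I J) (j : J) : Type _ := {i : I // N.E i j = true}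

/-- Basis labels of the joint system emitted by the source `i`, when the system it sends to the
party `j` has basis labels `Q i j`. -/
abbrev SourceIdx (N : BipartiteNetwork I J) (Q : I → J → Type*) (i : I) : Type _ :=
  ∀ j : N.Parties i, Q i j

/-- Basis labels of the joint system received by the party `j`. -/
abbrev PartyIdx (N : BipartiteNetwork I J) (Q : I → J → Type*) (j : J) : Type _ :=
  ∀ i : N.Sources j, Q i j

/-- Basis labels of all the systems in the network. -/
abbrev GlobalIdx (N : BipartiteNetwork I J) (Q : I → J → Type*) : Type _ :=
  ∀ i : I, N.SourceIdx Q i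

/-- The labels of the systems received by the party `j`. -/
def toParty (N : BipartiteNetwork I J) {Q : I → J → Type*} (x : N.GlobalIdx Q) (j : J) :
    N.PartyIdx Q j :=
  fun i => x i ⟨j, i.2⟩

/-- The marginal state `⨂_{i | E i j = 1} tr_{≠ j} (σ i)` of the systems received by the
party `j`, when the source `i` emits the state `σ i`. -/
def partyState [Fintype I] [DecidableEq J] (N : BipartiteNetwork I J) {Q : I → J → Type*}
    [∀ i j, Fintype (Q i j)] [∀ i j, DecidableEq (Q i j)]
    (σ : ∀ i, Matrix (N.SourceIdx Q i) (N.SourceIdx Q i) ℂ) (j : J) :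
    Matrix (N.PartyIdx Q j) (N.PartyIdx Q j) ℂ :=
  tensor fun i : N.Sources j => marginal (σ i) ⟨j, i.2⟩

end BipartiteNetwork

section Model

variable {I J : Type*} [Fintype I] [Fintype J] [DecidableEq I] [DecidableEq J]

open scoped ComplexOrder in
/-- A (finite-dimensional) quantum model on a network: each source `i` prepares a density operator
`ρ i`, and each party `j` performs a POVM whose outcomes are the conclusive outcomes `some o`,
`o : O j`, and the failure outcome `none`. -/
structure QuantumModel (N : BipartiteNetwork I J) (Q : I → J → Type*) (O : J → Type*)
    [∀ i j, Fintype (Q i j)] [∀ i j, DecidableEq (Q i j)] [∀ j, Fintype (O j)] where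
  ρ : ∀ i, Matrix (N.SourceIdx Q i) (N.SourceIdx Q i) ℂ
  ρ_pos : ∀ i, (ρ i).PosSemidef
  ρ_trace : ∀ i, (ρ i).trace = 1
  M : ∀ j, Option (O j) → Matrix (N.PartyIdx Q j) (N.PartyIdx Q j) ℂ
  M_pos : ∀ j a, (M j a).PosSemidef
  M_sum : ∀ j, ∑ a, M j a = 1

namespace QuantumModel

variable {N : BipartiteNetwork I J} {Q : I → J → Type*} {O : J → Type*}
  [∀ i j, Fintype (Q i j)] [∀ i j, DecidableEq (Q i j)] [∀ j, Fintype (O j)]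

/-- Born rule: the probability of the outcomes `a` is `tr ((⨂ᵢ ρ i) (⨂ⱼ M j (a j)))`. -/
def prob (q : QuantumModel N Q O) (a : ∀ j, Option (O j)) : ℝ :=
  (Matrix.trace (tensor q.ρ * Matrix.of fun x y : N.GlobalIdx Q =>
    ∏ j, q.M j (a j) (N.toParty x j) (N.toParty y j))).re

/-- The probability that all the parties in `T` obtain a conclusive outcome. -/
def conclusiveProb (q : QuantumModel N Q O) (T : Finset J) : ℝ :=
  ∑ a : (∀ j, Option (O j)) with ∀ j ∈ T, (a j).isSome = true, q.prob a

/-- Equality in the Finner inequality. -/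
def SaturatesFinner (q : QuantumModel N Q O) : Prop :=
  q.conclusiveProb Finset.univ = √(∏ j, q.conclusiveProb {j})

/-- The POVM element of the event that the party `j` obtains a conclusive outcome. -/
def conclusive (q : QuantumModel N Q O) (j : J) : Matrix (N.PartyIdx Q j) (N.PartyIdx Q j) ℂ :=
  ∑ o : O j, q.M j (some o)

/-- The vectors `Ψ i` on the emitted systems and a purifying system with basis labels `E i` are
purifications of the states of the sources. -/
def IsPurification (q : QuantumModel N Q O) {E : I → Type*} [∀ i, Fintype (E i)]
    (Ψ : ∀ i, N.SourceIdx Q i × E i → ℂ) : Prop :=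
  ∀ i x y, q.ρ i x y = ∑ ε, Ψ i (x, ε) * star (Ψ i (y, ε))

/-! ### The flag form -/

/-- The projector `|1⟩⟨1| ⊗ 𝟙` on a flag qubit and a remaining system of dimension `r`. -/
def flagProj (r : ℕ) : Matrix (Fin 2 × Fin r) (Fin 2 × Fin r) ℂ :=
  Matrix.kroneckerMap (· * ·) (Matrix.single 1 1 1) 1

/-- The failing-source form with failure rates `e i`. Every emitted system is identified, through
a local isometry `V i j`, with (a subspace of) a flag qubit and a remaining system of dimension
`r i j`. In this identification the source `i` prepares
`√(1 - e i) |11⟩ ⊗ Ψ₁ i + √(e i) |00⟩ ⊗ Ψ₀ i`, and the conclusive POVM element of each party is, on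
the support of its marginal state, the tensor product of the flag projectors. -/
structure IsFlagForm (q : QuantumModel N Q O) {E : I → Type*} [∀ i, Fintype (E i)]
    (Ψ : ∀ i, N.SourceIdx Q i × E i → ℂ) (e : I → ℝ) (r : I → J → ℕ)
    (V : ∀ i j, Matrix (Fin 2 × Fin (r i j)) (Q i j) ℂ)
    (Ψ₁ Ψ₀ : ∀ i, N.SourceIdx (fun i j => Fin (r i j)) i × E i → ℂ) : Prop where
  rate_mem : ∀ i, e i ∈ Set.Icc (0 : ℝ) 1
  isometry : ∀ i j, N.E i j = true → (V i j).conjTranspose * V i j = 1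
  unit_one : ∀ i, ∑ z, ‖Ψ₁ i z‖ ^ 2 = 1
  unit_zero : ∀ i, ∑ z, ‖Ψ₀ i z‖ ^ 2 = 1
  state : ∀ i (y : ∀ j : N.Parties i, Fin 2 × Fin (r i j)) (ε : E i),
    (tensor fun j : N.Parties i => V i j).mulVec (fun x => Ψ i (x, ε)) y =
      (√(1 - e i) : ℂ) * (if ∀ j, (y j).1 = 1 then 1 else 0) * Ψ₁ i (fun j => (y j).2, ε) +
      (√(e i) : ℂ) * (if ∀ j, (y j).1 = 0 then 1 else 0) * Ψ₀ i (fun j => (y j).2, ε)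
  measurement : ∀ j, AgreeOnSupport (N.partyState q.ρ j)
    ((tensor fun i : N.Sources j => V i j) * q.conclusive j)
    ((tensor fun i : N.Sources j => flagProj (r i j)) * tensor fun i : N.Sources j => V i j)

/-! ### The Schmidt form -/

/-- The purifying system of the source `i` is `⨂ⱼ E i j`, its part `E i j` being absorbed in the
system sent to the party `j`; this regroups the vector `Ψ i` accordingly. (If the whole purifying
system is absorbed in one of the two systems, then the other part is trivial.) -/
def absorb {E : I → J → Type*}
    (Ψ : ∀ i, N.SourceIdx Q i × N.SourceIdx E i → ℂ) (i : I) :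
    N.SourceIdx (fun i j => Q i j × E i j) i → ℂ :=
  fun z => Ψ i (fun j => (z j).1, fun j => (z j).2)

/-- The conclusive POVM element of the party `j`, acting trivially on the absorbed parts of the
purifying systems. -/
def absorbedConclusive (q : QuantumModel N Q O) (E : I → J → Type*)
    [∀ i j, DecidableEq (E i j)] (j : J) :
    Matrix (N.PartyIdx (fun i j => Q i j × E i j) j)
      (N.PartyIdx (fun i j => Q i j × E i j) j) ℂ :=
  Matrix.of fun z w => q.conclusive j (fun i => (z i).1) (fun i => (w i).1) *
    if (∀ i, (z i).2 = (w i).2) then 1 else 0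

/-- The Schmidt form: `∑_ℓ lam ℓ |b ℓ⟩⊗|b ℓ⟩` is a Schmidt decomposition of the purified state of
each source, and the conclusive POVM element of each party is, on the support of its marginal
state, the tensor product of the projectors `∑_ℓ χ ℓ |b ℓ⟩⟨b ℓ|`, where the indicator `χ i` is the
same for the two systems sent by the source `i`. -/
structure IsSchmidtForm (q : QuantumModel N Q O) {E : I → J → Type*}
    [∀ i j, Fintype (E i j)] [∀ i j, DecidableEq (E i j)]
    (Ψ : ∀ i, N.SourceIdx Q i × N.SourceIdx E i → ℂ) (d : I → ℕ)
    (lam : ∀ i, Fin (d i) → ℝ) (b : ∀ i j, Fin (d i) → Q i j × E i j → ℂ)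
    (χ : ∀ i, Fin (d i) → Fin 2) : Prop where
  lam_pos : ∀ i ℓ, 0 < lam i ℓ
  orthonormal : ∀ i j, N.E i j = true → ∀ ℓ ℓ',
    dotProduct (star (b i j ℓ)) (b i j ℓ') = if ℓ = ℓ' then 1 else 0
  state : ∀ i (z : N.SourceIdx (fun i j => Q i j × E i j) i),
    absorb Ψ i z = ∑ ℓ, (lam i ℓ : ℂ) * ∏ j : N.Parties i, b i j ℓ (z j)
  measurement : ∀ j,
    AgreeOnSupport
      (N.partyState (fun i => Matrix.vecMulVec (absorb Ψ i) (star (absorb Ψ i))) j)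
      (q.absorbedConclusive E j)
      (tensor fun i : N.Sources j =>
        ∑ ℓ, ((χ i ℓ : ℕ) : ℂ) • Matrix.vecMulVec (b i j ℓ) (star (b i j ℓ)))

end QuantumModel

end Model

end FinnerRigidity

end

open scoped BigOperators

set_option linter.unusedSectionVars false

namespace FinnerRigidity

open Matrix

/-! ### Positive semidefinite matrices -/

section PSD

open scoped ComplexOrder

variable {α β γ : Type*} [Fintype α] [Fintype β] [Fintype γ]

open scoped MatrixOrder in
theorem exists_eq_conjTranspose_mul_self {A : Matrix α α ℂ} (hA : A.PosSemidef) :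
    ∃ B : Matrix α α ℂ, A = Bᴴ * B := by
  classical
  exact CStarAlgebra.nonneg_iff_eq_star_mul_self.mp hA.nonneg

theorem mul_eq_zero_of_trace_eq_zero {σ : Matrix α α ℂ} (hσ : σ.PosSemidef) {C : Matrix β α ℂ}
    (h : (σ * (Cᴴ * C)).trace = 0) : C * σ = 0 := by
  obtain ⟨B, rfl⟩ := exists_eq_conjTranspose_mul_self hσ
  have h' : ((C * Bᴴ)ᴴ * (C * Bᴴ)).trace = 0 := by
    rw [Matrix.conjTranspose_mul, Matrix.conjTranspose_conjTranspose, ← h, Matrix.mul_assoc Bᴴ,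
      Matrix.trace_mul_comm Bᴴ]
    simp only [Matrix.mul_assoc]
  rw [Matrix.trace_conjTranspose_mul_self_eq_zero_iff] at h'
  rw [← Matrix.mul_assoc, h', Matrix.zero_mul]

/-- Two pairs of a state and an operator with equal second moments vanish simultaneously. -/
theorem mul_eq_zero_of_trace_eq {σ : Matrix α α ℂ} {τ : Matrix β β ℂ} (hτ : τ.PosSemidef)
    {γ' : Type*} [Fintype γ'] {C : Matrix γ α ℂ} {D : Matrix γ' β ℂ}
    (h : (σ * (Cᴴ * C)).trace = (τ * (Dᴴ * D)).trace) (hC : C * σ = 0) : D * τ = 0 := by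
  apply mul_eq_zero_of_trace_eq_zero hτ
  rw [← h, Matrix.trace_mul_comm, Matrix.mul_assoc, hC, Matrix.mul_zero, Matrix.trace_zero]

theorem agreeOnSupport_iff {α β : Type*} [Fintype α] {σ : Matrix α α ℂ} {A B : Matrix β α ℂ} :
    AgreeOnSupport σ A B ↔ A * σ = B * σ := by
  constructor
  · intro h
    classical
    ext x y
    have := congrFun (h _ ⟨Pi.single y 1, rfl⟩) x
    simp only [Matrix.mulVecLin_apply, Matrix.mulVec_mulVec] at this
    simpa using this
  · rintro h _ ⟨v, rfl⟩
    simp only [Matrix.mulVecLin_apply, Matrix.mulVec_mulVec, h]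

theorem trace_mul_vecMulVec_star (ψ : α → ℂ) (X : Matrix α α ℂ) :
    (Matrix.vecMulVec ψ (star ψ) * X).trace = star ψ ⬝ᵥ X *ᵥ ψ := by
  rw [Matrix.vecMulVec_mul, Matrix.trace_vecMulVec, dotProduct_comm, ← Matrix.dotProduct_mulVec]

theorem eq_zero_of_posSemidef_of_diag {A : Matrix α α ℂ} (hA : A.PosSemidef)
    (h : ∀ x, A x x = 0) : A = 0 := by
  rw [← hA.trace_eq_zero_iff]
  simp [Matrix.trace, h]

end PSD

/-! ### Tensor products of operators -/

section TensorAPI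

variable {κ : Type*} [Fintype κ] {α β γ : κ → Type*}

@[simp]
theorem tensor_apply (A : ∀ k, Matrix (α k) (β k) ℂ) (x : ∀ k, α k) (y : ∀ k, β k) :
    tensor A x y = ∏ k, A k (x k) (y k) := rfl

theorem tensor_mul [DecidableEq κ] [∀ k, Fintype (β k)] (A : ∀ k, Matrix (α k) (β k) ℂ)
    (B : ∀ k, Matrix (β k) (γ k) ℂ) :
    tensor A * tensor B = tensor fun k => A k * B k := by
  ext x y
  simp only [Matrix.mul_apply, tensor_apply, ← Finset.prod_mul_distrib]
  rw [Finset.prod_univ_sum, Fintype.piFinset_univ]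

theorem tensor_one [∀ k, DecidableEq (α k)] :
    tensor (fun k => (1 : Matrix (α k) (α k) ℂ)) = 1 := by
  classical
  ext x y
  simp only [tensor_apply, Matrix.one_apply, Finset.prod_ite_zero, Finset.prod_const_one,
    Finset.mem_univ, true_implies, funext_iff]

theorem tensor_conjTranspose (A : ∀ k, Matrix (α k) (β k) ℂ) :
    (tensor A)ᴴ = tensor fun k => (A k)ᴴ := by
  ext x y
  simp [Matrix.conjTranspose_apply]

theorem trace_tensor [DecidableEq κ] [∀ k, Fintype (α k)] (A : ∀ k, Matrix (α k) (α k) ℂ) :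
    (tensor A).trace = ∏ k, (A k).trace := by
  simp only [Matrix.trace, Matrix.diag_apply, tensor_apply]
  rw [Finset.prod_univ_sum, Fintype.piFinset_univ]

theorem tensor_smul (c : κ → ℂ) (A : ∀ k, Matrix (α k) (β k) ℂ) :
    (tensor fun k => c k • A k) = (∏ k, c k) • tensor A := by
  ext x y
  simp [Finset.prod_mul_distrib]

theorem single_eq_tensor [∀ k, DecidableEq (α k)] [∀ k, DecidableEq (β k)]
    [DecidableEq (∀ k, α k)] [DecidableEq (∀ k, β k)] (x : ∀ k, α k) (y : ∀ k, β k) :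
    Matrix.single x y (1 : ℂ) = tensor fun k => Matrix.single (x k) (y k) (1 : ℂ) := by
  ext z w
  simp only [tensor_apply, Matrix.single_apply, Finset.prod_ite_zero, Finset.prod_const_one,
    Finset.mem_univ, true_implies, forall_and, funext_iff]

open scoped ComplexOrder in
theorem tensor_posSemidef [DecidableEq κ] [∀ k, Fintype (α k)]
    {A : ∀ k, Matrix (α k) (α k) ℂ} (hA : ∀ k, (A k).PosSemidef) : (tensor A).PosSemidef := by
  classical
  choose B hB using fun k => exists_eq_conjTranspose_mul_self (hA k)
  have : A = fun k => (B k)ᴴ * B k := funext hB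
  rw [this, ← tensor_mul, ← tensor_conjTranspose]
  exact Matrix.posSemidef_conjTranspose_mul_self _

variable [DecidableEq κ] [∀ k, Fintype (α k)] [∀ k, DecidableEq (α k)]

/-- The operator `X` on the factor `k`, acting trivially on the other factors. -/
noncomputable def site (k : κ) (X : Matrix (α k) (α k) ℂ) :
    Matrix (∀ k, α k) (∀ k, α k) ℂ :=
  tensor (Function.update (fun _ => 1) k X)

theorem site_apply (k : κ) (X : Matrix (α k) (α k) ℂ) (x y : ∀ k, α k) :
    site k X x y = if ∀ l, l ≠ k → x l = y l then X (x k) (y k) else 0 := by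
  rw [site, tensor_apply, ← Finset.mul_prod_erase _ _ (Finset.mem_univ k), Function.update_self]
  rw [Finset.prod_congr rfl (g := fun l => if x l = y l then (1 : ℂ) else 0)]
  · simp [Finset.prod_ite_zero]
  · intro l hl
    rw [Function.update_of_ne (Finset.ne_of_mem_erase hl), Matrix.one_apply]

theorem site_mul (k : κ) (X Y : Matrix (α k) (α k) ℂ) : site k (X * Y) = site k X * site k Y := by
  rw [site, site, site, tensor_mul]
  congr 1
  funext l
  by_cases h : l = k
  · subst h; simp
  · simp [Function.update_of_ne h]

theorem site_conjTranspose (k : κ) (X : Matrix (α k) (α k) ℂ) : (site k X)ᴴ = site k Xᴴ := by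
  rw [site, site, tensor_conjTranspose]
  congr 1
  funext l
  by_cases h : l = k
  · subst h; simp
  · simp [Function.update_of_ne h]

theorem site_one (k : κ) : site k (1 : Matrix (α k) (α k) ℂ) = 1 := by
  rw [site, Function.update_eq_self_iff.mpr rfl, tensor_one]

theorem site_sub (k : κ) (X Y : Matrix (α k) (α k) ℂ) : site k (X - Y) = site k X - site k Y := by
  ext x y
  simp only [site_apply, Matrix.sub_apply]
  split_ifs <;> simp

theorem site_add (k : κ) (X Y : Matrix (α k) (α k) ℂ) : site k (X + Y) = site k X + site k Y := by
  ext x y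
  simp only [site_apply, Matrix.add_apply]
  split_ifs <;> simp

theorem site_smul (k : κ) (c : ℂ) (X : Matrix (α k) (α k) ℂ) : site k (c • X) = c • site k X := by
  ext x y
  simp only [site_apply, Matrix.smul_apply]
  split_ifs <;> simp

theorem site_zero (k : κ) : site k (0 : Matrix (α k) (α k) ℂ) = 0 := by
  ext x y
  simp [site_apply]

theorem trace_marginal_mul (σ : Matrix (∀ k, α k) (∀ k, α k) ℂ) (k : κ)
    (X : Matrix (α k) (α k) ℂ) : (marginal σ k * X).trace = (σ * site k X).trace := by
  have hx : ∀ x : ∀ k, α k, ∑ y, σ x y * site k X y x =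
      ∑ t, σ x (Function.update x k t) * X t (x k) := by
    intro x
    symm
    apply Finset.sum_of_injOn (fun t => Function.update x k t)
    · exact (Function.update_injective x k).injOn
    · simp
    · intro y _ hy
      rw [site_apply, if_neg, mul_zero]
      intro h
      apply hy
      refine ⟨y k, by simp, ?_⟩
      funext l
      by_cases hl : l = k
      · subst hl; simp
      · simp [Function.update_of_ne hl, h l hl]
    · intro t _
      rw [site_apply, if_pos]
      · simp
      · intro l hl; simp [Function.update_of_ne hl]
  simp only [Matrix.trace, Matrix.diag_apply, Matrix.mul_apply, marginal, Matrix.of_apply, hx]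
  simp only [Finset.sum_mul, ite_mul, zero_mul]
  rw [Finset.sum_congr rfl fun s _ => Finset.sum_comm, Finset.sum_comm]
  refine Finset.sum_congr rfl fun x _ => ?_
  simp [Finset.sum_ite_irrel]

theorem marginal_eq_of_trace {σ : Matrix (∀ k, α k) (∀ k, α k) ℂ} {k : κ}
    {τ : Matrix (α k) (α k) ℂ} (h : ∀ X, (σ * site k X).trace = (τ * X).trace) :
    marginal σ k = τ := by
  rw [Matrix.ext_iff_trace_mul_right]
  intro X
  rw [trace_marginal_mul, h]

open scoped ComplexOrder in
theorem marginal_posSemidef {σ : Matrix (∀ k, α k) (∀ k, α k) ℂ} (hσ : σ.PosSemidef) (k : κ) :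
    (marginal σ k).PosSemidef := by
  rcases isEmpty_or_nonempty (α k) with h | ⟨⟨s₀⟩⟩
  · rw [Subsingleton.elim (marginal σ k) 0]
    exact Matrix.PosSemidef.zero
  have : marginal σ k = ∑ x : ∀ k, α k with x k = s₀,
      σ.submatrix (Function.update x k) (Function.update x k) := by
    ext s t
    rw [Matrix.sum_apply, marginal, Matrix.of_apply, ← Finset.sum_filter]
    refine Finset.sum_bij' (fun x _ => Function.update x k s₀) (fun x _ => Function.update x k s)
      ?_ ?_ ?_ ?_ ?_ <;> simp +contextual [Function.update_idem]
    all_goals intro x hx; simp [← hx]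
  rw [this]
  exact Matrix.posSemidef_sum _ fun x _ => hσ.submatrix _

end TensorAPI

end FinnerRigidity

namespace FinnerRigidity

open Finset

/-! ### The Finner inequality for functions on a finite product -/

section Finner

variable {I J : Type*} [Fintype I] [DecidableEq I] [Fintype J] [DecidableEq J]
  {X : I → Type*} [∀ i, Fintype (X i)] [∀ i, Nonempty (X i)]

theorem sum_sum_update (i : I) {M : Type*} [AddCommMonoid M] (f : (∀ i, X i) → M) :
    ∑ ω, ∑ s, f (Function.update ω i s) = ∑ ω, ∑ _s : X i, f ω := by
  rw [← Fintype.sum_prod_type', ← Fintype.sum_prod_type']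
  refine Fintype.sum_equiv ⟨fun p => (Function.update p.1 i p.2, p.1 i),
    fun p => (Function.update p.1 i p.2, p.1 i), ?_, ?_⟩ _ _ ?_ <;> intro p <;> simp

theorem expect_expect_update (i : I) {K : Type*} [Field K] [CharZero K] (f : (∀ i, X i) → K) :
    𝔼 ω, 𝔼 s, f (Function.update ω i s) = 𝔼 ω, f ω := by
  have h : (Fintype.card (X i) : K) ≠ 0 := by simp
  simp only [Fintype.expect_eq_sum_div_card, ← Finset.sum_div, sum_sum_update]
  simp only [Finset.sum_const, Finset.card_univ, nsmul_eq_mul, ← Finset.mul_sum]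
  field_simp

/-- Averages of functions of disjoint sets of coordinates multiply. -/
theorem expect_mul_of_dependsOn {K : Type*} [Field K] [CharZero K] (S : Set I)
    {g h : (∀ i, X i) → K} (hg : DependsOn g S) (hh : DependsOn h Sᶜ) :
    𝔼 ω, g ω * h ω = (𝔼 ω, g ω) * 𝔼 ω, h ω := by
  classical
  have key : ∑ p : (∀ i, X i) × (∀ i, X i), g p.1 * h p.2 =
      ∑ p : (∀ i, X i) × (∀ i, X i), g p.1 * h p.1 := by
    refine Fintype.sum_equiv ⟨fun p => (S.piecewise p.1 p.2, S.piecewise p.2 p.1),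
      fun p => (S.piecewise p.1 p.2, S.piecewise p.2 p.1), ?_, ?_⟩ _ _ ?_
    · intro p
      ext i <;> by_cases hi : i ∈ S <;> simp [hi]
    · intro p
      ext i <;> by_cases hi : i ∈ S <;> simp [hi]
    · intro p
      simp only [Equiv.coe_fn_mk]
      congr 1
      · exact hg fun i hi => by simp [hi]
      · exact hh fun i hi => by
          have : i ∉ S := hi
          simp [this]
  have h0 : (Fintype.card (∀ i, X i) : K) ≠ 0 := Nat.cast_ne_zero.mpr Fintype.card_ne_zero
  simp only [Fintype.sum_prod_type, ← Finset.mul_sum, Finset.sum_const, Finset.card_univ,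
    nsmul_eq_mul, ← Finset.sum_mul] at key
  simp only [mul_left_comm (g _), ← Finset.mul_sum] at key
  simp only [Fintype.expect_eq_sum_div_card]
  rw [div_mul_div_comm, key, mul_div_mul_left _ _ h0]

theorem expect_mul_le_sqrt_mul_sqrt {S : Type*} [Fintype S] [Nonempty S] (f g : S → ℝ) :
    𝔼 s, f s * g s ≤ √(𝔼 s, f s ^ 2) * √(𝔼 s, g s ^ 2) := by
  have h0 : (0 : ℝ) < Fintype.card S := by positivity
  simp only [Fintype.expect_eq_sum_div_card]
  rw [Real.sqrt_div' _ h0.le, Real.sqrt_div' _ h0.le, div_mul_div_comm, Real.mul_self_sqrt h0.le]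
  gcongr
  exact Real.sum_mul_le_sqrt_mul_sqrt _ _ _

theorem expect_prod_le_prod_sqrt (T : Finset I) :
    ∀ f : J → (∀ i, X i) → ℝ, (∀ j ω, 0 ≤ f j ω) → (∀ j, DependsOn (f j) T) →
    (∀ i, ∃ p p', p ≠ p' ∧ ∀ j, j ≠ p → j ≠ p' → ∀ ω s, f j (Function.update ω i s) = f j ω) →
    𝔼 ω, ∏ j, f j ω ≤ ∏ j, √(𝔼 ω, f j ω ^ 2) := by
  induction T using Finset.induction_on with
  | empty =>
    intro f hf hdep _
    have hc : ∀ j ω, f j ω = f j (Classical.arbitrary _) := fun j ω => hdep j (by simp)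
    have : ∀ j, √(𝔼 ω, f j ω ^ 2) = f j (Classical.arbitrary _) := fun j => by
      simp only [hc j, Fintype.expect_const]
      exact Real.sqrt_sq (hf _ _)
    simp only [this]
    simp only [hc, Fintype.expect_const]
    rfl
  | insert i T hi ih =>
    intro f hf hdep hpair
    set g : J → (∀ i, X i) → ℝ := fun j ω => √(𝔼 s, f j (Function.update ω i s) ^ 2) with hg
    have hsq : ∀ j ω, g j ω ^ 2 = 𝔼 s, f j (Function.update ω i s) ^ 2 := fun j ω =>
      Real.sq_sqrt (Finset.expect_nonneg fun _ _ => sq_nonneg _)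
    have hle : 𝔼 ω, ∏ j, f j ω ≤ 𝔼 ω, ∏ j, g j ω := by
      rw [← expect_expect_update i]
      refine Finset.expect_le_expect fun ω _ => ?_
      obtain ⟨p, p', hne, hrest⟩ := hpair i
      have hsplit : ∀ h : J → ℝ, ∏ j, h j = h p * h p' * ∏ j ∈ (univ.erase p).erase p', h j := by
        intro h
        rw [mul_assoc, Finset.mul_prod_erase _ _ (by simp [hne.symm]),
          Finset.mul_prod_erase _ _ (by simp)]
      have hgr : ∏ j ∈ (univ.erase p).erase p', g j ω =
          ∏ j ∈ (univ.erase p).erase p', f j ω := by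
        refine Finset.prod_congr rfl fun j hj => ?_
        have h2 := Finset.ne_of_mem_erase hj
        have h1 := Finset.ne_of_mem_erase (Finset.mem_of_mem_erase hj)
        simp only [hg, hrest j h1 h2, Fintype.expect_const]
        exact Real.sqrt_sq (hf _ _)
      have hfr : ∀ s, ∏ j ∈ (univ.erase p).erase p', f j (Function.update ω i s) =
          ∏ j ∈ (univ.erase p).erase p', f j ω := by
        intro s
        refine Finset.prod_congr rfl fun j hj => ?_
        exact hrest j (Finset.ne_of_mem_erase (Finset.mem_of_mem_erase hj))
          (Finset.ne_of_mem_erase hj) ω s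
      simp only [hsplit, hgr, hfr]
      rw [← Finset.expect_mul]
      exact mul_le_mul_of_nonneg_right (expect_mul_le_sqrt_mul_sqrt _ _)
        (Finset.prod_nonneg fun _ _ => hf _ _)
    have hind := ih g (fun j ω => Real.sqrt_nonneg _) ?_ ?_
    · refine hle.trans (hind.trans_eq ?_)
      refine Finset.prod_congr rfl fun j _ => ?_
      simp only [hsq]
      rw [expect_expect_update i (fun ω => f j ω ^ 2)]
    · intro j ω ω' h
      simp only [hg]
      congr 2
      funext s
      congr 1
      refine hdep j fun k hk => ?_
      by_cases hki : k = i
      · subst hki; simp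
      · simp only [Function.update_of_ne hki]
        exact h k (by simpa [hki] using hk)
    · intro k
      obtain ⟨p, p', hne, hrest⟩ := hpair k
      refine ⟨p, p', hne, fun j h1 h2 ω s => ?_⟩
      simp only [hg]
      congr 2
      funext t
      congr 1
      by_cases hki : k = i
      · subst hki; simp
      · rw [Function.update_comm hki, hrest j h1 h2]

/-- The Lagrange identity quantifying the Cauchy–Schwarz inequality. -/
theorem lagrange_identity {S : Type*} [Fintype S] (u v : S → ℂ) :
    ∑ s, ∑ t, ‖u s * star (v t) - u t * star (v s)‖ ^ 2 =
      2 * ((∑ s, ‖u s‖ ^ 2) * (∑ s, ‖v s‖ ^ 2) - ‖∑ s, u s * v s‖ ^ 2) := by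
  have hn : ∀ z : ℂ, ((‖z‖ ^ 2 : ℝ) : ℂ) = z * star z := fun z => by
    rw [Complex.star_def, Complex.mul_conj, Complex.normSq_eq_norm_sq]
  apply Complex.ofReal_injective
  push_cast [← Complex.ofReal_pow, hn]
  have e1 : ∀ s t, (u s * star (v t) - u t * star (v s)) * star (u s * star (v t) - u t * star (v s))
      = (u s * star (u s)) * (v t * star (v t)) + (v s * star (v s)) * (u t * star (u t))
        - (u s * v s) * star (u t * v t) - (star (u s * v s)) * (u t * v t) := by
    intro s t
    simp only [star_sub, star_mul', star_star]
    ring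
  simp only [e1, Finset.sum_add_distrib, Finset.sum_sub_distrib, ← Finset.mul_sum,
    ← Finset.sum_mul, ← star_sum]
  ring

theorem mul_star_eq_of_cauchySchwarz_eq {S : Type*} [Fintype S] (u v : S → ℂ)
    (h : (∑ s, ‖u s‖ ^ 2) * (∑ s, ‖v s‖ ^ 2) ≤ ‖∑ s, u s * v s‖ ^ 2) (s t : S) :
    u s * star (v t) = u t * star (v s) := by
  have hL := lagrange_identity u v
  have h0 : ∑ s, ∑ t, ‖u s * star (v t) - u t * star (v s)‖ ^ 2 = 0 :=
    le_antisymm (by linarith) (by positivity)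
  rw [Finset.sum_eq_zero_iff_of_nonneg (fun _ _ => by positivity)] at h0
  have h1 := h0 s (by simp)
  rw [Finset.sum_eq_zero_iff_of_nonneg (fun _ _ => by positivity)] at h1
  have h2 := h1 t (by simp)
  exact sub_eq_zero.mp (norm_eq_zero.mp (pow_eq_zero_iff (two_ne_zero) |>.mp h2))

/-- Rigidity of the Finner inequality: if two functions `f p`, `f p'` share only the coordinate
`i`, then equality forces them to be proportional (up to conjugation) in this coordinate. -/
theorem mul_star_eq_of_finner_eq (S : J → Set I) (f : J → (∀ i, X i) → ℂ)
    (hdep : ∀ j, DependsOn (f j) (S j))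
    (hpair : ∀ i, ∃ p p', p ≠ p' ∧ ∀ j, i ∈ S j → j = p ∨ j = p')
    (hpos : ∀ j, 0 < 𝔼 ω, ‖f j ω‖ ^ 2)
    (heq : ∏ j, √(𝔼 ω, ‖f j ω‖ ^ 2) ≤ ‖𝔼 ω, ∏ j, f j ω‖)
    {i : I} {p p' : J} (hpp : p ≠ p') (hip : i ∈ S p) (hip' : i ∈ S p')
    (honly : ∀ k, k ∈ S p → k ∈ S p' → k = i) (ω ω' : ∀ i, X i) (s t : X i) :
    f p (Function.update ω i s) * star (f p' (Function.update ω' i t)) =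
      f p (Function.update ω i t) * star (f p' (Function.update ω' i s)) := by
  classical
  have hsplit : ∀ h : J → ℝ, ∏ j, h j = h p * h p' * ∏ j ∈ (univ.erase p).erase p', h j := by
    intro h
    rw [mul_assoc, Finset.mul_prod_erase _ _ (by simp [hpp.symm]),
      Finset.mul_prod_erase _ _ (by simp)]
  have hsplitC : ∀ h : J → ℂ, ∏ j, h j = h p * h p' * ∏ j ∈ (univ.erase p).erase p', h j := by
    intro h
    rw [mul_assoc, Finset.mul_prod_erase _ _ (by simp [hpp.symm]),
      Finset.mul_prod_erase _ _ (by simp)]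
  have hnot : ∀ j, j ≠ p → j ≠ p' → i ∉ S j := by
    intro j h1 h2 hj
    obtain ⟨a, b, _, h⟩ := hpair i
    rcases h _ hip with rfl | rfl <;> rcases h _ hip' with rfl | rfl <;> rcases h _ hj with rfl | rfl
      <;> simp_all
  have hupd : ∀ j k, k ∉ S j → ∀ ω s, f j (Function.update ω k s) = f j ω := by
    intro j k hk ω s
    refine hdep j fun l hl => ?_
    rw [Function.update_of_ne]
    rintro rfl
    exact hk hl
  set G : (∀ i, X i) → ℂ := fun ω => 𝔼 s, f p (Function.update ω i s) * f p' (Function.update ω i s)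
    with hG
  have hGmerge : 𝔼 ω, ∏ j, f j ω = 𝔼 ω, G ω * ∏ j ∈ (univ.erase p).erase p', f j ω := by
    rw [← expect_expect_update i]
    refine Finset.expect_congr rfl fun ω _ => ?_
    simp only [hsplitC, hG]
    rw [Finset.expect_mul]
    refine Finset.expect_congr rfl fun s _ => ?_
    congr 1
    refine Finset.prod_congr rfl fun j hj => hupd j i (hnot j ?_ ?_) _ _
    · exact Finset.ne_of_mem_erase (Finset.mem_of_mem_erase hj)
    · exact Finset.ne_of_mem_erase hj
  -- Finner for the network where `p` and `p'` are merged
  set F : J → (∀ i, X i) → ℝ := fun j ω => if j = p then ‖G ω‖ else if j = p' then 1 else ‖f j ω‖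
    with hF
  have hFp : F p = fun ω => ‖G ω‖ := by simp [hF]
  have hFp' : F p' = fun ω => 1 := by simp [hF, hpp.symm]
  have hFj : ∀ j, j ≠ p → j ≠ p' → F j = fun ω => ‖f j ω‖ := by
    intro j h1 h2; simp [hF, h1, h2]
  have hGupd : ∀ k, k = i ∨ (k ∉ S p ∧ k ∉ S p') → ∀ ω s, G (Function.update ω k s) = G ω := by
    rintro k hk ω s
    simp only [hG]
    refine Finset.expect_congr rfl fun t _ => ?_
    by_cases hki : k = i
    · subst hki; simp
    · obtain ⟨h1, h2⟩ := hk.resolve_left hki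
      rw [Function.update_comm hki, hupd p k h1, hupd p' k h2]
  have hfin := expect_prod_le_prod_sqrt (univ : Finset I) F ?_ ?_ ?_
  rotate_left
  · intro j ω
    simp only [hF]
    split_ifs <;> positivity
  · intro j ω ω' h
    rw [show ω = ω' from funext fun i => h i (by simp)]
  · intro k
    by_cases hki : k = i
    · refine ⟨p, p', hpp, fun j h1 h2 ω s => ?_⟩
      rw [hFj j h1 h2]
      simp only
      rw [hupd j k (hki ▸ hnot j h1 h2)]
    obtain ⟨a, b, hab, h⟩ := hpair k
    by_cases hkp' : k ∈ S p'
    · have hkp : k ∉ S p := fun hkp => hki (honly k hkp hkp')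
      obtain ⟨c, hc⟩ : ∃ c, c ≠ p' ∧ ∀ j, k ∈ S j → j = c ∨ j = p' := by
        rcases h p' hkp' with rfl | rfl
        · exact ⟨b, hab.symm, fun j hj => (h j hj).symm⟩
        · exact ⟨a, hab, h⟩
      have hgo : ∀ j, j ≠ p → j ≠ c → ∀ ω s, F j (Function.update ω k s) = F j ω := by
        intro j h1 h2 ω s
        by_cases h3 : j = p'
        · subst h3; rw [hFp']
        · rw [hFj j h1 h3]
          simp only
          rw [hupd j k (fun hj => (hc.2 j hj).elim h2 h3)]
      by_cases hcp : p = c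
      · exact ⟨p, p', hpp, fun j h1 _ => hgo j h1 (hcp ▸ h1)⟩
      · exact ⟨p, c, hcp, hgo⟩
    · refine ⟨a, b, hab, fun j h1 h2 ω s => ?_⟩
      have hkj : k ∉ S j := fun hj => (h j hj).elim h1 h2
      by_cases hjp : j = p
      · subst hjp
        rw [hFp]
        simp only
        rw [hGupd k (Or.inr ⟨hkj, hkp'⟩)]
      by_cases hjp' : j = p'
      · subst hjp'; rw [hFp']
      · rw [hFj j hjp hjp']
        simp only
        rw [hupd j k hkj]
  have hFrest : ∀ ω, ∏ j ∈ (univ.erase p).erase p', F j ω =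
      ∏ j ∈ (univ.erase p).erase p', ‖f j ω‖ := by
    intro ω
    refine Finset.prod_congr rfl fun j hj => ?_
    rw [hFj j (Finset.ne_of_mem_erase (Finset.mem_of_mem_erase hj)) (Finset.ne_of_mem_erase hj)]
  have hFrest2 : ∏ j ∈ (univ.erase p).erase p', √(𝔼 ω, F j ω ^ 2) =
      ∏ j ∈ (univ.erase p).erase p', √(𝔼 ω, ‖f j ω‖ ^ 2) := by
    refine Finset.prod_congr rfl fun j hj => ?_
    rw [hFj j (Finset.ne_of_mem_erase (Finset.mem_of_mem_erase hj)) (Finset.ne_of_mem_erase hj)]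
  rw [hsplit (fun j => √(𝔼 ω, F j ω ^ 2)), hFrest2] at hfin
  simp only [hsplit, hFp, hFp', hFrest, one_pow, Fintype.expect_const, Real.sqrt_one, mul_one]
    at hfin
  have hrpos : 0 < ∏ j ∈ (univ.erase p).erase p', √(𝔼 ω, ‖f j ω‖ ^ 2) :=
    Finset.prod_pos fun j _ => Real.sqrt_pos.mpr (hpos j)
  have hnorm : ‖𝔼 ω, ∏ j, f j ω‖ ≤ 𝔼 ω, ‖G ω‖ * ∏ j ∈ (univ.erase p).erase p', ‖f j ω‖ := by
    rw [hGmerge]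
    simp only [Fintype.expect_eq_sum_div_card, norm_div, Complex.norm_natCast]
    gcongr
    refine (norm_sum_le _ _).trans_eq ?_
    simp [norm_prod]
  have hGge : √(𝔼 ω, ‖f p ω‖ ^ 2) * √(𝔼 ω, ‖f p' ω‖ ^ 2) ≤ √(𝔼 ω, ‖G ω‖ ^ 2) := by
    have := heq.trans (hnorm.trans hfin)
    rw [hsplit] at this
    exact le_of_mul_le_mul_right this hrpos
  rw [← Real.sqrt_mul (hpos p).le] at hGge
  have hGge' := (Real.sqrt_le_sqrt_iff (Finset.expect_nonneg fun _ _ => by positivity)).mp hGge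
  -- pointwise Cauchy–Schwarz, and independence of the remaining coordinates
  set u : (∀ i, X i) → ℝ := fun ω => 𝔼 s, ‖f p (Function.update ω i s)‖ ^ 2 with hu
  set v : (∀ i, X i) → ℝ := fun ω => 𝔼 s, ‖f p' (Function.update ω i s)‖ ^ 2 with hv
  have hind : 𝔼 ω, u ω * v ω = (𝔼 ω, ‖f p ω‖ ^ 2) * 𝔼 ω, ‖f p' ω‖ ^ 2 := by
    rw [expect_mul_of_dependsOn (S p \ {i}), expect_expect_update i (fun ω => ‖f p ω‖ ^ 2),
      expect_expect_update i (fun ω => ‖f p' ω‖ ^ 2)]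
    · intro ω ω' h
      refine Finset.expect_congr rfl fun s _ => ?_
      rw [hdep p (x := Function.update ω i s) (y := Function.update ω' i s)]
      intro k hk
      by_cases hki : k = i
      · subst hki; simp
      · simp only [Function.update_of_ne hki]; exact h k ⟨hk, hki⟩
    · intro ω ω' h
      refine Finset.expect_congr rfl fun s _ => ?_
      rw [hdep p' (x := Function.update ω i s) (y := Function.update ω' i s)]
      intro k hk
      by_cases hki : k = i
      · subst hki; simp
      · simp only [Function.update_of_ne hki]
        exact h k fun hk' => hki (honly k hk'.1 hk)
  have hcs : ∀ ω, ‖G ω‖ ^ 2 ≤ u ω * v ω := by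
    intro ω
    have hc : ‖G ω‖ ≤ 𝔼 s, ‖f p (Function.update ω i s)‖ * ‖f p' (Function.update ω i s)‖ := by
      simp only [hG, Fintype.expect_eq_sum_div_card, norm_div, Complex.norm_natCast]
      gcongr
      refine (norm_sum_le _ _).trans_eq ?_
      simp
    have h2 := pow_le_pow_left₀ (norm_nonneg _) (hc.trans (expect_mul_le_sqrt_mul_sqrt _ _)) 2
    rwa [mul_pow, Real.sq_sqrt (Finset.expect_nonneg fun _ _ => by positivity),
      Real.sq_sqrt (Finset.expect_nonneg fun _ _ => by positivity)] at h2
  have hall : ∀ ω, u ω * v ω = ‖G ω‖ ^ 2 := by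
    have h0 : ∑ ω, (u ω * v ω - ‖G ω‖ ^ 2) = 0 := by
      refine le_antisymm ?_ (Finset.sum_nonneg fun ω _ => sub_nonneg.mpr (hcs ω))
      rw [← hind] at hGge'
      simp only [Fintype.expect_eq_sum_div_card] at hGge'
      rw [div_le_div_iff_of_pos_right (by positivity)] at hGge'
      rw [Finset.sum_sub_distrib]
      linarith
    rw [Finset.sum_eq_zero_iff_of_nonneg fun ω _ => sub_nonneg.mpr (hcs ω)] at h0
    intro ω
    exact sub_eq_zero.mp (h0 ω (by simp))
  have hpoint : ∀ ω : (∀ i, X i), ∀ s t, f p (Function.update ω i s) * star (f p' (Function.update ω i t)) =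
      f p (Function.update ω i t) * star (f p' (Function.update ω i s)) := by
    intro ω
    refine mul_star_eq_of_cauchySchwarz_eq (fun s => f p (Function.update ω i s))
      (fun s => f p' (Function.update ω i s)) ?_
    have := (hall ω).le
    simp only [hu, hv, hG, Fintype.expect_eq_sum_div_card, norm_div, Complex.norm_natCast] at this
    rw [div_mul_div_comm, div_pow, ← sq, div_le_div_iff_of_pos_right (by positivity)] at this
    exact this
  -- the other coordinates of `f p` and `f p'` can be chosen independently
  have h1 : ∀ r, f p (Function.update ω i r) =
      f p (Function.update ((S p).piecewise ω ω') i r) := by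
    intro r
    refine hdep p fun k hk => ?_
    by_cases hki : k = i
    · subst hki; simp
    · simp [Function.update_of_ne hki, hk]
  have h2 : ∀ r, f p' (Function.update ω' i r) =
      f p' (Function.update ((S p).piecewise ω ω') i r) := by
    intro r
    refine hdep p' fun k hk => ?_
    by_cases hki : k = i
    · subst hki; simp
    · have : k ∉ S p := fun h => hki (honly k h hk)
      simp [Function.update_of_ne hki, this]
  rw [h1 s, h1 t, h2 s, h2 t]
  exact hpoint _ s t

end Finner

end FinnerRigidity

namespace FinnerRigidity

open Matrix
open scoped ComplexOrder

/-! ### Product structure of projections -/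

section Product

variable {κ : Type*} [Fintype κ] [DecidableEq κ]

theorem fst_update {α β : κ → Type*} (ω : ∀ k, α k × β k) (k : κ) (s : α k × β k) :
    (fun l => (Function.update ω k s l).1) = Function.update (fun l => (ω l).1) k s.1 := by
  funext l
  by_cases h : l = k
  · subst h; simp
  · simp [Function.update_of_ne h]

theorem snd_update {α β : κ → Type*} (ω : ∀ k, α k × β k) (k : κ) (s : α k × β k) :
    (fun l => (Function.update ω k s l).2) = Function.update (fun l => (ω l).2) k s.2 := by
  funext l
  by_cases h : l = k
  · subst h; simp
  · simp [Function.update_of_ne h]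

theorem eq_mul_prod_of_separable {X : κ → Type*} {h : (∀ k, X k) → ℂ}
    (hs : ∀ k ω ω' s t, h (Function.update ω k s) * h (Function.update ω' k t) =
      h (Function.update ω k t) * h (Function.update ω' k s))
    {ω₀ : ∀ k, X k} (h₀ : h ω₀ ≠ 0) (ω : ∀ k, X k) :
    h ω = h ω₀ * ∏ k, h (Function.update ω₀ k (ω k)) / h ω₀ := by
  have key : ∀ T : Finset κ, h (T.piecewise ω ω₀) =
      h ω₀ * ∏ k ∈ T, h (Function.update ω₀ k (ω k)) / h ω₀ := by
    intro T
    induction T using Finset.induction_on with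
    | empty => simp
    | insert k T hk ih =>
      have h1 := hs k (T.piecewise ω ω₀) ω₀ (ω k) (ω₀ k)
      have h2 : Function.update (T.piecewise ω ω₀) k (ω₀ k) = T.piecewise ω ω₀ := by
        rw [Function.update_eq_self_iff]; simp [hk]
      rw [Function.update_eq_self, h2] at h1
      rw [Finset.piecewise_insert, Finset.prod_insert hk, mul_left_comm, ← ih]
      field_simp
      linear_combination h1
  simpa using key Finset.univ

variable {D : κ → Type*} [∀ k, Fintype (D k)]

/-- A nonzero orthogonal projection whose matrix is separable in each pair of indices is a tensor
product of orthogonal projections. -/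
theorem exists_tensor_projections {m : Matrix (∀ k, D k) (∀ k, D k) ℂ} (hH : m.IsHermitian)
    (hI : m * m = m) (hne : m ≠ 0)
    (hs : ∀ k x y x' y' (s t : D k × D k),
      m (Function.update x k s.1) (Function.update y k s.2) *
        m (Function.update x' k t.1) (Function.update y' k t.2) =
      m (Function.update x k t.1) (Function.update y k t.2) *
        m (Function.update x' k s.1) (Function.update y' k s.2)) :
    ∃ (P : ∀ k, Matrix (D k) (D k) ℂ) (x₀ : ∀ k, D k) (c : κ → ℂ), m = tensor P ∧
      m x₀ x₀ ≠ 0 ∧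
      ∀ k, (P k).IsHermitian ∧ P k * P k = P k ∧ P k ≠ 0 ∧ c k ≠ 0 ∧
        ∀ l l', P k l l' = c k * m (Function.update x₀ k l) (Function.update x₀ k l') := by
  classical
  obtain ⟨x₀, hx₀⟩ : ∃ x₀, m x₀ x₀ ≠ 0 := by
    by_contra! h
    refine hne (eq_zero_of_posSemidef_of_diag ?_ h)
    rw [← hI]
    nth_rw 1 [← hH.eq]
    exact Matrix.posSemidef_conjTranspose_mul_self m
  set C := m x₀ x₀ with hC
  have hCs : star C = C := hH.apply x₀ x₀
  set v : ∀ k, Matrix (D k) (D k) ℂ := fun k => Matrix.of fun l l' =>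
    m (Function.update x₀ k l) (Function.update x₀ k l') / C with hv
  have hm : m = C • tensor v := by
    ext x y
    have := eq_mul_prod_of_separable (X := fun k => D k × D k)
      (h := fun ω => m (fun k => (ω k).1) (fun k => (ω k).2)) (ω₀ := fun k => (x₀ k, x₀ k))
      (by intro k ω ω' s t; simp only [fst_update, snd_update]; exact hs _ _ _ _ _ _ _) hx₀
      (fun k => (x k, y k))
    simp only [fst_update, snd_update] at this
    exact this
  have hv₀ : ∀ k, v k (x₀ k) (x₀ k) = 1 := by
    intro k
    simp [hv, ← hC, hx₀]
  have hvH : ∀ k, (v k).IsHermitian := by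
    intro k
    ext l l'
    simp only [hv, Matrix.conjTranspose_apply, Matrix.of_apply, star_div₀, hCs, hH.apply]
  set n : κ → ℂ := fun k => (v k * v k) (x₀ k) (x₀ k) with hn
  have hmm : C • tensor (fun k => v k * v k) = tensor v := by
    have h1 := hI
    rw [hm, Matrix.smul_mul, Matrix.mul_smul, tensor_mul] at h1
    exact smul_right_injective _ hx₀ h1
  have hCn : C * ∏ k, n k = 1 := by
    have := congrFun (congrFun hmm x₀) x₀
    simpa [hv₀] using this
  have hn0 : ∀ k, n k ≠ 0 := by
    intro k hk
    rw [Finset.prod_eq_zero (Finset.mem_univ k) hk, mul_zero] at hCn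
    exact zero_ne_one hCn
  have hns : ∀ k, star (n k) = n k := by
    intro k
    have : (v k * v k).IsHermitian := by
      rw [Matrix.IsHermitian, Matrix.conjTranspose_mul, (hvH k).eq]
    exact this.apply _ _
  have hvv : ∀ k, v k * v k = n k • v k := by
    intro k
    ext l l'
    have := congrFun (congrFun hmm (Function.update x₀ k l)) (Function.update x₀ k l')
    simp only [Matrix.smul_apply, tensor_apply, smul_eq_mul] at this
    rw [← Finset.mul_prod_erase _ _ (Finset.mem_univ k),
      ← Finset.mul_prod_erase _ _ (Finset.mem_univ k)] at this
    have e1 : ∏ x ∈ Finset.univ.erase k, (v x * v x) (Function.update x₀ k l x)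
        (Function.update x₀ k l' x) = ∏ x ∈ Finset.univ.erase k, n x :=
      Finset.prod_congr rfl fun x hx => by
        simp only [Function.update_of_ne (Finset.ne_of_mem_erase hx), hn]
    have e2 : ∏ x ∈ Finset.univ.erase k, v x (Function.update x₀ k l x)
        (Function.update x₀ k l' x) = 1 :=
      Finset.prod_eq_one fun x hx => by
        simp only [Function.update_of_ne (Finset.ne_of_mem_erase hx), hv₀]
    rw [e1, e2] at this
    rw [← Finset.mul_prod_erase _ _ (Finset.mem_univ k)] at hCn
    simp only [Function.update_self] at this
    rw [Matrix.smul_apply, smul_eq_mul]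
    linear_combination n k * this - (v k * v k) l l' * hCn
  refine ⟨fun k => (n k)⁻¹ • v k, x₀, fun k => (n k)⁻¹ * C⁻¹, ?_, hx₀, fun k => ⟨?_, ?_, ?_, ?_, ?_⟩⟩
  · rw [tensor_smul, Finset.prod_inv_distrib, hm, eq_inv_of_mul_eq_one_left hCn]
  · rw [Matrix.IsHermitian, Matrix.conjTranspose_smul, (hvH k).eq, star_inv₀, hns]
  · rw [Matrix.smul_mul, Matrix.mul_smul, hvv, smul_smul, smul_smul]
    congr 1
    field_simp [hn0 k]
  · intro h
    have := congrFun (congrFun h (x₀ k)) (x₀ k)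
    simp [hv₀, hn0] at this
  · exact mul_ne_zero (inv_ne_zero (hn0 k)) (inv_ne_zero hx₀)
  · intro l l'
    simp only [Matrix.smul_apply, smul_eq_mul, hv, Matrix.of_apply]
    ring

end Product

/-! ### Spectral lemmas -/

section Spectral

variable {α β : Type*} [Fintype α] [Fintype β]

theorem exists_unitary_diagonal [DecidableEq α] {S : Matrix α α ℂ} (hS : S.IsHermitian) :
    ∃ (U : Matrix α α ℂ) (μ : α → ℝ), Uᴴ * U = 1 ∧ U * Uᴴ = 1 ∧
      S = U * diagonal (fun k => (μ k : ℂ)) * Uᴴ := by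
  refine ⟨hS.eigenvectorUnitary, hS.eigenvalues, ?_, ?_, ?_⟩
  · exact Unitary.coe_star_mul_self _
  · exact Unitary.coe_mul_star_self _
  · conv_lhs => rw [hS.spectral_theorem]
    rfl

/-- The spectral projection of a Hermitian matrix at `1`. -/
theorem exists_projection_sub_eq [DecidableEq α] {S : Matrix α α ℂ} (hS : S.IsHermitian) :
    ∃ P G : Matrix α α ℂ, P.IsHermitian ∧ P * P = P ∧ P - S = G * (S * S - S) := by
  obtain ⟨U, μ, hU, hU', rfl⟩ := exists_unitary_diagonal hS
  have hmul : ∀ f g : α → ℂ, (U * diagonal f * Uᴴ) * (U * diagonal g * Uᴴ) =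
      U * diagonal (fun k => f k * g k) * Uᴴ := by
    intro f g
    rw [← Matrix.diagonal_mul_diagonal]
    calc _ = U * diagonal f * (Uᴴ * U) * diagonal g * Uᴴ := by simp only [Matrix.mul_assoc]
      _ = _ := by rw [hU, Matrix.mul_one]; simp only [Matrix.mul_assoc]
  have hsub : ∀ f g : α → ℂ, (U * diagonal f * Uᴴ) - (U * diagonal g * Uᴴ) =
      U * diagonal (fun k => f k - g k) * Uᴴ := by
    intro f g
    rw [← Matrix.sub_mul, ← Matrix.mul_sub, Matrix.diagonal_sub]
  refine ⟨U * diagonal (fun k => if μ k = 1 then 1 else 0) * Uᴴ,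
    U * diagonal (fun k => if μ k = 1 ∨ μ k = 0 then 0 else -((μ k : ℂ) - 1)⁻¹) * Uᴴ, ?_, ?_, ?_⟩
  · simp only [Matrix.IsHermitian, Matrix.conjTranspose_mul, Matrix.conjTranspose_conjTranspose,
      Matrix.diagonal_conjTranspose, Matrix.mul_assoc]
    congr 3
    funext k
    simp only [Pi.star_apply]
    split_ifs <;> simp
  · rw [hmul]
    congr 3
    funext k
    split_ifs <;> simp
  · rw [hmul, hsub, hsub, hmul]
    congr 3
    funext k
    by_cases h1 : μ k = 1
    · simp [h1]
    by_cases h0 : μ k = 0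
    · simp [h0]
    have h1' : (μ k : ℂ) - 1 ≠ 0 := by
      rw [sub_ne_zero]; exact_mod_cast h1
    simp only [h1, h0, if_false, or_self]
    field_simp
    ring

theorem exists_unit_fixed [DecidableEq α] {P : Matrix α α ℂ} (hI : P * P = P)
    (hne : P ≠ 0) : ∃ u : α → ℂ, P *ᵥ u = u ∧ star u ⬝ᵥ u = 1 := by
  obtain ⟨y, hy⟩ : ∃ y, P *ᵥ Pi.single y 1 ≠ 0 := by
    by_contra! h
    apply hne
    ext x y
    simpa using congrFun (h y) x
  set w := P *ᵥ Pi.single y 1 with hw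
  have hPw : P *ᵥ w = w := by rw [hw, Matrix.mulVec_mulVec, hI]
  have hn : star w ⬝ᵥ w = ((∑ x, ‖w x‖ ^ 2 : ℝ) : ℂ) := by
    simp only [dotProduct, Pi.star_apply]
    push_cast
    refine Finset.sum_congr rfl fun x _ => ?_
    rw [Complex.star_def, mul_comm, Complex.mul_conj, Complex.normSq_eq_norm_sq]
    push_cast
    rfl
  set r := ∑ x, ‖w x‖ ^ 2 with hr
  have hr0 : 0 ≤ r := by positivity
  have hrne : r ≠ 0 := by
    intro h
    rw [h, Complex.ofReal_zero, dotProduct_star_self_eq_zero] at hn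
    exact hy hn
  refine ⟨((√r)⁻¹ : ℂ) • w, ?_, ?_⟩
  · rw [Matrix.mulVec_smul, hPw]
  · rw [star_smul, smul_dotProduct, dotProduct_smul, hn]
    have : ((√r : ℝ) : ℂ) * (√r : ℝ) = r := by
      rw [← Complex.ofReal_mul, Real.mul_self_sqrt hr0]
    have hs : (√r : ℂ) ≠ 0 := by
      simpa using Real.sqrt_ne_zero'.mpr (lt_of_le_of_ne hr0 hrne.symm)
    simp only [smul_eq_mul, star_inv₀, Complex.star_def, Complex.conj_ofReal]
    field_simp
    rw [← this]; ring

/-- The singular value decomposition, with the singular vectors for nonzero singular values. -/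
theorem exists_svd (K : Matrix α β ℂ) :
    ∃ (d : ℕ) (s : Fin d → ℝ) (u : Matrix α (Fin d) ℂ) (v : Matrix β (Fin d) ℂ)
      (u' : Matrix β (Fin d) ℂ) (v' : Matrix α (Fin d) ℂ),
      (∀ k, 0 < s k) ∧ uᴴ * u = 1 ∧ vᴴ * v = 1 ∧
      K = u * diagonal (fun k => (s k : ℂ)) * vᵀ ∧ u = K * u' ∧ v = Kᵀ * v' := by
  classical
  have hA : (Kᴴ * K).PosSemidef := Matrix.posSemidef_conjTranspose_mul_self K
  obtain ⟨U, μ, hU, hU', hS⟩ := exists_unitary_diagonal hA.isHermitian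
  set Y := K * U with hY
  have hYY : Yᴴ * Y = diagonal (fun k => (μ k : ℂ)) := by
    rw [hY, Matrix.conjTranspose_mul]
    calc _ = Uᴴ * (Kᴴ * K) * U := by simp only [Matrix.mul_assoc]
      _ = (Uᴴ * U) * diagonal (fun k => (μ k : ℂ)) * (Uᴴ * U) := by
        rw [hS]; simp only [Matrix.mul_assoc]
      _ = _ := by rw [hU, Matrix.one_mul, Matrix.mul_one]
  have hcol : ∀ k, ((∑ x, ‖Y x k‖ ^ 2 : ℝ) : ℂ) = μ k := by
    intro k
    have := congrFun (congrFun hYY k) k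
    rw [Matrix.diagonal_apply_eq, Matrix.mul_apply] at this
    rw [← this]
    push_cast
    refine Finset.sum_congr rfl fun x _ => ?_
    rw [Matrix.conjTranspose_apply, Complex.star_def, mul_comm, Complex.mul_conj,
      Complex.normSq_eq_norm_sq]
    push_cast
    rfl
  have hμ : ∀ k, ∑ x, ‖Y x k‖ ^ 2 = μ k := fun k => by exact_mod_cast hcol k
  have hμ0 : ∀ k, 0 ≤ μ k := fun k => by rw [← hμ]; positivity
  have hzero : ∀ k, μ k = 0 → ∀ x, Y x k = 0 := by
    intro k hk x
    rw [← hμ, Finset.sum_eq_zero_iff_of_nonneg (fun _ _ => by positivity)] at hk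
    simpa using hk x (by simp)
  let e := (Fintype.equivFin {k // μ k ≠ 0}).symm
  set s : Fin (Fintype.card {k // μ k ≠ 0}) → ℝ := fun k => √(μ (e k)) with hs
  have hspos : ∀ k, 0 < s k := fun k =>
    Real.sqrt_pos.mpr (lt_of_le_of_ne (hμ0 _) (e k).2.symm)
  have hs0 : ∀ k, (s k : ℂ) ≠ 0 := fun k => by exact_mod_cast (hspos k).ne'
  have hss : ∀ k, (s k : ℂ) * s k = μ (e k) := fun k => by
    rw [← Complex.ofReal_mul, hs, Real.mul_self_sqrt (hμ0 _)]
  have hinj : ∀ k l, ((e k : β) = e l) ↔ k = l := fun k l => by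
    rw [← Subtype.ext_iff, e.injective.eq_iff]
  refine ⟨_, s, Matrix.of fun x k => Y x (e k) * (s k : ℂ)⁻¹, Matrix.of fun y k => star (U y (e k)),
    Matrix.of fun y k => U y (e k) * (s k : ℂ)⁻¹,
    Matrix.of fun x k => star (Y x (e k)) * ((s k : ℂ) * s k)⁻¹, hspos, ?_, ?_, ?_, ?_, ?_⟩
  · ext k l
    have := congrFun (congrFun hYY (e k)) (e l)
    rw [Matrix.mul_apply] at this
    simp only [Matrix.mul_apply, Matrix.conjTranspose_apply, Matrix.of_apply, star_mul',
      star_inv₀, Complex.star_def, Complex.conj_ofReal] at this ⊢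
    calc _ = (∑ x, (starRingEnd ℂ) (Y x (e k)) * Y x (e l)) * ((s k : ℂ)⁻¹ * (s l : ℂ)⁻¹) := by
          rw [Finset.sum_mul]
          exact Finset.sum_congr rfl fun x _ => by ring
      _ = _ := by
        rw [this, Matrix.diagonal_apply, Matrix.one_apply]
        simp only [hinj]
        split_ifs with h
        · subst h
          rw [← hss, ← mul_inv, mul_inv_cancel₀ (mul_ne_zero (hs0 _) (hs0 _))]
        · simp
  · ext k l
    have := congrFun (congrFun hU (e l)) (e k)
    rw [Matrix.mul_apply] at this
    simp only [Matrix.mul_apply, Matrix.conjTranspose_apply, Matrix.of_apply, star_star] at this ⊢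
    rw [Finset.sum_congr rfl fun x _ => mul_comm _ _, this, Matrix.one_apply, Matrix.one_apply]
    simp only [hinj, eq_comm]
  · ext x y
    have hK : K = Y * Uᴴ := by rw [hY, Matrix.mul_assoc, hU', Matrix.mul_one]
    rw [hK, Matrix.mul_apply, Matrix.mul_apply]
    simp only [Matrix.mul_diagonal, Matrix.of_apply, Matrix.conjTranspose_apply,
      Matrix.transpose_apply]
    have h1 : ∑ j, Y x j * star (U y j) = ∑ j : {k // μ k ≠ 0}, Y x j * star (U y j) := by
      rw [← Finset.sum_subtype (Finset.univ.filter fun k => μ k ≠ 0) (by simp)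
        (fun j => Y x j * star (U y j)), Finset.sum_filter_of_ne]
      intro k _ hk h0
      exact hk (by rw [hzero k h0, zero_mul])
    rw [h1, ← e.sum_comp]
    refine Finset.sum_congr rfl fun k _ => ?_
    rw [inv_mul_cancel_right₀ (hs0 k)]
  · ext x k
    simp only [hY, Matrix.mul_apply, Matrix.of_apply, Finset.sum_mul]
    exact Finset.sum_congr rfl fun x _ => by ring
  · ext y k
    have h1 : Kᴴ * Y = U * diagonal (fun k => (μ k : ℂ)) := by
      rw [hY, ← Matrix.mul_assoc, hS, Matrix.mul_assoc, hU, Matrix.mul_one]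
    have := congrFun (congrFun h1 y) (e k)
    rw [Matrix.mul_apply, Matrix.mul_diagonal, ← hss] at this
    have h2 := congrArg star this
    simp only [Matrix.mul_apply, Matrix.of_apply, Matrix.transpose_apply,
      Matrix.conjTranspose_apply, star_sum, star_mul', Complex.star_def,
      Complex.conj_conj, Complex.conj_ofReal] at h2 ⊢
    calc _ = (starRingEnd ℂ) (U y (e k)) * (s k * s k) * ((s k : ℂ) * s k)⁻¹ := by
          rw [mul_inv_cancel_right₀ (mul_ne_zero (hs0 _) (hs0 _))]
      _ = _ := by
        rw [← h2, Finset.sum_mul]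
        exact Finset.sum_congr rfl fun x _ => by ring

theorem orthonormal_sumElim {d₁ d₀ : ℕ} {w₁ : Matrix α (Fin d₁) ℂ} {w₀ : Matrix α (Fin d₀) ℂ}
    (h₁ : w₁ᴴ * w₁ = 1) (h₀ : w₀ᴴ * w₀ = 1) (h₁₀ : w₁ᴴ * w₀ = 0) (h₀₁ : w₀ᴴ * w₁ = 0)
    (k l : Fin d₁ ⊕ Fin d₀) :
    star (Sum.elim (fun k x => w₁ x k) (fun k x => w₀ x k) k) ⬝ᵥ
      Sum.elim (fun k x => w₁ x k) (fun k x => w₀ x k) l = if k = l then 1 else 0 := by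
  rcases k with k | k <;> rcases l with l | l
  · simpa [Matrix.mul_apply, dotProduct, Matrix.one_apply] using congrFun (congrFun h₁ k) l
  · simpa [Matrix.mul_apply, dotProduct, Matrix.one_apply] using congrFun (congrFun h₁₀ k) l
  · simpa [Matrix.mul_apply, dotProduct, Matrix.one_apply] using congrFun (congrFun h₀₁ k) l
  · simpa [Matrix.mul_apply, dotProduct, Matrix.one_apply] using congrFun (congrFun h₀ k) l

/-- A singular value decomposition of `K` adapted to projections intertwined by `K`. -/
theorem exists_svd_adapted [DecidableEq α] [DecidableEq β] (K : Matrix α β ℂ) {P : Matrix α α ℂ}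
    {R : Matrix β β ℂ} (hP : P.IsHermitian) (hP' : P * P = P) (hR : R.IsHermitian)
    (hR' : R * R = R) (hK : P * K = K * Rᵀ) :
    ∃ (d : ℕ) (s : Fin d → ℝ) (u : Fin d → α → ℂ) (v : Fin d → β → ℂ) (χ : Fin d → Fin 2),
      (∀ k, 0 < s k) ∧ (∀ k l, star (u k) ⬝ᵥ u l = if k = l then 1 else 0) ∧
      (∀ k l, star (v k) ⬝ᵥ v l = if k = l then 1 else 0) ∧
      (∀ x y, K x y = ∑ k, (s k : ℂ) * (u k x * v k y)) ∧
      (∀ k, P *ᵥ u k = ((χ k : ℕ) : ℂ) • u k) ∧ (∀ k, R *ᵥ v k = ((χ k : ℕ) : ℂ) • v k) := by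
  obtain ⟨d₁, s₁, u₁, v₁, u₁', v₁', hs₁, hu₁, hv₁, hK₁, hu₁', hv₁'⟩ := exists_svd (P * K)
  obtain ⟨d₀, s₀, u₀, v₀, u₀', v₀', hs₀, hu₀, hv₀, hK₀, hu₀', hv₀'⟩ := exists_svd ((1 - P) * K)
  have hPu₁ : P * u₁ = u₁ := by
    rw [hu₁', ← Matrix.mul_assoc, ← Matrix.mul_assoc, hP']
  have hPu₀ : P * u₀ = 0 := by
    rw [hu₀', ← Matrix.mul_assoc, ← Matrix.mul_assoc, Matrix.mul_sub, hP', Matrix.mul_one, sub_self,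
      Matrix.zero_mul, Matrix.zero_mul]
  have hRv₁ : R * v₁ = v₁ := by
    rw [hv₁', hK, Matrix.transpose_mul, Matrix.transpose_transpose, ← Matrix.mul_assoc,
      ← Matrix.mul_assoc, hR']
  have hRv₀ : R * v₀ = 0 := by
    rw [hv₀', Matrix.sub_mul, hK, Matrix.one_mul, Matrix.transpose_sub, Matrix.transpose_mul,
      Matrix.transpose_transpose, ← Matrix.mul_assoc, Matrix.mul_sub, ← Matrix.mul_assoc, hR',
      sub_self, Matrix.zero_mul]
  have hu₁₀ : u₁ᴴ * u₀ = 0 := by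
    rw [← hPu₁, Matrix.conjTranspose_mul, hP.eq, Matrix.mul_assoc, hPu₀, Matrix.mul_zero]
  have hv₁₀ : v₁ᴴ * v₀ = 0 := by
    rw [← hRv₁, Matrix.conjTranspose_mul, hR.eq, Matrix.mul_assoc, hRv₀, Matrix.mul_zero]
  have hu₀₁ : u₀ᴴ * u₁ = 0 := by
    rw [← Matrix.conjTranspose_conjTranspose u₁, ← Matrix.conjTranspose_mul, hu₁₀,
      Matrix.conjTranspose_zero]
  have hv₀₁ : v₀ᴴ * v₁ = 0 := by
    rw [← Matrix.conjTranspose_conjTranspose v₁, ← Matrix.conjTranspose_mul, hv₁₀,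
      Matrix.conjTranspose_zero]
  have hsplit : K = P * K + (1 - P) * K := by rw [Matrix.sub_mul, Matrix.one_mul]; abel
  let e := (finSumFinEquiv (m := d₁) (n := d₀)).symm
  refine ⟨d₁ + d₀, fun k => Sum.elim s₁ s₀ (e k),
    fun k => Sum.elim (fun k x => u₁ x k) (fun k x => u₀ x k) (e k),
    fun k => Sum.elim (fun k x => v₁ x k) (fun k x => v₀ x k) (e k),
    fun k => Sum.elim (fun _ => 1) (fun _ => 0) (e k), ?_, ?_, ?_, ?_, ?_, ?_⟩
  · intro k
    beta_reduce
    rcases e k with k | k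
    · exact hs₁ k
    · exact hs₀ k
  · intro k l
    rw [orthonormal_sumElim hu₁ hu₀ hu₁₀ hu₀₁]
    simp only [e.injective.eq_iff]
  · intro k l
    rw [orthonormal_sumElim hv₁ hv₀ hv₁₀ hv₀₁]
    simp only [e.injective.eq_iff]
  · intro x y
    rw [e.sum_comp fun k => ((Sum.elim s₁ s₀ k : ℝ) : ℂ) *
      (Sum.elim (fun k x => u₁ x k) (fun k x => u₀ x k) k x *
        Sum.elim (fun k x => v₁ x k) (fun k x => v₀ x k) k y), Fintype.sum_sum_type]
    have h1 := congrFun (congrFun hK₁ x) y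
    have h0 := congrFun (congrFun hK₀ x) y
    rw [hsplit, Matrix.add_apply, h1, h0, Matrix.mul_apply, Matrix.mul_apply]
    simp only [Matrix.mul_diagonal, Matrix.transpose_apply, Sum.elim_inl,
      Sum.elim_inr]
    congr 1 <;> exact Finset.sum_congr rfl fun _ _ => by ring
  · intro k
    beta_reduce
    rcases e k with k | k
    · funext x
      simpa [Matrix.mulVec, dotProduct, Matrix.mul_apply] using congrFun (congrFun hPu₁ x) k
    · funext x
      simpa [Matrix.mulVec, dotProduct, Matrix.mul_apply] using congrFun (congrFun hPu₀ x) k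
  · intro k
    beta_reduce
    rcases e k with k | k
    · funext x
      simpa [Matrix.mulVec, dotProduct, Matrix.mul_apply] using congrFun (congrFun hRv₁ x) k
    · funext x
      simpa [Matrix.mulVec, dotProduct, Matrix.mul_apply] using congrFun (congrFun hRv₀ x) k

end Spectral

/-! ### Schmidt decompositions -/

section Schmidt

variable {κ : Type*} [Fintype κ]

theorem exists_pair_of_card_eq_two (hκ : Fintype.card κ = 2) :
    ∃ p p' : κ, p ≠ p' ∧ ∀ k, k = p ∨ k = p' := by
  classical
  obtain ⟨p, p', hne, h⟩ := Finset.card_eq_two.mp (Finset.card_univ.trans hκ)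
  refine ⟨p, p', hne, fun k => ?_⟩
  have := Finset.mem_univ k
  rw [h] at this
  simpa using this

theorem prod_eq_mul_of_pair {M : Type*} [CommMonoid M] {p p' : κ} (hne : p ≠ p')
    (h : ∀ k, k = p ∨ k = p') (f : κ → M) : ∏ k, f k = f p * f p' := by
  classical
  have : (Finset.univ : Finset κ) = {p, p'} := by
    ext k; simpa using h k
  rw [this, Finset.prod_pair hne]

theorem exists_section_of_pair {p p' : κ} (hne : p ≠ p') (h : ∀ k, k = p ∨ k = p')
    {F : κ → Type*} (a : F p) (b : F p') : ∃ f : ∀ k, F k, f p = a ∧ f p' = b := by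
  classical
  refine ⟨fun k => if hk : k = p then hk ▸ a else (h k).resolve_left hk ▸ b, ?_, ?_⟩
  · simp
  · simp [hne.symm]

variable [DecidableEq κ] {α : κ → Type*} [∀ k, Fintype (α k)] [∀ k, DecidableEq (α k)]

theorem site_mulVec_apply (k : κ) (X : Matrix (α k) (α k) ℂ) (ψ : (∀ k, α k) → ℂ)
    (x : ∀ k, α k) : (site k X *ᵥ ψ) x = ∑ s, X (x k) s * ψ (Function.update x k s) := by
  rw [Matrix.mulVec, dotProduct]
  symm
  apply Finset.sum_of_injOn (fun t => Function.update x k t)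
  · exact (Function.update_injective x k).injOn
  · simp
  · intro y _ hy
    rw [site_apply, if_neg, zero_mul]
    intro h
    apply hy
    refine ⟨y k, by simp, ?_⟩
    funext l
    by_cases hl : l = k
    · subst hl; simp
    · simp [Function.update_of_ne hl, h l hl]
  · intro t _
    rw [site_apply, if_pos]
    · simp
    · intro l hl; simp [Function.update_of_ne hl]

/-- A Schmidt decomposition of a bipartite vector adapted to local projections that agree on it. -/
theorem exists_schmidt_adapted (hκ : Fintype.card κ = 2) (ψ : (∀ k, α k) → ℂ)
    {P : ∀ k, Matrix (α k) (α k) ℂ} (hP : ∀ k, (P k).IsHermitian) (hP' : ∀ k, P k * P k = P k)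
    (hψ : ∀ k k', site k (P k) *ᵥ ψ = site k' (P k') *ᵥ ψ) :
    ∃ (d : ℕ) (lam : Fin d → ℝ) (b : ∀ k, Fin d → α k → ℂ) (χ : Fin d → Fin 2),
      (∀ l, 0 < lam l) ∧ (∀ k l l', star (b k l) ⬝ᵥ b k l' = if l = l' then 1 else 0) ∧
      (∀ z, ψ z = ∑ l, (lam l : ℂ) * ∏ k, b k l (z k)) ∧
      ∀ k l, P k *ᵥ b k l = ((χ l : ℕ) : ℂ) • b k l := by
  obtain ⟨p, p', hne, hcov⟩ := exists_pair_of_card_eq_two hκ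
  choose mk hmk hmk' using fun a b => exists_section_of_pair (F := α) hne hcov a b
  have hext : ∀ {x y : ∀ k, α k}, x p = y p → x p' = y p' → x = y := by
    intro x y h h'
    funext k
    rcases hcov k with rfl | rfl
    · exact h
    · exact h'
  have hup : ∀ a b s, Function.update (mk a b) p s = mk s b := by
    intro a b s
    apply hext
    · simp [hmk]
    · simp [Function.update_of_ne hne.symm, hmk']
  have hup' : ∀ a b s, Function.update (mk a b) p' s = mk a s := by
    intro a b s
    apply hext
    · simp [Function.update_of_ne hne, hmk]
    · simp [hmk']
  obtain ⟨d, s, u, v, χ, hs, hu, hv, hK, hPu, hPv⟩ :=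
    exists_svd_adapted (Matrix.of fun a b => ψ (mk a b)) (hP p) (hP' p) (hP p') (hP' p') (by
      ext a b
      have := congrFun (hψ p p') (mk a b)
      rw [site_mulVec_apply, site_mulVec_apply] at this
      simp only [hup, hup', hmk, hmk'] at this
      rw [Matrix.mul_apply, Matrix.mul_apply]
      simp only [Matrix.of_apply, Matrix.transpose_apply]
      rw [this]
      exact Finset.sum_congr rfl fun _ _ => mul_comm _ _)
  obtain ⟨b, hb, hb'⟩ := exists_section_of_pair (F := fun k => Fin d → α k → ℂ) hne hcov u v
  refine ⟨d, s, b, χ, hs, ?_, ?_, ?_⟩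
  · intro k
    rcases hcov k with rfl | rfl
    · rw [hb]; exact hu
    · rw [hb']; exact hv
  · intro z
    have := hK (z p) (z p')
    rw [Matrix.of_apply, hext (x := mk (z p) (z p')) (y := z) (hmk _ _) (hmk' _ _)] at this
    rw [this]
    simp only [prod_eq_mul_of_pair hne hcov, hb, hb']
  · intro k
    rcases hcov k with rfl | rfl
    · rw [hb]; exact hPu
    · rw [hb']; exact hPv

end Schmidt

end FinnerRigidity

namespace FinnerRigidity

open Matrix
open scoped ComplexOrder

/-! ### Expectation values in a network -/

namespace BipartiteNetwork

variable {I J : Type*} [Fintype I] [Fintype J] [DecidableEq I] [DecidableEq J]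
  (N : BipartiteNetwork I J) {Q : I → J → Type*}

theorem prod_sources_eq_prod_parties {M : Type*} [CommMonoid M]
    (g : ∀ i j, N.E i j = true → M) :
    ∏ j, ∏ i : N.Sources j, g i j i.2 = ∏ i, ∏ j : N.Parties i, g i j j.2 := by
  rw [← Fintype.prod_sigma' (fun j (i : N.Sources j) => g i j i.2),
    ← Fintype.prod_sigma' (fun i (j : N.Parties i) => g i j j.2)]
  exact Fintype.prod_equiv ⟨fun a => ⟨a.2.1, a.1, a.2.2⟩, fun a => ⟨a.2.1, a.1, a.2.2⟩,
    fun _ => rfl, fun _ => rfl⟩ _ _ fun _ => rfl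

/-- The systems of the network, grouped by sources or by parties. -/
def partyEquiv (Q : I → J → Type*) : N.GlobalIdx Q ≃ ∀ j, N.PartyIdx Q j where
  toFun x j := N.toParty x j
  invFun y i j := y j ⟨i, j.2⟩
  left_inv _ := rfl
  right_inv _ := rfl

/-- The tensor product of operators of the parties, as an operator on all the systems. -/
def globalOp (A : ∀ j, Matrix (N.PartyIdx Q j) (N.PartyIdx Q j) ℂ) :
    Matrix (N.GlobalIdx Q) (N.GlobalIdx Q) ℂ :=
  (tensor A).submatrix (N.partyEquiv Q) (N.partyEquiv Q)

theorem globalOp_apply (A : ∀ j, Matrix (N.PartyIdx Q j) (N.PartyIdx Q j) ℂ)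
    (x y : N.GlobalIdx Q) :
    N.globalOp A x y = ∏ j, A j (N.toParty x j) (N.toParty y j) := rfl

variable [∀ i j, Fintype (Q i j)]

/-- The expectation value `tr ((⨂ᵢ σ i) (⨂ⱼ A j))`. -/
noncomputable def expectation (σ : ∀ i, Matrix (N.SourceIdx Q i) (N.SourceIdx Q i) ℂ)
    (A : ∀ j, Matrix (N.PartyIdx Q j) (N.PartyIdx Q j) ℂ) : ℂ :=
  (tensor σ * N.globalOp A).trace

theorem globalOp_mul (A B : ∀ j, Matrix (N.PartyIdx Q j) (N.PartyIdx Q j) ℂ) :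
    N.globalOp A * N.globalOp B = N.globalOp fun j => A j * B j := by
  rw [globalOp, globalOp, Matrix.submatrix_mul_equiv, tensor_mul, globalOp]

theorem globalOp_tensor (X : ∀ i j, Matrix (Q i j) (Q i j) ℂ) :
    N.globalOp (fun j => tensor fun i : N.Sources j => X i j) =
      tensor fun i => tensor fun j : N.Parties i => X i j := by
  ext x y
  rw [globalOp_apply]
  exact N.prod_sources_eq_prod_parties fun i j h => X i j (x i ⟨j, h⟩) (y i ⟨j, h⟩)

theorem expectation_tensor (σ : ∀ i, Matrix (N.SourceIdx Q i) (N.SourceIdx Q i) ℂ)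
    (X : ∀ i j, Matrix (Q i j) (Q i j) ℂ) :
    N.expectation σ (fun j => tensor fun i : N.Sources j => X i j) =
      ∏ i, (σ i * tensor fun j : N.Parties i => X i j).trace := by
  rw [expectation, globalOp_tensor, tensor_mul, trace_tensor]

variable [∀ i j, DecidableEq (Q i j)]

theorem globalOp_update (j : J) (C : Matrix (N.PartyIdx Q j) (N.PartyIdx Q j) ℂ) :
    N.globalOp (Function.update (fun _ => 1) j C) =
      (site j C).submatrix (N.partyEquiv Q) (N.partyEquiv Q) := rfl

theorem expectation_update_tensor {σ : ∀ i, Matrix (N.SourceIdx Q i) (N.SourceIdx Q i) ℂ}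
    (hσ : ∀ i, (σ i).trace = 1) (j : J) (X : ∀ i : N.Sources j, Matrix (Q i j) (Q i j) ℂ) :
    N.expectation σ (Function.update (fun _ => 1) j (tensor X)) =
      (N.partyState σ j * tensor X).trace := by
  let Y : ∀ i j, Matrix (Q i j) (Q i j) ℂ := fun i =>
    Function.update (fun _ => 1) j (if h : N.E i j = true then X ⟨i, h⟩ else 1)
  have hY : Function.update (fun _ => 1) j (tensor X) =
      fun j => tensor fun i : N.Sources j => Y i j := by
    funext j'
    by_cases h : j' = j
    · subst h
      simp only [Function.update_self, Y]
      congr 1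
      funext i
      rw [dif_pos i.2]
    · rw [Function.update_of_ne h]
      simp only [Y, Function.update_of_ne h]
      rw [tensor_one]
  rw [hY, expectation_tensor, partyState, tensor_mul, trace_tensor]
  have : ∀ i, (σ i * tensor fun j' : N.Parties i => Y i j').trace =
      if h : N.E i j = true then (marginal (σ i) ⟨j, h⟩ * X ⟨i, h⟩).trace else 1 := by
    intro i
    split_ifs with h
    · rw [trace_marginal_mul, site]
      congr 3
      funext j'
      by_cases hj : j' = ⟨j, h⟩
      · subst hj; simp [Y, h]
      · have : j'.1 ≠ j := fun h' => hj (Subtype.ext h')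
        simp only [Y, Function.update_of_ne hj, Function.update_of_ne this]
    · have : (fun j' : N.Parties i => Y i j') = fun _ => 1 := by
        funext j'
        have : j'.1 ≠ j := fun h' => h (h' ▸ j'.2)
        simp only [Y, Function.update_of_ne this]
      rw [this, tensor_one, Matrix.mul_one, hσ]
  simp only [this]
  rw [Fintype.prod_dite]
  simp

/-- An operator of the party `j` is measured in the marginal state of this party. -/
theorem expectation_update_one {σ : ∀ i, Matrix (N.SourceIdx Q i) (N.SourceIdx Q i) ℂ}
    (hσ : ∀ i, (σ i).trace = 1) (j : J) (C : Matrix (N.PartyIdx Q j) (N.PartyIdx Q j) ℂ) :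
    N.expectation σ (Function.update (fun _ => 1) j C) = (N.partyState σ j * C).trace := by
  induction C using Matrix.induction_on' with
  | h_zero => simp [expectation, globalOp_update, site_zero]
  | h_add A B hA hB =>
    rw [expectation, globalOp_update] at hA hB ⊢
    rw [site_add, Matrix.submatrix_add, Pi.add_apply, Pi.add_apply, Matrix.mul_add, Matrix.mul_add, Matrix.trace_add,
      Matrix.trace_add, ← hA, ← hB]
  | h_std_basis x y c =>
    have h1 : Matrix.single x y c = c • tensor fun k => Matrix.single (x k) (y k) (1 : ℂ) := by
      rw [← single_eq_tensor, Matrix.smul_single, smul_eq_mul, mul_one]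
    have h2 := N.expectation_update_tensor hσ j fun k => Matrix.single (x k) (y k) (1 : ℂ)
    rw [expectation, globalOp_update] at h2 ⊢
    rw [h1, site_smul, Matrix.mul_smul, Matrix.trace_smul, ← h2, Matrix.submatrix_smul,
      Pi.smul_apply, Pi.smul_apply, Matrix.mul_smul, Matrix.trace_smul]

theorem globalOp_update_mul_eq_zero {σ : ∀ i, Matrix (N.SourceIdx Q i) (N.SourceIdx Q i) ℂ}
    (hpos : ∀ i, (σ i).PosSemidef) (hσ : ∀ i, (σ i).trace = 1) {j : J}
    {C : Matrix (N.PartyIdx Q j) (N.PartyIdx Q j) ℂ} (hC : C * N.partyState σ j = 0) :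
    N.globalOp (Function.update (fun _ => 1) j C) * tensor σ = 0 := by
  refine mul_eq_zero_of_trace_eq (tensor_posSemidef hpos) ?_ hC
  rw [← N.expectation_update_one hσ, expectation, globalOp_update, globalOp_update, site_mul,
    ← site_conjTranspose, Matrix.conjTranspose_submatrix, Matrix.submatrix_mul_equiv]

theorem partyState_posSemidef {σ : ∀ i, Matrix (N.SourceIdx Q i) (N.SourceIdx Q i) ℂ}
    (hpos : ∀ i, (σ i).PosSemidef) (j : J) : (N.partyState σ j).PosSemidef :=
  tensor_posSemidef fun i => marginal_posSemidef (hpos i) _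

/-- Expectation values depend only on the action of the operators on the supports of the
marginal states. -/
theorem expectation_congr {σ : ∀ i, Matrix (N.SourceIdx Q i) (N.SourceIdx Q i) ℂ}
    (hpos : ∀ i, (σ i).PosSemidef) (hσ : ∀ i, (σ i).trace = 1)
    {A B : ∀ j, Matrix (N.PartyIdx Q j) (N.PartyIdx Q j) ℂ}
    (hAB : ∀ j, A j * N.partyState σ j = B j * N.partyState σ j) :
    N.expectation σ A = N.expectation σ B := by
  have step : ∀ (D : ∀ j, Matrix (N.PartyIdx Q j) (N.PartyIdx Q j) ℂ) (j : J),
      N.expectation σ (Function.update D j (A j)) = N.expectation σ (Function.update D j (B j)) := by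
    intro D j
    have hsplit : ∀ X, N.globalOp (Function.update D j X) =
        N.globalOp (Function.update D j 1) * N.globalOp (Function.update (fun _ => 1) j X) := by
      intro X
      rw [globalOp_mul]
      congr 1
      funext j'
      by_cases h : j' = j
      · subst h; simp
      · simp [Function.update_of_ne h]
    have h0 := N.globalOp_update_mul_eq_zero hpos hσ (j := j) (C := A j - B j)
      (by rw [Matrix.sub_mul, hAB, sub_self])
    rw [globalOp_update, site_sub, Matrix.submatrix_sub, Pi.sub_apply, Pi.sub_apply,
      Matrix.sub_mul, sub_eq_zero, ← globalOp_update, ← globalOp_update] at h0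
    rw [expectation, expectation, hsplit (A j), hsplit (B j)]
    rw [← Matrix.mul_assoc, Matrix.trace_mul_comm, ← Matrix.mul_assoc, h0, Matrix.mul_assoc,
      Matrix.trace_mul_comm, Matrix.mul_assoc]
  have key : ∀ T : Finset J, N.expectation σ (T.piecewise A B) = N.expectation σ B := by
    intro T
    induction T using Finset.induction_on with
    | empty => simp
    | insert j T hj ih =>
      rw [Finset.piecewise_insert, step, ← ih]
      congr 1
      rw [Function.update_eq_self_iff]
      simp [hj]
  simpa using key Finset.univ

end BipartiteNetwork

namespace QuantumModel

open BipartiteNetwork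

variable {I J : Type*} [Fintype I] [Fintype J] [DecidableEq I] [DecidableEq J]
  {N : BipartiteNetwork I J} {Q : I → J → Type*} {O : J → Type*}
  [∀ i j, Fintype (Q i j)] [∀ i j, DecidableEq (Q i j)] [∀ j, Fintype (O j)]

theorem conclusiveProb_eq_expectation (q : QuantumModel N Q O) (T : Finset J) :
    q.conclusiveProb T =
      (N.expectation q.ρ fun j => if j ∈ T then q.conclusive j else 1).re := by
  classical
  have hsum : ∀ j, (if j ∈ T then q.conclusive j else 1) =
      ∑ o ∈ (if j ∈ T then Finset.univ.filter (fun o : Option (O j) => o.isSome = true)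
        else Finset.univ), q.M j o := by
    intro j
    split_ifs
    · rw [Finset.sum_filter, Fintype.sum_option]
      simp [conclusive]
    · rw [q.M_sum]
  have hop : N.globalOp (fun j => if j ∈ T then q.conclusive j else 1) =
      ∑ a : (∀ j, Option (O j)) with ∀ j ∈ T, (a j).isSome = true,
        N.globalOp fun j => q.M j (a j) := by
    ext x y
    rw [Matrix.sum_apply]
    simp only [globalOp_apply, hsum, Matrix.sum_apply]
    rw [Finset.prod_univ_sum]
    refine Finset.sum_congr ?_ fun _ _ => rfl
    ext a
    simp only [Fintype.mem_piFinset, Finset.mem_filter, Finset.mem_univ, true_and]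
    refine forall_congr' fun j => ?_
    split_ifs with h <;> simp [h]
  rw [conclusiveProb, expectation, hop, Matrix.mul_sum, Matrix.trace_sum, Complex.re_sum]
  rfl

end QuantumModel

end FinnerRigidity

namespace FinnerRigidity

open Matrix
open scoped ComplexOrder

/-! ### Vectors in Schmidt form -/

section SchmidtVector

variable {κ : Type*} [Fintype κ] [DecidableEq κ] {α : κ → Type*} [∀ k, Fintype (α k)]
  [∀ k, DecidableEq (α k)] {D : Type*} [Fintype D] [DecidableEq D]

/-- The vector `∑_l lam l ⨂ₖ b k l`. -/
noncomputable def schmidtVec (lam : D → ℝ) (b : ∀ k, Matrix (α k) D ℂ) : (∀ k, α k) → ℂ :=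
  fun x => ∑ l, (lam l : ℂ) * ∏ k, b k (x k) l

theorem schmidtVec_eq_mulVec (lam : D → ℝ) (b : ∀ k, Matrix (α k) D ℂ) :
    schmidtVec lam b =
      (tensor b).submatrix id (fun (l : D) (_ : κ) => l) *ᵥ fun l => (lam l : ℂ) := by
  funext x
  simp only [schmidtVec, Matrix.mulVec, dotProduct, Matrix.submatrix_apply, tensor_apply, id]
  exact Finset.sum_congr rfl fun l _ => mul_comm _ _

theorem tensor_mulVec_schmidtVec (lam : D → ℝ) (b : ∀ k, Matrix (α k) D ℂ)
    (X : ∀ k, Matrix (α k) (α k) ℂ) :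
    tensor X *ᵥ schmidtVec lam b = schmidtVec lam fun k => X k * b k := by
  rw [schmidtVec_eq_mulVec, Matrix.mulVec_mulVec, schmidtVec_eq_mulVec, ← tensor_mul]
  rfl

theorem star_schmidtVec_dotProduct (lam : D → ℝ) (b : ∀ k, Matrix (α k) D ℂ)
    (X : ∀ k, Matrix (α k) (α k) ℂ) :
    star (schmidtVec lam b) ⬝ᵥ tensor X *ᵥ schmidtVec lam b =
      ∑ l, ∑ l', (lam l : ℂ) * (lam l' : ℂ) * ∏ k, ((b k)ᴴ * X k * b k) l l' := by
  have hmat : ((tensor b).submatrix id (fun (l : D) (_ : κ) => l))ᴴ * (tensor X *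
      (tensor b).submatrix id (fun (l : D) (_ : κ) => l)) =
      (tensor fun k => (b k)ᴴ * X k * b k).submatrix (fun l _ => l) (fun l _ => l) := by
    have h : (tensor fun k => (b k)ᴴ * X k * b k) = (tensor b)ᴴ * (tensor X * tensor b) := by
      rw [tensor_conjTranspose, tensor_mul, tensor_mul]
      simp only [Matrix.mul_assoc]
    rw [h]
    rfl
  rw [schmidtVec_eq_mulVec, Matrix.star_mulVec, ← Matrix.dotProduct_mulVec, Matrix.mulVec_mulVec,
    Matrix.mulVec_mulVec, Matrix.mul_assoc, hmat]
  simp only [dotProduct, Matrix.mulVec, Matrix.submatrix_apply, tensor_apply, Pi.star_apply,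
    Complex.star_def, Complex.conj_ofReal, Finset.mul_sum]
  exact Finset.sum_congr rfl fun l _ => Finset.sum_congr rfl fun l' _ => by ring

theorem marginal_schmidtVec (hκ : 1 < Fintype.card κ) (lam : D → ℝ) {b : ∀ k, Matrix (α k) D ℂ}
    (hb : ∀ k, (b k)ᴴ * b k = 1) (k : κ) :
    marginal (vecMulVec (schmidtVec lam b) (star (schmidtVec lam b))) k =
      b k * diagonal (fun l => ((lam l : ℂ)) ^ 2) * (b k)ᴴ := by
  apply marginal_eq_of_trace
  intro X
  obtain ⟨k', hk'⟩ := Fintype.exists_ne_of_one_lt_card hκ k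
  rw [trace_mul_vecMulVec_star, site, star_schmidtVec_dotProduct]
  have h : ∀ l l', ∏ x, ((b x)ᴴ *
      Function.update (fun k => (1 : Matrix (α k) (α k) ℂ)) k X x * b x) l l' =
      if l = l' then ((b k)ᴴ * X * b k) l l' else 0 := by
    intro l l'
    split_ifs with hl
    · rw [← Finset.mul_prod_erase _ _ (Finset.mem_univ k), Function.update_self,
        Finset.prod_eq_one, mul_one]
      intro x hx
      rw [Function.update_of_ne (Finset.ne_of_mem_erase hx), Matrix.mul_one, hb, hl,
        Matrix.one_apply_eq]
    · apply Finset.prod_eq_zero (Finset.mem_univ k')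
      rw [Function.update_of_ne hk', Matrix.mul_one, hb, Matrix.one_apply_ne hl]
  simp only [h, mul_ite, mul_zero, Finset.sum_ite_eq, Finset.mem_univ, if_true]
  have hcyc : (b k * diagonal (fun l => ((lam l : ℂ)) ^ 2) * (b k)ᴴ * X).trace =
      ((b k)ᴴ * X * b k * diagonal fun l => ((lam l : ℂ)) ^ 2).trace := by
    rw [Matrix.mul_assoc, Matrix.trace_mul_comm, ← Matrix.mul_assoc]
  rw [hcyc, Matrix.trace]
  refine Finset.sum_congr rfl fun l _ => ?_
  rw [Matrix.diag_apply, Matrix.mul_diagonal]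
  ring

end SchmidtVector

/-! ### Compressions of effects -/

section Compression

variable {α Z : Type*} [Fintype α] [DecidableEq α] [Fintype Z] [DecidableEq Z]

theorem posSemidef_sub_mul_self {A : Matrix α α ℂ} (hA : A.PosSemidef)
    (hA' : (1 - A).PosSemidef) : (A - A * A).PosSemidef := by
  have h1 := hA'.conjTranspose_mul_mul_same A
  have h2 := hA.conjTranspose_mul_mul_same (1 - A)
  rw [hA.isHermitian.eq] at h1
  rw [hA'.isHermitian.eq] at h2
  have : A - A * A = A * (1 - A) * A + (1 - A) * A * (1 - A) := by noncomm_ring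
  rw [this]
  exact h1.add h2

theorem re_mul_self_diag {m : Matrix Z Z ℂ} (hm : m.IsHermitian) (x : Z) :
    ((m * m) x x).re = ∑ y, ‖m x y‖ ^ 2 := by
  rw [Matrix.mul_apply, Complex.re_sum]
  refine Finset.sum_congr rfl fun y _ => ?_
  rw [← hm.apply y x, Complex.star_def, Complex.mul_conj, Complex.normSq_eq_norm_sq,
    Complex.ofReal_re]

theorem sum_norm_sq_weighted {m : Matrix Z Z ℂ} (hm : m.IsHermitian) (w : Z → ℝ) :
    ∑ x, w x ^ 2 * (m x x).re - ∑ x, ∑ y, w x * w y * ‖m x y‖ ^ 2 =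
      ∑ x, w x ^ 2 * ((m - m * m) x x).re + (∑ x, ∑ y, (w x - w y) ^ 2 * ‖m x y‖ ^ 2) / 2 := by
  have hsym : ∑ x, ∑ y, w y ^ 2 * ‖m x y‖ ^ 2 = ∑ x, ∑ y, w x ^ 2 * ‖m x y‖ ^ 2 := by
    rw [Finset.sum_comm]
    refine Finset.sum_congr rfl fun x _ => Finset.sum_congr rfl fun y _ => ?_
    rw [← hm.apply x y, norm_star]
  have h1 : ∑ x, ∑ y, (w x - w y) ^ 2 * ‖m x y‖ ^ 2 =
      ∑ x, ∑ y, w x ^ 2 * ‖m x y‖ ^ 2 + ∑ x, ∑ y, w y ^ 2 * ‖m x y‖ ^ 2 -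
        2 * ∑ x, ∑ y, w x * w y * ‖m x y‖ ^ 2 := by
    simp only [Finset.mul_sum, ← Finset.sum_add_distrib, ← Finset.sum_sub_distrib]
    exact Finset.sum_congr rfl fun x _ => Finset.sum_congr rfl fun y _ => by ring
  have h2 : ∑ x, w x ^ 2 * ((m - m * m) x x).re =
      ∑ x, w x ^ 2 * (m x x).re - ∑ x, ∑ y, w x ^ 2 * ‖m x y‖ ^ 2 := by
    rw [← Finset.sum_sub_distrib]
    refine Finset.sum_congr rfl fun x _ => ?_
    rw [Matrix.sub_apply, Complex.sub_re, re_mul_self_diag hm, mul_sub, Finset.mul_sum]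
  rw [h1, h2, hsym]
  ring

variable {A : Matrix α α ℂ} {B : Matrix α Z ℂ}

theorem compression_posSemidef (hA : A.PosSemidef) : (Bᴴ * A * B).PosSemidef :=
  hA.conjTranspose_mul_mul_same B

theorem one_sub_compression_posSemidef (hA' : (1 - A).PosSemidef) (hB : Bᴴ * B = 1) :
    (1 - Bᴴ * A * B).PosSemidef := by
  have := hA'.conjTranspose_mul_mul_same B
  rwa [Matrix.mul_sub, Matrix.mul_one, Matrix.sub_mul, hB] at this

theorem sum_weighted_le {m : Matrix Z Z ℂ} (hm : m.PosSemidef) (hm' : (1 - m).PosSemidef)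
    (w : Z → ℝ) :
    ∑ x, ∑ y, w x * w y * ‖m x y‖ ^ 2 ≤ ∑ x, w x ^ 2 * (m x x).re := by
  have h := sum_norm_sq_weighted hm.isHermitian w
  have h1 : 0 ≤ ∑ x, w x ^ 2 * ((m - m * m) x x).re :=
    Finset.sum_nonneg fun x _ => mul_nonneg (sq_nonneg _)
      (Complex.le_def.mp ((posSemidef_sub_mul_self hm hm').diag_nonneg (i := x))).1
  have h2 : 0 ≤ ∑ x, ∑ y, (w x - w y) ^ 2 * ‖m x y‖ ^ 2 := by positivity
  linarith

/-- If the weighted bound `sum_weighted_le` is an equality, then `m` is a projection and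
commutes with the weights. -/
theorem projection_of_sum_weighted_eq {m : Matrix Z Z ℂ} (hm : m.PosSemidef)
    (hm' : (1 - m).PosSemidef) {w : Z → ℝ} (hw : ∀ x, 0 < w x)
    (heq : ∑ x, w x ^ 2 * (m x x).re ≤ ∑ x, ∑ y, w x * w y * ‖m x y‖ ^ 2) :
    m * m = m ∧ ∀ x y, m x y ≠ 0 → w x = w y := by
  have h := sum_norm_sq_weighted hm.isHermitian w
  have hPSD := posSemidef_sub_mul_self hm hm'
  have hd : ∀ x, 0 ≤ ((m - m * m) x x).re := fun x =>
    (Complex.le_def.mp (hPSD.diag_nonneg (i := x))).1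
  have h1 : 0 ≤ ∑ x, w x ^ 2 * ((m - m * m) x x).re :=
    Finset.sum_nonneg fun x _ => mul_nonneg (sq_nonneg _) (hd x)
  have h2 : 0 ≤ ∑ x, ∑ y, (w x - w y) ^ 2 * ‖m x y‖ ^ 2 := by positivity
  have h10 : ∑ x, w x ^ 2 * ((m - m * m) x x).re = 0 := by linarith
  have h20 : ∑ x, ∑ y, (w x - w y) ^ 2 * ‖m x y‖ ^ 2 = 0 := by linarith
  constructor
  · have : m - m * m = 0 := by
      apply eq_zero_of_posSemidef_of_diag hPSD
      intro x
      rw [Finset.sum_eq_zero_iff_of_nonneg fun x _ => mul_nonneg (sq_nonneg _) (hd x)] at h10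
      have hre := (mul_eq_zero.mp (h10 x (by simp))).resolve_left (pow_ne_zero _ (hw x).ne')
      have him := (Complex.le_def.mp (hPSD.diag_nonneg (i := x))).2
      exact Complex.ext hre him.symm
    exact (sub_eq_zero.mp this).symm
  · intro x y hxy
    rw [Finset.sum_eq_zero_iff_of_nonneg fun x _ => by positivity] at h20
    have h21 := h20 x (by simp)
    rw [Finset.sum_eq_zero_iff_of_nonneg fun x _ => by positivity] at h21
    have h22 := (mul_eq_zero.mp (h21 y (by simp))).resolve_right
      (pow_ne_zero _ (norm_ne_zero_iff.mpr hxy))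
    exact sub_eq_zero.mp (pow_eq_zero_iff two_ne_zero |>.mp h22)

/-- If the compression of an effect is a projection, then the effect preserves the subspace. -/
theorem mul_eq_of_compression_projection (hA : A.PosSemidef) (hA' : (1 - A).PosSemidef)
    (hB : Bᴴ * B = 1) (hI : (Bᴴ * A * B) * (Bᴴ * A * B) = Bᴴ * A * B) :
    A * B = B * (Bᴴ * A * B) := by
  set m := Bᴴ * A * B with hm
  have hmH : mᴴ = m := (compression_posSemidef hA).isHermitian.eq
  set Z₀ := A * B - B * m with hZ
  have hBm : Bᴴ * (A * B) = m := by rw [hm, Matrix.mul_assoc]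
  have hBA : (A * B)ᴴ * B = m := by
    rw [Matrix.conjTranspose_mul, hA.isHermitian.eq, hm]
  have h1 : Z₀ᴴ * Z₀ = -(Bᴴ * (A - A * A) * B) := by
    have e1 : (A * B)ᴴ * (A * B) = Bᴴ * (A * A) * B := by
      rw [Matrix.conjTranspose_mul, hA.isHermitian.eq]; simp only [Matrix.mul_assoc]
    have e2 : (A * B)ᴴ * (B * m) = m := by rw [← Matrix.mul_assoc, hBA, hI]
    have e3 : (B * m)ᴴ * (A * B) = m := by
      rw [Matrix.conjTranspose_mul, hmH, Matrix.mul_assoc, hBm, hI]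
    have e4 : (B * m)ᴴ * (B * m) = m := by
      rw [Matrix.conjTranspose_mul, hmH, Matrix.mul_assoc, ← Matrix.mul_assoc Bᴴ, hB,
        Matrix.one_mul, hI]
    rw [hZ, Matrix.conjTranspose_sub, Matrix.sub_mul, Matrix.mul_sub, Matrix.mul_sub, e1, e2, e3,
      e4, Matrix.mul_sub, Matrix.sub_mul, ← hm]
    abel
  have h2 := ((posSemidef_sub_mul_self hA hA').conjTranspose_mul_mul_same B).trace_nonneg
  have h3 := (Matrix.posSemidef_conjTranspose_mul_self Z₀).trace_nonneg
  have h4 : (Z₀ᴴ * Z₀).trace = 0 := by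
    refine le_antisymm ?_ h3
    rw [h1, Matrix.trace_neg]
    exact neg_nonpos.mpr h2
  rw [Matrix.trace_conjTranspose_mul_self_eq_zero_iff] at h4
  exact sub_eq_zero.mp h4

end Compression

end FinnerRigidity

namespace FinnerRigidity

open Matrix
open scoped ComplexOrder

/-- Families of pairs are pairs of families. -/
def piProdEquiv {κ : Type*} (α β : κ → Type*) : (∀ k, α k × β k) ≃ (∀ k, α k) × ∀ k, β k where
  toFun ω := (fun k => (ω k).1, fun k => (ω k).2)
  invFun p k := (p.1 k, p.2 k)
  left_inv _ := rfl
  right_inv _ := rfl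

theorem expect_restrict {I : Type*} [Fintype I] [DecidableEq I] {X : I → Type*}
    [∀ i, Fintype (X i)] [∀ i, Nonempty (X i)] {K : Type*} [Field K] [CharZero K]
    (p : I → Prop) [DecidablePred p] (g : (∀ i : {i // p i}, X i) → K) :
    (𝔼 ω : ∀ i, X i, g fun i => ω i) = 𝔼 x, g x := by
  refine (Fintype.expect_equiv (Equiv.piEquivPiSubtypeProd p X) (fun ω => g fun i => ω i)
    (fun y => g y.1) (fun _ => rfl)).trans ?_
  simp only [Fintype.expect_eq_sum_div_card, Fintype.sum_prod_type, Finset.sum_const,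
    Finset.card_univ, Fintype.card_prod, nsmul_eq_mul, ← Finset.mul_sum, Nat.cast_mul]
  rw [mul_comm (Fintype.card (∀ i : {i // p i}, X i) : K), mul_div_mul_left]
  exact Nat.cast_ne_zero.mpr Fintype.card_ne_zero

namespace BipartiteNetwork

variable {I J : Type*} [Fintype I] [Fintype J] [DecidableEq I] [DecidableEq J]
  (N : BipartiteNetwork I J)

theorem exists_pair (i : I) : ∃ p p', p ≠ p' ∧ ∀ j, N.E i j = true → j = p ∨ j = p' := by
  obtain ⟨p, p', hne, h⟩ := exists_pair_of_card_eq_two (N.two_parties i)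
  refine ⟨p, p', fun h' => hne (Subtype.ext h'), fun j hj => ?_⟩
  rcases h ⟨j, hj⟩ with h' | h'
  · exact Or.inl (congrArg Subtype.val h')
  · exact Or.inr (congrArg Subtype.val h')

/-- Two parties share at most one source. -/
theorem eq_of_shared {i k : I} {p p' : J} (hpp : p ≠ p') (hip : N.E i p = true)
    (hip' : N.E i p' = true) (hkp : N.E k p = true) (hkp' : N.E k p' = true) : k = i := by
  refine (N.nonredundant i k fun j hj => ?_).symm
  obtain ⟨a, b, _, h⟩ := N.exists_pair i
  have : j = p ∨ j = p' := by
    rcases h _ hip with rfl | rfl <;> rcases h _ hip' with rfl | rfl <;> rcases h _ hj with rfl | rfl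
      <;> simp_all
  rcases this with rfl | rfl
  · exact hkp
  · exact hkp'

section Classical

variable {X : I → Type*} [∀ i, Fintype (X i)] [∀ i, Nonempty (X i)]

theorem prod_card_sources :
    ∏ j, Fintype.card (∀ i : N.Sources j, X i) = Fintype.card (∀ i, X i) ^ 2 := by
  simp only [Fintype.card_pi]
  rw [N.prod_sources_eq_prod_parties fun i _ _ => Fintype.card (X i), ← Finset.prod_pow]
  refine Finset.prod_congr rfl fun i _ => ?_
  rw [Finset.prod_const, Finset.card_univ, N.two_parties]

theorem prod_sqrt_sum (h : ∀ j, (∀ i : N.Sources j, X i) → ℂ) :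
    ∏ j, √(∑ x, ‖h j x‖ ^ 2) =
      Fintype.card (∀ i, X i) * ∏ j, √(𝔼 ω : ∀ i, X i, ‖h j fun i => ω i‖ ^ 2) := by
  have h1 : ∀ j, ∑ x, ‖h j x‖ ^ 2 = Fintype.card (∀ i : N.Sources j, X i) *
      𝔼 ω : ∀ i, X i, ‖h j fun i => ω i‖ ^ 2 := by
    intro j
    rw [expect_restrict (fun i => N.E i j = true) (fun x => ‖h j x‖ ^ 2),
      Fintype.card_mul_expect]
  simp only [h1]
  rw [← Real.sqrt_prod _ (fun j _ => by
    rw [← h1]; positivity), Finset.prod_mul_distrib, Real.sqrt_mul (by positivity),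
    ← Nat.cast_prod, prod_card_sources, Nat.cast_pow, Real.sqrt_sq (by positivity),
    Real.sqrt_prod _ (fun j _ => Finset.expect_nonneg fun _ _ => by positivity)]

theorem norm_sum_prod_eq (h : ∀ j, (∀ i : N.Sources j, X i) → ℂ) :
    ‖∑ ω : ∀ i, X i, ∏ j, h j fun i => ω i‖ =
      Fintype.card (∀ i, X i) * ‖𝔼 ω : ∀ i, X i, ∏ j, h j fun i => ω i‖ := by
  rw [← Fintype.card_mul_expect, norm_mul, Complex.norm_natCast]

theorem dependsOn_restrict {j : J} (g : (∀ i : N.Sources j, X i) → ℂ) :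
    DependsOn (fun ω : ∀ i, X i => g fun i => ω i) {i | N.E i j = true} := by
  intro ω ω' hω
  exact congrArg g (funext fun i => hω i i.2)

theorem norm_sum_prod_le (h : ∀ j, (∀ i : N.Sources j, X i) → ℂ) :
    ‖∑ ω : ∀ i, X i, ∏ j, h j fun i => ω i‖ ≤ ∏ j, √(∑ x, ‖h j x‖ ^ 2) := by
  rw [prod_sqrt_sum, norm_sum_prod_eq]
  gcongr
  refine le_trans ?_ (expect_prod_le_prod_sqrt Finset.univ
    (fun j (ω : ∀ i, X i) => ‖h j fun i => ω i‖) ?_ ?_ ?_)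
  · simp only [Fintype.expect_eq_sum_div_card, norm_div, Complex.norm_natCast]
    gcongr
    refine (norm_sum_le _ _).trans_eq ?_
    simp [norm_prod]
  · intro j ω; positivity
  · intro j ω ω' h
    rw [show ω = ω' from funext fun i => h i (by simp)]
  · intro i
    obtain ⟨p, p', hne, hcov⟩ := N.exists_pair i
    refine ⟨p, p', hne, fun j h1 h2 ω s => ?_⟩
    congr 1
    refine N.dependsOn_restrict (h j) fun k hk => ?_
    rw [Function.update_of_ne]
    rintro rfl
    exact (hcov j hk).elim h1 h2

theorem mul_star_eq_of_norm_sum_prod_eq {h : ∀ j, (∀ i : N.Sources j, X i) → ℂ}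
    (hpos : ∀ j, 0 < ∑ x, ‖h j x‖ ^ 2)
    (heq : ∏ j, √(∑ x, ‖h j x‖ ^ 2) ≤ ‖∑ ω : ∀ i, X i, ∏ j, h j fun i => ω i‖)
    {i : I} {p p' : J} (hpp : p ≠ p') (hip : N.E i p = true) (hip' : N.E i p' = true)
    (x : ∀ i : N.Sources p, X i) (x' : ∀ i : N.Sources p', X i) (s t : X i) :
    h p (Function.update x ⟨i, hip⟩ s) * star (h p' (Function.update x' ⟨i, hip'⟩ t)) =
      h p (Function.update x ⟨i, hip⟩ t) * star (h p' (Function.update x' ⟨i, hip'⟩ s)) := by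
  have hlift : ∀ {p : J} (x : ∀ i : N.Sources p, X i), ∃ ω : ∀ i, X i,
      ∀ (i : N.Sources p) (s : X i), (fun k : N.Sources p => Function.update ω i.1 s k) =
        Function.update x i s := by
    intro p x
    refine ⟨fun i => if h : N.E i p = true then x ⟨i, h⟩ else Classical.arbitrary _, ?_⟩
    intro i s
    funext k
    by_cases hk : k = i
    · subst hk; simp
    · have : k.1 ≠ i.1 := fun h => hk (Subtype.ext h)
      rw [Function.update_of_ne hk, Function.update_of_ne this, dif_pos k.2]
  obtain ⟨ω, hω⟩ := hlift x
  obtain ⟨ω', hω'⟩ := hlift x'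
  have hcard : (0 : ℝ) < Fintype.card (∀ i, X i) := by
    exact_mod_cast Fintype.card_pos
  have := mul_star_eq_of_finner_eq (fun j => {i | N.E i j = true})
    (fun j (ω : ∀ i, X i) => h j fun i => ω i) (fun j => N.dependsOn_restrict (h j))
    N.exists_pair ?_ ?_ hpp hip hip'
    (fun k hk hk' => N.eq_of_shared hpp hip hip' hk hk') ω ω' s t
  · have e1 := fun s => hω ⟨i, hip⟩ s
    have e2 := fun s => hω' ⟨i, hip'⟩ s
    simp only at e1 e2
    simpa only [e1, e2] using this
  · intro j
    rw [expect_restrict (fun i => N.E i j = true) (fun x => ‖h j x‖ ^ 2),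
      Fintype.expect_eq_sum_div_card]
    exact div_pos (hpos j) (by exact_mod_cast Fintype.card_pos)
  · rw [prod_sqrt_sum, norm_sum_prod_eq] at heq
    exact le_of_mul_le_mul_left heq hcard

end Classical

section Pure

variable {K : I → J → Type*} [∀ i j, Fintype (K i j)] [∀ i j, DecidableEq (K i j)]
  {D : I → Type*} [∀ i, Fintype (D i)] [∀ i, DecidableEq (D i)]

/-- The state of the source `i` with Schmidt coefficients `lam i` and Schmidt vectors `b i`. -/
noncomputable def schmidtState (lam : ∀ i, D i → ℝ) (b : ∀ i j, Matrix (K i j) (D i) ℂ) (i : I) :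
    Matrix (N.SourceIdx K i) (N.SourceIdx K i) ℂ :=
  vecMulVec (schmidtVec (lam i) fun j : N.Parties i => b i j)
    (star (schmidtVec (lam i) fun j : N.Parties i => b i j))

/-- The product of the Schmidt vectors of the systems received by the party `j`. -/
noncomputable def partyFrame (b : ∀ i j, Matrix (K i j) (D i) ℂ) (j : J) :
    Matrix (N.PartyIdx K j) (∀ i : N.Sources j, D i) ℂ :=
  tensor fun i : N.Sources j => b i j

variable {lam : ∀ i, D i → ℝ} {b : ∀ i j, Matrix (K i j) (D i) ℂ}

theorem partyFrame_isometry (hb : ∀ i j, N.E i j = true → (b i j)ᴴ * b i j = 1) (j : J) :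
    (N.partyFrame b j)ᴴ * N.partyFrame b j = 1 := by
  rw [partyFrame, tensor_conjTranspose, tensor_mul, ← tensor_one]
  congr 1
  funext i
  exact hb _ _ i.2

theorem partyState_schmidtState (hb : ∀ i j, N.E i j = true → (b i j)ᴴ * b i j = 1) (j : J) :
    N.partyState (N.schmidtState lam b) j =
      N.partyFrame b j * (tensor fun i : N.Sources j => diagonal fun l => (lam i l : ℂ) ^ 2) *
        (N.partyFrame b j)ᴴ := by
  rw [partyState, partyFrame, tensor_conjTranspose, tensor_mul, tensor_mul]
  congr 1
  funext i
  exact marginal_schmidtVec (by rw [N.two_parties]; norm_num) _ (fun j => hb _ _ j.2) _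

theorem expectation_schmidtState (A : ∀ j, Matrix (N.PartyIdx K j) (N.PartyIdx K j) ℂ) :
    N.expectation (N.schmidtState lam b) A = ∑ x : ∀ i, D i, ∑ y : ∀ i, D i,
      (∏ i, (lam i (x i) : ℂ)) * (∏ i, (lam i (y i) : ℂ)) *
        ∏ j, ((N.partyFrame b j)ᴴ * A j * N.partyFrame b j) (fun i => x i) (fun i => y i) := by
  set Ψ : N.GlobalIdx K → ℂ := fun x =>
    ∏ i, schmidtVec (lam i) (fun j : N.Parties i => b i j) (x i) with hΨ
  let copy : (∀ i, D i) → ∀ j, ∀ i : N.Sources j, D i := fun x j i => x i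
  set B := (tensor fun j => N.partyFrame b j).submatrix (N.partyEquiv K) copy with hB
  have hstate : tensor (N.schmidtState lam b) = vecMulVec Ψ (star Ψ) := by
    ext x y
    simp [hΨ, schmidtState, vecMulVec_apply, Finset.prod_mul_distrib]
  have hΨB : Ψ = B *ᵥ fun x => ∏ i, (lam i (x i) : ℂ) := by
    funext x
    simp only [hΨ, schmidtVec]
    rw [Finset.prod_univ_sum, Fintype.piFinset_univ]
    simp only [Matrix.mulVec, dotProduct]
    refine Finset.sum_congr rfl fun l _ => ?_
    rw [Finset.prod_mul_distrib, mul_comm]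
    congr 1
    exact (N.prod_sources_eq_prod_parties fun i j h => b i j (x i ⟨j, h⟩) (l i)).symm
  have hBAB : Bᴴ * (N.globalOp A * B) =
      (tensor fun j => (N.partyFrame b j)ᴴ * A j * N.partyFrame b j).submatrix copy copy := by
    rw [hB, globalOp, Matrix.submatrix_mul_equiv, Matrix.conjTranspose_submatrix,
      Matrix.submatrix_mul_equiv, tensor_conjTranspose, tensor_mul, tensor_mul]
    simp only [Matrix.mul_assoc]
  rw [expectation, hstate, trace_mul_vecMulVec_star, hΨB, Matrix.star_mulVec,
    ← Matrix.dotProduct_mulVec, Matrix.mulVec_mulVec, Matrix.mulVec_mulVec, Matrix.mul_assoc, hBAB]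
  simp only [dotProduct, Matrix.mulVec, Matrix.submatrix_apply, tensor_apply, Pi.star_apply,
    star_prod, Complex.star_def, Complex.conj_ofReal, Finset.mul_sum]
  refine Finset.sum_congr rfl fun x _ => Finset.sum_congr rfl fun y _ => ?_
  simp only [copy]
  ring

theorem expectation_schmidtState_update (hb : ∀ i j, N.E i j = true → (b i j)ᴴ * b i j = 1)
    (hone : ∀ i, (N.schmidtState lam b i).trace = 1) (j : J)
    (A : Matrix (N.PartyIdx K j) (N.PartyIdx K j) ℂ) :
    N.expectation (N.schmidtState lam b) (Function.update (fun _ => 1) j A) =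
      ∑ x : ∀ i : N.Sources j, D i, ((∏ i : N.Sources j, lam i (x i) : ℝ) : ℂ) ^ 2 *
        ((N.partyFrame b j)ᴴ * A * N.partyFrame b j) x x := by
  rw [N.expectation_update_one hone, partyState_schmidtState N hb, Matrix.mul_assoc,
    Matrix.mul_assoc, Matrix.trace_mul_comm, Matrix.mul_assoc, Matrix.trace]
  refine Finset.sum_congr rfl fun x _ => ?_
  have hdiag : (tensor fun i : N.Sources j => diagonal fun l => (lam i l : ℂ) ^ 2) =
      diagonal fun x => ((∏ i : N.Sources j, lam i (x i) : ℝ) : ℂ) ^ 2 := by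
    ext x y
    by_cases h : x = y
    · subst h
      simp [Finset.prod_pow]
    · rw [Matrix.diagonal_apply_ne _ h, tensor_apply]
      obtain ⟨k, hk⟩ := Function.ne_iff.mp h
      exact Finset.prod_eq_zero (Finset.mem_univ k) (Matrix.diagonal_apply_ne _ hk)
  rw [hdiag, Matrix.diag_apply, Matrix.diagonal_mul, Matrix.mul_assoc]

end Pure

end BipartiteNetwork

end FinnerRigidity

namespace FinnerRigidity

open Matrix
open scoped ComplexOrder

namespace BipartiteNetwork

section PureRigidity

variable {I J : Type*} [Fintype I] [Fintype J] [DecidableEq I] [DecidableEq J]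
  (N : BipartiteNetwork I J)
  {K : I → J → Type*} [∀ i j, Fintype (K i j)] [∀ i j, DecidableEq (K i j)]
  {D : I → Type*} [∀ i, Fintype (D i)] [∀ i, DecidableEq (D i)]
  {lam : ∀ i, D i → ℝ} {b : ∀ i j, Matrix (K i j) (D i) ℂ}

/-- The matrix `m` of a party with the square roots of the Schmidt coefficients distributed to
its rows and columns, as a function of pairs of indices. -/
noncomputable def weightedEntry (lam : ∀ i, D i → ℝ) (j : J)
    (m : Matrix (∀ i : N.Sources j, D i) (∀ i : N.Sources j, D i) ℂ)
    (ω : ∀ i : N.Sources j, D i × D i) : ℂ :=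
  ((∏ i : N.Sources j, (√(lam i (ω i).1) * √(lam i (ω i).2)) : ℝ) : ℂ) *
    m (fun i => (ω i).1) (fun i => (ω i).2)

theorem expectation_eq_sum_weightedEntry (hlam : ∀ i l, 0 < lam i l)
    (A : ∀ j, Matrix (N.PartyIdx K j) (N.PartyIdx K j) ℂ) :
    N.expectation (N.schmidtState lam b) A = ∑ ω : ∀ i, D i × D i, ∏ j,
      N.weightedEntry lam j ((N.partyFrame b j)ᴴ * A j * N.partyFrame b j) fun i => ω i := by
  rw [expectation_schmidtState, ← Fintype.sum_prod_type', ← (piProdEquiv D D).sum_comp]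
  refine Finset.sum_congr rfl fun ω _ => ?_
  simp only [weightedEntry, Finset.prod_mul_distrib (s := (Finset.univ : Finset J)), piProdEquiv,
    Equiv.coe_fn_mk]
  congr 1
  rw [← Complex.ofReal_prod, ← Complex.ofReal_prod, ← Complex.ofReal_prod, ← Complex.ofReal_mul,
    N.prod_sources_eq_prod_parties fun i _ _ => √(lam i (ω i).1) * √(lam i (ω i).2),
    ← Finset.prod_mul_distrib]
  congr 1
  refine Finset.prod_congr rfl fun i _ => ?_
  rw [Finset.prod_const, Finset.card_univ, N.two_parties, mul_pow, Real.sq_sqrt (hlam _ _).le,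
    Real.sq_sqrt (hlam _ _).le]

theorem sum_norm_sq_weightedEntry (hlam : ∀ i l, 0 < lam i l) (j : J)
    (m : Matrix (∀ i : N.Sources j, D i) (∀ i : N.Sources j, D i) ℂ) :
    ∑ ω, ‖N.weightedEntry lam j m ω‖ ^ 2 =
      ∑ x, ∑ y, (∏ i : N.Sources j, lam i (x i)) * (∏ i : N.Sources j, lam i (y i)) *
        ‖m x y‖ ^ 2 := by
  rw [← Fintype.sum_prod_type', ← (piProdEquiv (fun i : N.Sources j => D i) _).sum_comp]
  refine Finset.sum_congr rfl fun ω _ => ?_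
  simp only [weightedEntry, norm_mul, mul_pow, Complex.norm_real, Real.norm_eq_abs, sq_abs,
    piProdEquiv, Equiv.coe_fn_mk]
  congr 1
  rw [← Finset.prod_pow, ← Finset.prod_mul_distrib]
  refine Finset.prod_congr rfl fun i _ => ?_
  rw [mul_pow, Real.sq_sqrt (hlam _ _).le, Real.sq_sqrt (hlam _ _).le]

theorem exists_weightedEntry_update (hlam : ∀ i l, 0 < lam i l) {j : J}
    (m : Matrix (∀ i : N.Sources j, D i) (∀ i : N.Sources j, D i) ℂ)
    (x y : ∀ i : N.Sources j, D i) (k : N.Sources j) :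
    ∃ r : ℂ, r ≠ 0 ∧ ∀ s : D k × D k,
      N.weightedEntry lam j m (Function.update (fun i => (x i, y i)) k s) =
        r * ((√(lam k s.1) * √(lam k s.2) : ℝ) : ℂ) *
          m (Function.update x k s.1) (Function.update y k s.2) := by
  refine ⟨((∏ i ∈ Finset.univ.erase k, (√(lam i (x i)) * √(lam i (y i))) : ℝ) : ℂ), ?_, fun s => ?_⟩
  · rw [Complex.ofReal_ne_zero]
    exact Finset.prod_ne_zero_iff.mpr fun i _ =>
      (mul_pos (Real.sqrt_pos.mpr (hlam _ _)) (Real.sqrt_pos.mpr (hlam _ _))).ne'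
  · rw [weightedEntry, fst_update, snd_update, ← Finset.mul_prod_erase _ _ (Finset.mem_univ k),
      Function.update_self, Complex.ofReal_mul, mul_comm (Complex.ofReal (_ * _))]
    congr 3
    refine Finset.prod_congr rfl fun i hi => ?_
    rw [Function.update_of_ne (Finset.ne_of_mem_erase hi)]

theorem nonempty_of_trace_schmidtState {i : I} (hone : (N.schmidtState lam b i).trace = 1) :
    Nonempty (D i) := by
  by_contra h
  rw [not_nonempty_iff] at h
  have : schmidtVec (lam i) (fun j : N.Parties i => b i j) = 0 := by
    funext x; simp [schmidtVec]
  rw [schmidtState, this] at hone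
  simp at hone

theorem eq_of_prod_sqrt_le {a c : J → ℝ} (ha : ∀ j, 0 < a j) (hac : ∀ j, c j ≤ a j)
    (h : √(∏ j, a j) ≤ ∏ j, √(c j)) (j : J) : c j = a j := by
  rw [Real.sqrt_prod _ fun j _ => (ha j).le] at h
  have hpos : 0 < ∏ j, √(c j) :=
    lt_of_lt_of_le (Finset.prod_pos fun j _ => Real.sqrt_pos.mpr (ha j)) h
  have hc : ∀ j, 0 < √(c j) := fun j =>
    lt_of_le_of_ne (Real.sqrt_nonneg _)
      (Ne.symm (Finset.prod_ne_zero_iff.mp hpos.ne' j (Finset.mem_univ j)))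
  by_contra hne
  have hlt : √(c j) < √(a j) :=
    Real.sqrt_lt_sqrt (Real.sqrt_pos.mp (hc j)).le (lt_of_le_of_ne (hac j) hne)
  exact absurd h (not_le.mpr (Finset.prod_lt_prod (fun j _ => hc j)
    (fun j _ => Real.sqrt_le_sqrt (hac j)) ⟨j, Finset.mem_univ j, hlt⟩))

/-- Rigidity of the Finner inequality for pure states: in the Schmidt bases, the effects are tensor
products of projections which commute with the Schmidt coefficients and match at the two ends of
each source. -/
theorem exists_projections_of_pure (hlam : ∀ i l, 0 < lam i l)
    (hb : ∀ i j, N.E i j = true → (b i j)ᴴ * b i j = 1)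
    (hone : ∀ i, (N.schmidtState lam b i).trace = 1)
    {A : ∀ j, Matrix (N.PartyIdx K j) (N.PartyIdx K j) ℂ}
    (hA : ∀ j, (A j).PosSemidef) (hA' : ∀ j, (1 - A j).PosSemidef)
    (hpos : ∀ j, 0 < (N.expectation (N.schmidtState lam b)
      (Function.update (fun _ => 1) j (A j))).re)
    (hsat : √(∏ j, (N.expectation (N.schmidtState lam b)
      (Function.update (fun _ => 1) j (A j))).re) ≤ ‖N.expectation (N.schmidtState lam b) A‖) :
    ∃ P : ∀ j (i : N.Sources j), Matrix (D i) (D i) ℂ,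
      (∀ j i, (P j i).IsHermitian ∧ P j i * P j i = P j i ∧ P j i ≠ 0) ∧
      (∀ j, A j * N.partyFrame b j = N.partyFrame b j * tensor (P j)) ∧
      (∀ j j' i (h : N.E i j = true) (h' : N.E i j' = true), j ≠ j' →
        P j ⟨i, h⟩ = (P j' ⟨i, h'⟩)ᵀ) ∧
      ∀ j i l l', P j i l l' ≠ 0 → lam i l = lam i l' := by
  have hne : ∀ i, Nonempty (D i) := fun i => N.nonempty_of_trace_schmidtState (hone i)
  set m := fun j => (N.partyFrame b j)ᴴ * A j * N.partyFrame b j with hm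
  set w : ∀ j, (∀ i : N.Sources j, D i) → ℝ := fun j x => ∏ i : N.Sources j, lam i (x i) with hw
  have hwpos : ∀ j x, 0 < w j x := fun j x => Finset.prod_pos fun i _ => hlam _ _
  have hmPSD : ∀ j, (m j).PosSemidef := fun j => compression_posSemidef (hA j)
  have hmPSD' : ∀ j, (1 - m j).PosSemidef := fun j =>
    one_sub_compression_posSemidef (hA' j) (N.partyFrame_isometry hb j)
  have hP : ∀ j, (N.expectation (N.schmidtState lam b)
      (Function.update (fun _ => 1) j (A j))).re = ∑ x, w j x ^ 2 * (m j x x).re := by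
    intro j
    rw [expectation_schmidtState_update N hb hone, Complex.re_sum]
    refine Finset.sum_congr rfl fun x _ => ?_
    rw [← Complex.ofReal_pow, Complex.re_ofReal_mul]
  simp only [hP] at hpos hsat
  have hE := N.expectation_eq_sum_weightedEntry (b := b) hlam A
  have hbound := N.norm_sum_prod_le (X := fun i => D i × D i)
    (fun j => N.weightedEntry lam j (m j))
  have hle : ∀ j, ∑ ω, ‖N.weightedEntry lam j (m j) ω‖ ^ 2 ≤ ∑ x, w j x ^ 2 * (m j x x).re := by
    intro j
    rw [N.sum_norm_sq_weightedEntry hlam]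
    exact sum_weighted_le (hmPSD j) (hmPSD' j) (w j)
  rw [hE] at hsat
  have heq := eq_of_prod_sqrt_le hpos hle (hsat.trans hbound)
  have hproj : ∀ j, m j * m j = m j ∧ ∀ x y, m j x y ≠ 0 → w j x = w j y := by
    intro j
    refine projection_of_sum_weighted_eq (hmPSD j) (hmPSD' j) (hwpos j) ?_
    rw [← heq j, N.sum_norm_sq_weightedEntry hlam]
  have hrigid := fun i p p' hpp hip hip' => N.mul_star_eq_of_norm_sum_prod_eq
    (X := fun i => D i × D i) (h := fun j => N.weightedEntry lam j (m j))
    (fun j => by rw [heq j]; exact hpos j)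
    (by
      refine le_trans (le_of_eq ?_) hsat
      simp only [heq]
      rw [Real.sqrt_prod _ fun j _ => (hpos j).le])
    (i := i) (p := p) (p' := p') hpp hip hip'
  have hcross : ∀ i p p' (_ : p ≠ p') (hip : N.E i p = true) (hip' : N.E i p' = true)
      (x y : ∀ i : N.Sources p, D i) (x' y' : ∀ i : N.Sources p', D i) (s t : D i × D i),
      m p (Function.update x ⟨i, hip⟩ s.1) (Function.update y ⟨i, hip⟩ s.2) *
        star (m p' (Function.update x' ⟨i, hip'⟩ t.1) (Function.update y' ⟨i, hip'⟩ t.2)) =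
      m p (Function.update x ⟨i, hip⟩ t.1) (Function.update y ⟨i, hip⟩ t.2) *
        star (m p' (Function.update x' ⟨i, hip'⟩ s.1) (Function.update y' ⟨i, hip'⟩ s.2)) := by
    intro i p p' hpp hip hip' x y x' y' s t
    obtain ⟨r, hr, h1⟩ := N.exists_weightedEntry_update hlam (m p) x y ⟨i, hip⟩
    obtain ⟨r', hr', h2⟩ := N.exists_weightedEntry_update hlam (m p') x' y' ⟨i, hip'⟩
    have h := hrigid i p p' hpp hip hip' (fun i => (x i, y i)) (fun i => (x' i, y' i)) s t
    simp only [h1, h2, star_mul', Complex.star_def, Complex.conj_ofReal] at h ⊢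
    have hg : ∀ s : D i × D i, ((√(lam i s.1) * √(lam i s.2) : ℝ) : ℂ) ≠ 0 := fun s =>
      Complex.ofReal_ne_zero.mpr
        (mul_pos (Real.sqrt_pos.mpr (hlam _ _)) (Real.sqrt_pos.mpr (hlam _ _))).ne'
    have hr'' : (starRingEnd ℂ) r' ≠ 0 := by simpa using hr'
    apply mul_left_cancel₀ (mul_ne_zero (mul_ne_zero hr hr'') (mul_ne_zero (hg s) (hg t)))
    linear_combination h
  have hmne : ∀ j, m j ≠ 0 := by
    intro j h0
    have := hpos j
    simp [h0] at this
  have hother : ∀ i j, N.E i j = true → ∃ j', j ≠ j' ∧ N.E i j' = true := by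
    intro i j h
    obtain ⟨j', hj'⟩ := Fintype.exists_ne_of_one_lt_card
      (by rw [N.two_parties i]; norm_num) (⟨j, h⟩ : N.Parties i)
    exact ⟨j', fun h' => hj' (Subtype.ext h'.symm), j'.2⟩
  have hsep := fun j => exists_tensor_projections (hmPSD j).isHermitian (hproj j).1 (hmne j) (by
    rintro ⟨i, hi⟩ x y x' y' s t
    obtain ⟨j', hjj', hij'⟩ := hother i j hi
    obtain ⟨u, v, huv⟩ : ∃ u v, m j' u v ≠ 0 := by
      by_contra! h
      exact hmne j' (by ext u v; exact h u v)
    have c1 := hcross i j j' hjj' hi hij' x y u v s (u ⟨i, hij'⟩, v ⟨i, hij'⟩)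
    have c2 := hcross i j j' hjj' hi hij' x y u v t (u ⟨i, hij'⟩, v ⟨i, hij'⟩)
    have c3 := hcross i j j' hjj' hi hij' x' y' u v s (u ⟨i, hij'⟩, v ⟨i, hij'⟩)
    have c4 := hcross i j j' hjj' hi hij' x' y' u v t (u ⟨i, hij'⟩, v ⟨i, hij'⟩)
    simp only [Function.update_eq_self] at c1 c2 c3 c4
    have hf : star (m j' u v) ≠ 0 := star_ne_zero.mpr huv
    apply mul_left_cancel₀ (mul_ne_zero hf hf)
    generalize star (m j' u v) = f at *
    generalize star (m j' (Function.update u ⟨i, hij'⟩ s.1) (Function.update v ⟨i, hij'⟩ s.2)) = fs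
      at *
    generalize star (m j' (Function.update u ⟨i, hij'⟩ t.1) (Function.update v ⟨i, hij'⟩ t.2)) = ft
      at *
    linear_combination (m j (Function.update x' ⟨i, hi⟩ t.1) (Function.update y' ⟨i, hi⟩ t.2) * f) * c1
      - (m j (Function.update x' ⟨i, hi⟩ s.1) (Function.update y' ⟨i, hi⟩ s.2) * f) * c2
      - (m j (Function.update x ⟨i, hi⟩ (u ⟨i, hij'⟩)) (Function.update y ⟨i, hi⟩ (v ⟨i, hij'⟩)) * ft) * c3
      + (m j (Function.update x ⟨i, hi⟩ (u ⟨i, hij'⟩)) (Function.update y ⟨i, hi⟩ (v ⟨i, hij'⟩)) * fs) * c4)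
  choose P x₀ c hmP hx₀ hPprop using hsep
  refine ⟨P, fun j i => ⟨(hPprop j i).1, (hPprop j i).2.1, (hPprop j i).2.2.1⟩, ?_, ?_, ?_⟩
  · intro j
    rw [← hmP j]
    exact mul_eq_of_compression_projection (hA j) (hA' j) (N.partyFrame_isometry hb j) (hproj j).1
  · intro j j' i h h' hjj'
    obtain ⟨hH, hI, hne0, hc, hPm⟩ := hPprop j ⟨i, h⟩
    obtain ⟨hH', hI', hne0', hc', hPm'⟩ := hPprop j' ⟨i, h'⟩
    have hrel : ∀ s t : D i × D i, P j ⟨i, h⟩ s.1 s.2 * star (P j' ⟨i, h'⟩ t.1 t.2) =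
        P j ⟨i, h⟩ t.1 t.2 * star (P j' ⟨i, h'⟩ s.1 s.2) := by
      intro s t
      have := hcross i j j' hjj' h h' (x₀ j) (x₀ j) (x₀ j') (x₀ j') s t
      rw [hPm, hPm, hPm', hPm', star_mul', star_mul']
      linear_combination (c j ⟨i, h⟩ * star (c j' ⟨i, h'⟩)) * this
    obtain ⟨u, v, huv⟩ : ∃ u v, P j' ⟨i, h'⟩ u v ≠ 0 := by
      by_contra! h0
      exact hne0' (by ext u v; exact h0 u v)
    have hsc : P j ⟨i, h⟩ = (P j ⟨i, h⟩ u v / star (P j' ⟨i, h'⟩ u v)) • (P j' ⟨i, h'⟩)ᵀ := by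
      ext l l'
      rw [Matrix.smul_apply, Matrix.transpose_apply, smul_eq_mul, ← hH'.apply l' l,
        div_mul_eq_mul_div, eq_div_iff (star_ne_zero.mpr huv)]
      exact hrel (l, l') (u, v)
    generalize P j ⟨i, h⟩ u v / star (P j' ⟨i, h'⟩ u v) = z at hsc
    have hz : z = 1 := by
      have hz0 : z ≠ 0 := by
        rintro rfl
        rw [zero_smul] at hsc
        exact hne0 hsc
      rw [hsc, Matrix.smul_mul, Matrix.mul_smul, ← Matrix.transpose_mul, hI', smul_smul] at hI
      have := congrFun (congrFun hI v) u
      simp only [Matrix.smul_apply, Matrix.transpose_apply, smul_eq_mul] at this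
      exact mul_left_cancel₀ hz0 ((mul_right_cancel₀ huv this).trans (mul_one z).symm)
    rw [hsc, hz, one_smul]
  · intro j i l l' hll
    obtain ⟨-, -, -, -, hPm⟩ := hPprop j i
    rw [hPm] at hll
    have := (hproj j).2 _ _ (right_ne_zero_of_mul hll)
    simp only [hw] at this
    rw [← Finset.mul_prod_erase _ _ (Finset.mem_univ i),
      ← Finset.mul_prod_erase _ _ (Finset.mem_univ i), Function.update_self,
      Function.update_self] at this
    have hr : ∏ k ∈ Finset.univ.erase i, lam k (Function.update (x₀ j) i l k) =
        ∏ k ∈ Finset.univ.erase i, lam k (Function.update (x₀ j) i l' k) :=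
      Finset.prod_congr rfl fun k hk => by
        rw [Function.update_of_ne (Finset.ne_of_mem_erase hk),
          Function.update_of_ne (Finset.ne_of_mem_erase hk)]
    rw [hr] at this
    exact mul_right_cancel₀ (Finset.prod_ne_zero_iff.mpr fun k _ => (hlam _ _).ne') this

end PureRigidity

end BipartiteNetwork

end FinnerRigidity

namespace FinnerRigidity

open Matrix
open scoped ComplexOrder Kronecker

/-! ### Purifications -/

section Inflate

variable {κ : Type*} [Fintype κ] [DecidableEq κ] {α : κ → Type*} [∀ k, Fintype (α k)]
  [∀ k, DecidableEq (α k)] (ε : κ → Type*) [∀ k, Fintype (ε k)] [∀ k, DecidableEq (ε k)]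

/-- An operator on `⨂ₖ ℂ^(α k)` acting trivially on additional factors `ℂ^(ε k)`. -/
def inflate (A : Matrix (∀ k, α k) (∀ k, α k) ℂ) :
    Matrix (∀ k, α k × ε k) (∀ k, α k × ε k) ℂ :=
  Matrix.of fun z w => A (fun k => (z k).1) (fun k => (w k).1) *
    if (∀ k, (z k).2 = (w k).2) then 1 else 0

theorem inflate_eq_submatrix (A : Matrix (∀ k, α k) (∀ k, α k) ℂ) :
    inflate ε A = (A ⊗ₖ (1 : Matrix (∀ k, ε k) (∀ k, ε k) ℂ)).submatrix (piProdEquiv α ε)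
      (piProdEquiv α ε) := by
  ext z w
  simp [inflate, piProdEquiv, Matrix.one_apply, funext_iff]

theorem inflate_mul (A B : Matrix (∀ k, α k) (∀ k, α k) ℂ) :
    inflate ε (A * B) = inflate ε A * inflate ε B := by
  rw [inflate_eq_submatrix, inflate_eq_submatrix, inflate_eq_submatrix,
    Matrix.submatrix_mul_equiv, ← Matrix.mul_kronecker_mul, Matrix.mul_one]

theorem inflate_conjTranspose (A : Matrix (∀ k, α k) (∀ k, α k) ℂ) :
    (inflate ε A)ᴴ = inflate ε Aᴴ := by
  rw [inflate_eq_submatrix, inflate_eq_submatrix, Matrix.conjTranspose_submatrix,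
    Matrix.conjTranspose_kronecker, Matrix.conjTranspose_one]

theorem inflate_one : inflate ε (1 : Matrix (∀ k, α k) (∀ k, α k) ℂ) = 1 := by
  rw [inflate_eq_submatrix, Matrix.one_kronecker_one, Matrix.submatrix_one_equiv]

theorem inflate_sub (A B : Matrix (∀ k, α k) (∀ k, α k) ℂ) :
    inflate ε (A - B) = inflate ε A - inflate ε B := by
  ext z w
  simp only [inflate, Matrix.of_apply, Matrix.sub_apply, sub_mul]

theorem inflate_posSemidef {A : Matrix (∀ k, α k) (∀ k, α k) ℂ} (hA : A.PosSemidef) :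
    (inflate ε A).PosSemidef := by
  rw [inflate_eq_submatrix]
  exact (hA.kronecker Matrix.PosSemidef.one).submatrix _

theorem inflate_tensor (X : ∀ k, Matrix (α k) (α k) ℂ) :
    inflate ε (tensor X) = tensor fun k => X k ⊗ₖ (1 : Matrix (ε k) (ε k) ℂ) := by
  ext z w
  simp only [inflate, Matrix.of_apply, tensor_apply, Matrix.kroneckerMap_apply,
    Finset.prod_mul_distrib, Matrix.one_apply, Finset.prod_ite_zero, Finset.prod_const_one,
    Finset.mem_univ, true_implies]

theorem inflate_site (k : κ) (X : Matrix (α k) (α k) ℂ) :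
    inflate ε (site k X) = site k (X ⊗ₖ (1 : Matrix (ε k) (ε k) ℂ)) := by
  rw [site, site, inflate_tensor]
  congr 1
  funext l
  by_cases h : l = k
  · subst h; simp
  · simp [Function.update_of_ne h]

end Inflate

theorem trace_submatrix_equiv {α β : Type*} [Fintype α] [Fintype β] (e : α ≃ β)
    (A : Matrix β β ℂ) : (A.submatrix e e).trace = A.trace := by
  simp only [Matrix.trace, Matrix.diag_apply, Matrix.submatrix_apply]
  exact e.sum_comp fun x => A x x

theorem trace_mul_of_purification {X Y : Type*} [Fintype X] [Fintype Y] [DecidableEq Y]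
    {ρ : Matrix X X ℂ} {Ψ : X × Y → ℂ} (hρ : ∀ x y, ρ x y = ∑ ε, Ψ (x, ε) * star (Ψ (y, ε)))
    (G : Matrix X X ℂ) :
    (ρ * G).trace = (vecMulVec Ψ (star Ψ) * (G ⊗ₖ (1 : Matrix Y Y ℂ))).trace := by
  simp only [Matrix.trace, Matrix.diag_apply, Matrix.mul_apply, Matrix.kroneckerMap_apply,
    Fintype.sum_prod_type, hρ, Finset.sum_mul, vecMulVec_apply, Pi.star_apply, Matrix.one_apply,
    mul_ite, mul_one, mul_zero, Finset.sum_ite_eq', Finset.mem_univ, if_true]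
  refine Finset.sum_congr rfl fun x _ => ?_
  rw [Finset.sum_comm]

namespace QuantumModel

open BipartiteNetwork

variable {I J : Type*} [Fintype I] [Fintype J] [DecidableEq I] [DecidableEq J]
  {N : BipartiteNetwork I J} {Q : I → J → Type*} {O : J → Type*}
  [∀ i j, Fintype (Q i j)] [∀ i j, DecidableEq (Q i j)] [∀ j, Fintype (O j)]
  {q : QuantumModel N Q O} {E : I → J → Type*} [∀ i j, Fintype (E i j)]
  [∀ i j, DecidableEq (E i j)] {Ψ : ∀ i, N.SourceIdx Q i × N.SourceIdx E i → ℂ}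

/-- The pure state of the enlarged systems emitted by the source `i`. -/
noncomputable def absorbState (Ψ : ∀ i, N.SourceIdx Q i × N.SourceIdx E i → ℂ) (i : I) :
    Matrix (N.SourceIdx (fun i j => Q i j × E i j) i)
      (N.SourceIdx (fun i j => Q i j × E i j) i) ℂ :=
  vecMulVec (absorb Ψ i) (star (absorb Ψ i))

theorem absorbState_posSemidef (i : I) : (absorbState Ψ i).PosSemidef :=
  Matrix.posSemidef_vecMulVec_self_star _

theorem trace_mul_eq_absorb (hΨ : q.IsPurification Ψ) (i : I)
    (X : Matrix (N.SourceIdx Q i) (N.SourceIdx Q i) ℂ) :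
    (q.ρ i * X).trace =
      (absorbState Ψ i * inflate (fun j : N.Parties i => E i j) X).trace := by
  rw [trace_mul_of_purification (hΨ i), inflate_eq_submatrix]
  rw [← trace_submatrix_equiv (piProdEquiv (fun j : N.Parties i => Q i j) fun j => E i j),
    ← Matrix.submatrix_mul_equiv _ _ _ (piProdEquiv (fun j : N.Parties i => Q i j) fun j => E i j)]
  rfl

theorem trace_absorbState (hΨ : q.IsPurification Ψ) (i : I) : (absorbState Ψ i).trace = 1 := by
  have := trace_mul_eq_absorb hΨ i 1
  rwa [inflate_one, Matrix.mul_one, Matrix.mul_one, q.ρ_trace, eq_comm] at this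

theorem mul_rho_eq_zero_iff (hΨ : q.IsPurification Ψ) {i : I}
    {X : Matrix (N.SourceIdx Q i) (N.SourceIdx Q i) ℂ} :
    X * q.ρ i = 0 ↔ inflate (fun j : N.Parties i => E i j) X * absorbState Ψ i = 0 := by
  have h := trace_mul_eq_absorb hΨ i (Xᴴ * X)
  rw [inflate_mul, ← inflate_conjTranspose] at h
  exact ⟨mul_eq_zero_of_trace_eq (absorbState_posSemidef i) h,
    mul_eq_zero_of_trace_eq (q.ρ_pos i) h.symm⟩

theorem expectation_absorb (hΨ : q.IsPurification Ψ)
    (A : ∀ j, Matrix (N.PartyIdx Q j) (N.PartyIdx Q j) ℂ) :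
    N.expectation q.ρ A = N.expectation (absorbState Ψ) fun j =>
      inflate (fun i : N.Sources j => E i j) (A j) := by
  let e : N.GlobalIdx (fun i j => Q i j × E i j) ≃ N.GlobalIdx Q × N.GlobalIdx E :=
    ⟨fun z => (fun i j => (z i j).1, fun i j => (z i j).2), fun p i j => (p.1 i j, p.2 i j),
      fun _ => rfl, fun _ => rfl⟩
  let Φ : N.GlobalIdx Q × N.GlobalIdx E → ℂ := fun p => ∏ i, Ψ i (p.1 i, p.2 i)
  have h1 : ∀ x y, tensor q.ρ x y = ∑ ε, Φ (x, ε) * star (Φ (y, ε)) := by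
    intro x y
    rw [tensor_apply, Finset.prod_congr rfl fun i _ => hΨ i (x i) (y i), Finset.prod_univ_sum,
      Fintype.piFinset_univ]
    simp only [Φ, star_prod, Finset.prod_mul_distrib]
  have h2 : tensor (absorbState Ψ) = (vecMulVec Φ (star Φ)).submatrix e e := by
    ext z w
    simp only [tensor_apply, absorbState, vecMulVec_apply, Matrix.submatrix_apply, Φ, Pi.star_apply,
      star_prod, Finset.prod_mul_distrib]
    rfl
  have h3 : (N.globalOp fun j => inflate (fun i : N.Sources j => E i j) (A j)) =
      (N.globalOp A ⊗ₖ (1 : Matrix (N.GlobalIdx E) (N.GlobalIdx E) ℂ)).submatrix e e := by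
    ext z w
    rw [globalOp_apply, Matrix.submatrix_apply, Matrix.kroneckerMap_apply, globalOp_apply]
    simp only [inflate, Matrix.of_apply, Finset.prod_mul_distrib, Finset.prod_ite_zero,
      Finset.prod_const_one, Finset.mem_univ, true_implies, Matrix.one_apply]
    congr 1
    refine if_congr ?_ rfl rfl
    constructor
    · intro h
      funext i j
      exact h j.1 ⟨i, j.2⟩
    · intro h j i
      exact congrFun (congrFun h i) ⟨j, i.2⟩
  rw [expectation, trace_mul_of_purification h1, expectation, h2, h3, Matrix.submatrix_mul_equiv,
    trace_submatrix_equiv]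

theorem expectation_absorb_update (hΨ : q.IsPurification Ψ) (j : J)
    (C : Matrix (N.PartyIdx Q j) (N.PartyIdx Q j) ℂ) :
    N.expectation q.ρ (Function.update (fun _ => 1) j C) =
      N.expectation (absorbState Ψ)
        (Function.update (fun _ => 1) j (inflate (fun i : N.Sources j => E i j) C)) := by
  rw [expectation_absorb hΨ]
  congr 1
  funext j'
  by_cases h : j' = j
  · subst h; simp
  · simp only [Function.update_of_ne h, inflate_one]

theorem mul_partyState_eq_zero_iff (hΨ : q.IsPurification Ψ) {j : J}
    {C : Matrix (N.PartyIdx Q j) (N.PartyIdx Q j) ℂ} :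
    C * N.partyState q.ρ j = 0 ↔
      inflate (fun i : N.Sources j => E i j) C * N.partyState (absorbState Ψ) j = 0 := by
  have h := expectation_absorb_update hΨ j (Cᴴ * C)
  have h' := N.expectation_update_one (Q := fun i j => Q i j × E i j) (σ := absorbState Ψ)
    (trace_absorbState hΨ) j (inflate (fun i : N.Sources j => E i j) (Cᴴ * C))
  rw [N.expectation_update_one q.ρ_trace, h', inflate_mul, ← inflate_conjTranspose] at h
  have hpos := N.partyState_posSemidef (Q := fun i j => Q i j × E i j) (σ := absorbState Ψ)
    absorbState_posSemidef j
  exact ⟨mul_eq_zero_of_trace_eq hpos h,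
    mul_eq_zero_of_trace_eq (N.partyState_posSemidef q.ρ_pos j) h.symm⟩

theorem conclusive_posSemidef (q : QuantumModel N Q O) (j : J) : (q.conclusive j).PosSemidef :=
  Matrix.posSemidef_sum _ fun o _ => q.M_pos j (some o)

theorem one_sub_conclusive_posSemidef (q : QuantumModel N Q O) (j : J) :
    (1 - q.conclusive j).PosSemidef := by
  have : 1 - q.conclusive j = q.M j none := by
    rw [← q.M_sum j, Fintype.sum_option, conclusive, add_sub_cancel_right]
  rw [this]
  exact q.M_pos j none

theorem conclusiveProb_singleton (q : QuantumModel N Q O) (j : J) :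
    q.conclusiveProb {j} =
      (N.expectation q.ρ (Function.update (fun _ => 1) j (q.conclusive j))).re := by
  rw [conclusiveProb_eq_expectation]
  congr 2
  funext j'
  by_cases h : j' = j
  · subst h; simp
  · simp [h]

/-- Every model has a purification with the purifying systems absorbed. -/
theorem exists_purification (q : QuantumModel N Q O) :
    ∃ Ψ : ∀ i, N.SourceIdx Q i × N.SourceIdx (fun i _ => N.SourceIdx Q i) i → ℂ,
      q.IsPurification Ψ := by
  choose B hB using fun i => exists_eq_conjTranspose_mul_self (q.ρ_pos i)
  refine ⟨fun i p => ∑ z, if p.2 = (fun _ => z) then star (B i z p.1) else 0, fun i x y => ?_⟩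
  obtain ⟨p, -⟩ := exists_pair_of_card_eq_two (N.two_parties i)
  have hinj : Function.Injective fun (z : N.SourceIdx Q i) (_ : N.Parties i) => z :=
    fun a b h => congrFun h p
  rw [hB i, Matrix.mul_apply]
  apply Finset.sum_of_injOn (fun (z : N.SourceIdx Q i) (_ : N.Parties i) => z)
  · exact hinj.injOn
  · simp
  · intro ε _ hε
    beta_reduce
    rw [Finset.sum_eq_zero, zero_mul]
    intro z _
    rw [if_neg]
    rintro rfl
    exact hε ⟨z, by simp, rfl⟩
  · intro z _
    have : ∀ z' : N.SourceIdx Q i, ((fun _ : N.Parties i => z) = fun _ => z') ↔ z = z' :=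
      fun z' => hinj.eq_iff
    simp [this]

end QuantumModel

end FinnerRigidity

namespace FinnerRigidity

open Matrix
open scoped ComplexOrder Kronecker

/-! ### Local effects on the original systems -/

section ProductVec

variable {κ : Type*} [Fintype κ] [DecidableEq κ] {α β : κ → Type*} [∀ k, Fintype (α k)]
  [∀ k, DecidableEq (α k)] [∀ k, Fintype (β k)]

/-- The product vector `⨂ₖ v k`. -/
def productVec (v : ∀ k, α k → ℂ) : (∀ k, α k) → ℂ := fun x => ∏ k, v k (x k)

theorem tensor_mulVec_productVec (X : ∀ k, Matrix (α k) (β k) ℂ) (v : ∀ k, β k → ℂ) :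
    tensor X *ᵥ productVec v = productVec fun k => X k *ᵥ v k := by
  funext x
  simp only [Matrix.mulVec, dotProduct, productVec, tensor_apply, ← Finset.prod_mul_distrib]
  rw [Finset.prod_univ_sum, Fintype.piFinset_univ]

theorem productVec_update_apply (v : ∀ k, α k → ℂ) (k₀ : κ) (c : α k₀ → ℂ) (x : ∀ k, α k) :
    productVec (Function.update v k₀ c) x = c (x k₀) * ∏ k ∈ Finset.univ.erase k₀, v k (x k) := by
  rw [productVec, ← Finset.mul_prod_erase _ _ (Finset.mem_univ k₀), Function.update_self]
  congr 1
  exact Finset.prod_congr rfl fun k hk => by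
    rw [Function.update_of_ne (Finset.ne_of_mem_erase hk)]

theorem star_productVec_dotProduct (v v' : ∀ k, α k → ℂ) :
    star (productVec v) ⬝ᵥ productVec v' = ∏ k, star (v k) ⬝ᵥ v' k := by
  simp only [dotProduct, productVec, Pi.star_apply, star_prod, ← Finset.prod_mul_distrib]
  rw [Finset.prod_univ_sum, Fintype.piFinset_univ]

/-- The embedding `c ↦ c ⊗ ⨂_{k ≠ k₀} v k`. -/
noncomputable def embedding (v : ∀ k, α k → ℂ) (k₀ : κ) : Matrix (∀ k, α k) (α k₀) ℂ :=
  Matrix.of fun x a => productVec (Function.update v k₀ (Pi.single a 1)) x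

theorem embedding_mulVec (v : ∀ k, α k → ℂ) (k₀ : κ) (c : α k₀ → ℂ) :
    embedding v k₀ *ᵥ c = productVec (Function.update v k₀ c) := by
  funext x
  simp only [embedding, Matrix.mulVec, dotProduct, Matrix.of_apply, productVec_update_apply]
  rw [Finset.sum_eq_single (x k₀)]
  · simp [mul_comm]
  · intro a _ ha
    simp [ha.symm]
  · simp

theorem embedding_conjTranspose_mulVec (v : ∀ k, α k → ℂ) (k₀ : κ) (c : α k₀ → ℂ) :
    (embedding v k₀)ᴴ *ᵥ productVec (Function.update v k₀ c) =
      (∏ k ∈ Finset.univ.erase k₀, star (v k) ⬝ᵥ v k) • c := by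
  funext a
  have : ((embedding v k₀)ᴴ *ᵥ productVec (Function.update v k₀ c)) a =
      star (productVec (Function.update v k₀ (Pi.single a 1))) ⬝ᵥ
        productVec (Function.update v k₀ c) := by
    simp only [embedding, Matrix.mulVec, dotProduct, Matrix.conjTranspose_apply, Matrix.of_apply,
      Pi.star_apply]
  rw [this, star_productVec_dotProduct, ← Finset.mul_prod_erase _ _ (Finset.mem_univ k₀),
    Function.update_self, Function.update_self, Pi.smul_apply, smul_eq_mul, mul_comm]
  congr 1
  · exact Finset.prod_congr rfl fun k hk => by
      rw [Function.update_of_ne (Finset.ne_of_mem_erase hk),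
        Function.update_of_ne (Finset.ne_of_mem_erase hk)]
  · simp

variable {ε : κ → Type*} [∀ k, Fintype (ε k)] [∀ k, DecidableEq (ε k)]

theorem inflate_mulVec_apply (C : Matrix (∀ k, α k) (∀ k, α k) ℂ)
    (Φ : (∀ k, α k × ε k) → ℂ) (x : ∀ k, α k) (e : ∀ k, ε k) :
    (inflate ε C *ᵥ Φ) (fun k => (x k, e k)) = (C *ᵥ fun y => Φ fun k => (y k, e k)) x := by
  simp only [Matrix.mulVec, dotProduct, inflate, Matrix.of_apply]
  rw [← (piProdEquiv α ε).symm.sum_comp, Fintype.sum_prod_type]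
  refine Finset.sum_congr rfl fun y _ => ?_
  simp only [piProdEquiv, Equiv.coe_fn_symm_mk, mul_ite, mul_one, mul_zero, ite_mul, zero_mul,
    ← funext_iff, Finset.sum_ite_eq, Finset.mem_univ, if_true]

theorem kronecker_one_mul_apply {α ε D : Type*} [Fintype α] [Fintype ε] [DecidableEq ε]
    (S : Matrix α α ℂ) (b : Matrix (α × ε) D ℂ) (a : α) (e : ε) (l : D) :
    ((S ⊗ₖ (1 : Matrix ε ε ℂ)) * b) (a, e) l = (S *ᵥ fun a => b (a, e) l) a := by
  rw [Matrix.mul_apply, Fintype.sum_prod_type]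
  simp only [Matrix.kroneckerMap_apply, Matrix.one_apply, mul_ite, mul_one, mul_zero, ite_mul,
    zero_mul, Finset.sum_ite_eq, Finset.mem_univ, if_true, Matrix.mulVec, dotProduct]

variable {D : κ → Type*} [∀ k, Fintype (D k)] [∀ k, DecidableEq (D k)]

/-- If an operator `C ⊗ 𝟙` acts on product frames `b k` as a product of projections `P k`, then each
`P k` is the restriction of an operator of the form `S ⊗ 𝟙`. -/
theorem exists_local_effect {C : Matrix (∀ k, α k) (∀ k, α k) ℂ} (hC : C.IsHermitian)
    {b : ∀ k, Matrix (α k × ε k) (D k) ℂ} (hb : ∀ k, (b k)ᴴ * b k = 1)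
    {P : ∀ k, Matrix (D k) (D k) ℂ} (hI : ∀ k, P k * P k = P k) (hne : ∀ k, P k ≠ 0)
    (h : inflate ε C * tensor b = tensor b * tensor P) (k₀ : κ) :
    ∃ S : Matrix (α k₀) (α k₀) ℂ, S.IsHermitian ∧
      (S ⊗ₖ (1 : Matrix (ε k₀) (ε k₀) ℂ)) * b k₀ = b k₀ * P k₀ := by
  choose u hu hu1 using fun k => exists_unit_fixed (hI k) (hne k)
  set w : ∀ k, α k × ε k → ℂ := fun k => b k *ᵥ u k with hw
  have hwne : ∀ k, ∃ r, w k r ≠ 0 := by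
    intro k
    by_contra! h0
    have h1 : w k = 0 := funext h0
    have h2 : u k = 0 := by
      have : (b k)ᴴ *ᵥ w k = u k := by rw [hw, Matrix.mulVec_mulVec, hb, Matrix.one_mulVec]
      rw [← this, h1, Matrix.mulVec_zero]
    have := hu1 k
    rw [h2] at this
    simp at this
  choose r hr using hwne
  set v : ∀ k, α k → ℂ := fun k a => w k (a, (r k).2) with hv
  set n : ℂ := ∏ k ∈ Finset.univ.erase k₀, star (v k) ⬝ᵥ v k with hn
  have hn0 : n ≠ 0 := by
    refine Finset.prod_ne_zero_iff.mpr fun k _ h0 => hr k ?_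
    rw [dotProduct_star_self_eq_zero] at h0
    exact congrFun h0 (r k).1
  have hns : star n = n := by
    rw [hn, star_prod]
    refine Finset.prod_congr rfl fun k _ => ?_
    rw [← Matrix.star_dotProduct_star, star_star]
  have hslice : ∀ (e : ε k₀) (c : α k₀ × ε k₀ → ℂ) (x : ∀ k, α k),
      productVec (Function.update w k₀ c)
        (fun k => (x k, Function.update (fun k => (r k).2) k₀ e k)) =
      productVec (Function.update v k₀ fun a => c (a, e)) x := by
    intro e c x
    rw [productVec_update_apply, productVec_update_apply, Function.update_self]
    congr 1
    exact Finset.prod_congr rfl fun k hk => by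
      rw [Function.update_of_ne (Finset.ne_of_mem_erase hk)]
  have hupd : ∀ (X : ∀ k, Matrix (α k × ε k) (D k) ℂ), (∀ k, X k *ᵥ u k = w k) → ∀ l,
      (fun k => X k *ᵥ Function.update u k₀ (Pi.single l 1) k) =
        Function.update w k₀ fun a => X k₀ a l := by
    intro X hX l
    funext k
    by_cases hk : k = k₀
    · subst hk
      funext a
      simp
    · rw [Function.update_of_ne hk, Function.update_of_ne hk, hX]
  have hmain : ∀ (e : ε k₀) (l : D k₀),
      C *ᵥ productVec (Function.update v k₀ fun a => b k₀ (a, e) l) =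
        productVec (Function.update v k₀ fun a => (b k₀ * P k₀) (a, e) l) := by
    intro e l
    funext x
    have h1 := congrArg (fun M => (M *ᵥ productVec (Function.update u k₀ (Pi.single l 1)))
      (fun k => (x k, Function.update (fun k => (r k).2) k₀ e k))) h
    beta_reduce at h1
    rw [← Matrix.mulVec_mulVec, inflate_mulVec_apply, tensor_mulVec_productVec, tensor_mul,
      tensor_mulVec_productVec, hupd b (fun k => rfl), hupd (fun k => b k * P k)
        (fun k => by rw [← Matrix.mulVec_mulVec, hu]), hslice] at h1
    rw [← h1]
    congr 2
    funext y
    exact (hslice e (fun a => b k₀ a l) y).symm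
  refine ⟨n⁻¹ • ((embedding v k₀)ᴴ * C * embedding v k₀), ?_, ?_⟩
  · rw [Matrix.IsHermitian, Matrix.conjTranspose_smul, Matrix.conjTranspose_mul,
      Matrix.conjTranspose_mul, Matrix.conjTranspose_conjTranspose, hC.eq, star_inv₀, hns,
      Matrix.mul_assoc]
  · ext ⟨a, e⟩ l
    rw [kronecker_one_mul_apply, Matrix.smul_mulVec, ← Matrix.mulVec_mulVec,
      ← Matrix.mulVec_mulVec, embedding_mulVec, hmain, embedding_conjTranspose_mulVec, smul_smul,
      inv_mul_cancel₀ hn0, one_smul]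

/-- The effects in `exists_local_effect` can be chosen to be projections. -/
theorem exists_local_projection {C : Matrix (∀ k, α k) (∀ k, α k) ℂ} (hC : C.IsHermitian)
    {b : ∀ k, Matrix (α k × ε k) (D k) ℂ} (hb : ∀ k, (b k)ᴴ * b k = 1)
    {P : ∀ k, Matrix (D k) (D k) ℂ} (hI : ∀ k, P k * P k = P k) (hne : ∀ k, P k ≠ 0)
    (h : inflate ε C * tensor b = tensor b * tensor P) (k₀ : κ) :
    ∃ S : Matrix (α k₀) (α k₀) ℂ, S.IsHermitian ∧ S * S = S ∧
      (S ⊗ₖ (1 : Matrix (ε k₀) (ε k₀) ℂ)) * b k₀ = b k₀ * P k₀ := by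
  obtain ⟨S, hS, hSb⟩ := exists_local_effect hC hb hI hne h k₀
  obtain ⟨R, G, hR, hRR, hRS⟩ := exists_projection_sub_eq hS
  refine ⟨R, hR, hRR, ?_⟩
  have hmul : ∀ X Y : Matrix (α k₀) (α k₀) ℂ, (X * Y) ⊗ₖ (1 : Matrix (ε k₀) (ε k₀) ℂ) =
      (X ⊗ₖ (1 : Matrix (ε k₀) (ε k₀) ℂ)) * (Y ⊗ₖ (1 : Matrix (ε k₀) (ε k₀) ℂ)) := by
    intro X Y
    rw [← Matrix.mul_kronecker_mul, Matrix.mul_one]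
  have hsub : ∀ X Y : Matrix (α k₀) (α k₀) ℂ, (X - Y) ⊗ₖ (1 : Matrix (ε k₀) (ε k₀) ℂ) =
      (X ⊗ₖ (1 : Matrix (ε k₀) (ε k₀) ℂ)) - (Y ⊗ₖ (1 : Matrix (ε k₀) (ε k₀) ℂ)) := by
    intro X Y
    ext x y
    simp [Matrix.kroneckerMap_apply, sub_mul]
  have hzero : ((S * S - S) ⊗ₖ (1 : Matrix (ε k₀) (ε k₀) ℂ)) * b k₀ = 0 := by
    rw [hsub, hmul, Matrix.sub_mul, Matrix.mul_assoc, hSb, ← Matrix.mul_assoc, hSb,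
      Matrix.mul_assoc, hI, sub_self]
  have : ((R - S) ⊗ₖ (1 : Matrix (ε k₀) (ε k₀) ℂ)) * b k₀ = 0 := by
    rw [hRS, hmul, Matrix.mul_assoc, hzero, Matrix.mul_zero]
  rw [hsub, Matrix.sub_mul, hSb, sub_eq_zero] at this
  exact this

end ProductVec

end FinnerRigidity

namespace FinnerRigidity

open Matrix
open scoped ComplexOrder Kronecker

/-! ### Rigidity for mixed states -/

theorem site_mulVec_schmidtVec_comm {κ : Type*} [Fintype κ] [DecidableEq κ] {α : κ → Type*}
    [∀ k, Fintype (α k)] [∀ k, DecidableEq (α k)] {D : Type*} [Fintype D] [DecidableEq D]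
    (hκ : Fintype.card κ = 2) {lam : D → ℝ} {b : ∀ k, Matrix (α k) D ℂ}
    {X : ∀ k, Matrix (α k) (α k) ℂ} {P : κ → Matrix D D ℂ} (hX : ∀ k, X k * b k = b k * P k)
    (hPP : ∀ k k', k ≠ k' → P k = (P k')ᵀ) (hlam : ∀ k l l', P k l l' ≠ 0 → lam l = lam l')
    (k k' : κ) :
    site k (X k) *ᵥ schmidtVec lam b = site k' (X k') *ᵥ schmidtVec lam b := by
  by_cases hkk : k = k'
  · rw [hkk]
  have hcov : ∀ r, r = k ∨ r = k' := by
    obtain ⟨p, p', _, hcov⟩ := exists_pair_of_card_eq_two hκ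
    intro r
    rcases hcov r with rfl | rfl <;> rcases hcov k with rfl | rfl <;> rcases hcov k' with rfl | rfl
      <;> simp_all
  rw [site, site, tensor_mulVec_schmidtVec, tensor_mulVec_schmidtVec]
  funext x
  simp only [schmidtVec, prod_eq_mul_of_pair hkk hcov, Function.update_self,
    Function.update_of_ne hkk, Function.update_of_ne (Ne.symm hkk), hX, Matrix.one_mul]
  simp only [Matrix.mul_apply, Finset.sum_mul, Finset.mul_sum]
  rw [Finset.sum_comm]
  refine Finset.sum_congr rfl fun r _ => Finset.sum_congr rfl fun l _ => ?_
  have h1 : P k' l r = P k r l := by rw [hPP k k' hkk, Matrix.transpose_apply]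
  rw [h1]
  by_cases h0 : P k r l = 0
  · rw [h0]; ring
  · rw [hlam k r l h0]; ring

namespace QuantumModel

open BipartiteNetwork

variable {I J : Type*} [Fintype I] [Fintype J] [DecidableEq I] [DecidableEq J]
  {N : BipartiteNetwork I J} {Q : I → J → Type*} {O : J → Type*}
  [∀ i j, Fintype (Q i j)] [∀ i j, DecidableEq (Q i j)] [∀ j, Fintype (O j)]

/-- The conclusive effects are, on the supports of the marginal states, tensor products of
projections which agree on the states of the sources. -/
structure IsProjectionForm (q : QuantumModel N Q O) (P : ∀ i j, Matrix (Q i j) (Q i j) ℂ) :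
    Prop where
  isHermitian : ∀ i j, (P i j).IsHermitian
  idempotent : ∀ i j, P i j * P i j = P i j
  measurement : ∀ j, q.conclusive j * N.partyState q.ρ j =
    (tensor fun i : N.Sources j => P i j) * N.partyState q.ρ j
  state : ∀ i (k k' : N.Parties i), site k (P i k) * q.ρ i = site k' (P i k') * q.ρ i

theorem exists_projectionForm (q : QuantumModel N Q O) (hpos : ∀ j, 0 < q.conclusiveProb {j})
    (hsat : q.SaturatesFinner) : ∃ P, q.IsProjectionForm P := by
  obtain ⟨Ψ, hΨ⟩ := q.exists_purification
  have hschmidt := fun i => exists_schmidt_adapted (N.two_parties i) (absorb Ψ i)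
    (P := fun _ => 1) (fun _ => Matrix.isHermitian_one) (fun _ => Matrix.mul_one _)
    (fun k k' => by rw [site_one, site_one])
  choose d lam c χ hlam hc hψ _ using hschmidt
  let b : ∀ i j, Matrix (Q i j × N.SourceIdx Q i) (Fin (d i)) ℂ := fun i j =>
    if h : N.E i j = true then Matrix.of fun x l => c i ⟨j, h⟩ l x else 0
  have hbapp : ∀ i (j : N.Parties i), b i j = Matrix.of fun x l => c i j l x := by
    intro i j
    simp only [b]
    rw [dif_pos j.2]
  have hb : ∀ i j, N.E i j = true → (b i j)ᴴ * b i j = 1 := by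
    intro i j h
    rw [hbapp i ⟨j, h⟩]
    ext l l'
    rw [Matrix.one_apply, ← hc i ⟨j, h⟩ l l']
    rfl
  have hvec : ∀ i, absorb Ψ i = schmidtVec (lam i) fun j : N.Parties i => b i j := by
    intro i
    funext z
    rw [hψ i z, schmidtVec]
    simp only [hbapp, Matrix.of_apply]
  have hstate : absorbState Ψ = N.schmidtState lam b := by
    funext i
    rw [absorbState, schmidtState, hvec]
  have hP := N.exists_projections_of_pure (lam := lam) (b := b) hlam hb
    (fun i => by rw [← hstate]; exact trace_absorbState hΨ i)
    (A := fun j => inflate (fun i : N.Sources j => N.SourceIdx Q i) (q.conclusive j))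
    (fun j => inflate_posSemidef _ (q.conclusive_posSemidef j))
    (fun j => by
      rw [← inflate_one, ← inflate_sub]
      exact inflate_posSemidef _ (q.one_sub_conclusive_posSemidef j))
  have hprob : ∀ j, (N.expectation (N.schmidtState lam b) (Function.update (fun _ => 1) j
      (inflate (fun i : N.Sources j => N.SourceIdx Q i) (q.conclusive j)))).re =
      q.conclusiveProb {j} := by
    intro j
    rw [conclusiveProb_singleton, expectation_absorb_update hΨ, hstate]
  have hall : q.conclusiveProb Finset.univ = (N.expectation (N.schmidtState lam b) fun j =>
      inflate (fun i : N.Sources j => N.SourceIdx Q i) (q.conclusive j)).re := by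
    rw [conclusiveProb_eq_expectation, expectation_absorb hΨ, hstate]
    simp
  simp only [hprob] at hP
  obtain ⟨P, hPproj, hPmul, hPmatch, hPlam⟩ := hP hpos (by
    rw [← hsat, hall]
    exact Complex.re_le_norm _)
  have hS := fun j => exists_local_projection (κ := N.Sources j) (C := q.conclusive j)
    (q.conclusive_posSemidef j).isHermitian (b := fun i => b i j) (fun i => hb _ _ i.2)
    (P := P j) (fun i => (hPproj j i).2.1) (fun i => (hPproj j i).2.2) (hPmul j)
  choose S hSH hSI hSb using hS
  let R : ∀ i j, Matrix (Q i j) (Q i j) ℂ := fun i j =>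
    if h : N.E i j = true then S j ⟨i, h⟩ else 1
  have hR : ∀ j (i : N.Sources j), R i j = S j i := by
    intro j i
    simp only [R]
    rw [dif_pos i.2]
  refine ⟨R, ?_, ?_, ?_, ?_⟩
  · intro i j
    by_cases h : N.E i j = true
    · rw [hR j ⟨i, h⟩]; exact hSH j ⟨i, h⟩
    · simp only [R, dif_neg h]; exact Matrix.isHermitian_one
  · intro i j
    by_cases h : N.E i j = true
    · rw [hR j ⟨i, h⟩]; exact hSI j ⟨i, h⟩
    · simp only [R, dif_neg h]; exact Matrix.mul_one _
  · intro j
    rw [← sub_eq_zero, ← Matrix.sub_mul, mul_partyState_eq_zero_iff hΨ, hstate,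
      partyState_schmidtState N hb, ← Matrix.mul_assoc, ← Matrix.mul_assoc, inflate_sub,
      Matrix.sub_mul, hPmul, inflate_tensor]
    have : (tensor fun i : N.Sources j => R i j ⊗ₖ
        (1 : Matrix (N.SourceIdx Q i) (N.SourceIdx Q i) ℂ)) * N.partyFrame b j =
        N.partyFrame b j * tensor (P j) := by
      rw [partyFrame, tensor_mul, tensor_mul]
      congr 1
      funext i
      rw [hR, hSb]
    rw [this, sub_self, Matrix.zero_mul, Matrix.zero_mul]
  · intro i k k'
    rw [← sub_eq_zero, ← Matrix.sub_mul, mul_rho_eq_zero_iff hΨ, inflate_sub, inflate_site,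
      inflate_site, Matrix.sub_mul, sub_eq_zero, absorbState, Matrix.mul_vecMulVec,
      Matrix.mul_vecMulVec, hvec]
    congr 1
    exact site_mulVec_schmidtVec_comm (N.two_parties i)
      (X := fun j : N.Parties i => R i j ⊗ₖ (1 : Matrix (N.SourceIdx Q i) (N.SourceIdx Q i) ℂ))
      (P := fun j => P j ⟨i, j.2⟩)
      (fun j => by rw [hR j ⟨i, j.2⟩]; exact hSb j ⟨i, j.2⟩)
      (fun j j' h => hPmatch j j' i j.2 j'.2 fun h' => h (Subtype.ext h'))
      (fun j l l' => hPlam j ⟨i, j.2⟩ l l') k k'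

end QuantumModel

end FinnerRigidity

namespace FinnerRigidity

open Matrix
open scoped ComplexOrder Kronecker

/-! ### From product effects to saturation -/

namespace BipartiteNetwork

variable {I J : Type*} [Fintype I] [Fintype J] [DecidableEq I] [DecidableEq J]
  (N : BipartiteNetwork I J) {Q : I → J → Type*}
  [∀ i j, Fintype (Q i j)] [∀ i j, DecidableEq (Q i j)]

theorem expectation_of_product_effects
    {σ : ∀ i, Matrix (N.SourceIdx Q i) (N.SourceIdx Q i) ℂ}
    (hpos : ∀ i, (σ i).PosSemidef) (hσ : ∀ i, (σ i).trace = 1)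
    {A : ∀ j, Matrix (N.PartyIdx Q j) (N.PartyIdx Q j) ℂ} {X : ∀ i j, Matrix (Q i j) (Q i j) ℂ}
    {t : I → ℝ}
    (hA : ∀ j, A j * N.partyState σ j = (tensor fun i : N.Sources j => X i j) * N.partyState σ j)
    (ht : ∀ i (T : Finset J), (∃ j ∈ T, N.E i j = true) →
      (σ i * tensor fun j : N.Parties i => if j.1 ∈ T then X i j else 1).trace = t i)
    (T : Finset J) :
    N.expectation σ (fun j => if j ∈ T then A j else 1) =
      ((∏ i, if ∃ j ∈ T, N.E i j = true then t i else 1 : ℝ) : ℂ) := by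
  have h1 : N.expectation σ (fun j => if j ∈ T then A j else 1) =
      N.expectation σ fun j => tensor fun i : N.Sources j => if j ∈ T then X i j else 1 := by
    refine N.expectation_congr hpos hσ fun j => ?_
    split_ifs
    · exact hA j
    · rw [tensor_one]
  rw [h1, N.expectation_tensor σ fun i j => if j ∈ T then X i j else 1, Complex.ofReal_prod]
  refine Finset.prod_congr rfl fun i _ => ?_
  split_ifs with h
  · exact ht i T h
  · have : (fun j : N.Parties i => if j.1 ∈ T then X i j else 1) = fun _ => 1 := by
      funext j
      rw [if_neg fun hj => h ⟨j, hj, j.2⟩]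
    rw [this, tensor_one, Matrix.mul_one, hσ, Complex.ofReal_one]

end BipartiteNetwork

namespace QuantumModel

open BipartiteNetwork

variable {I J : Type*} [Fintype I] [Fintype J] [DecidableEq I] [DecidableEq J]
  {N : BipartiteNetwork I J} {Q : I → J → Type*} {O : J → Type*}
  [∀ i j, Fintype (Q i j)] [∀ i j, DecidableEq (Q i j)] [∀ j, Fintype (O j)]

/-- The conclusive outcomes are distributed as if each source independently succeeded with
probability `t i`. -/
def HasSuccessRates (q : QuantumModel N Q O) (t : I → ℝ) : Prop :=
  ∀ T : Finset J, q.conclusiveProb T = ∏ i, if ∃ j ∈ T, N.E i j = true then t i else 1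

variable {q : QuantumModel N Q O} {t : I → ℝ}

theorem HasSuccessRates.saturatesFinner (h : q.HasSuccessRates t) (ht : ∀ i, 0 ≤ t i) :
    q.SaturatesFinner := by
  have h1 : q.conclusiveProb Finset.univ = ∏ i, t i := by
    rw [h]
    refine Finset.prod_congr rfl fun i _ => if_pos ?_
    obtain ⟨p, -⟩ := exists_pair_of_card_eq_two (N.two_parties i)
    exact ⟨p, Finset.mem_univ _, p.2⟩
  have h2 : ∀ j, q.conclusiveProb {j} = ∏ i : N.Sources j, t i := by
    intro j
    rw [h, Finset.prod_congr rfl (g := fun i => if _h : N.E i j = true then t i else 1),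
      Fintype.prod_dite]
    · simp
    · intro i _
      simp
  rw [SaturatesFinner, h1, Finset.prod_congr rfl fun j _ => h2 j,
    N.prod_sources_eq_prod_parties fun i _ _ => t i]
  simp only [Finset.prod_const, Finset.card_univ, N.two_parties, Finset.prod_pow]
  rw [Real.sqrt_sq (Finset.prod_nonneg fun i _ => ht i)]

theorem HasSuccessRates.rate_eq (h : q.HasSuccessRates t) (hpos : ∀ j, 0 < q.conclusiveProb {j})
    {i : I} {j j' : J} (hjj : j ≠ j') (hj : N.E i j = true) (hj' : N.E i j' = true) :
    t i = q.conclusiveProb {j} * q.conclusiveProb {j'} / q.conclusiveProb {j, j'} := by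
  have key : q.conclusiveProb {j} * q.conclusiveProb {j'} = t i * q.conclusiveProb {j, j'} := by
    rw [h, h, h, ← Finset.prod_mul_distrib]
    have : ∀ k, (if ∃ a ∈ ({j} : Finset J), N.E k a = true then t k else 1) *
        (if ∃ a ∈ ({j'} : Finset J), N.E k a = true then t k else 1) =
        (if k = i then t k else 1) *
          if ∃ a ∈ ({j, j'} : Finset J), N.E k a = true then t k else 1 := by
      intro k
      simp only [Finset.mem_singleton, exists_eq_left, Finset.mem_insert, exists_eq_or_imp]
      by_cases hki : k = i
      · subst hki; simp [hj, hj']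
      · by_cases h1 : N.E k j = true <;> by_cases h2 : N.E k j' = true
        · exact absurd (N.eq_of_shared hjj hj hj' h1 h2) hki
        all_goals simp [hki, h1, h2]
    rw [Finset.prod_congr rfl fun k _ => this k, Finset.prod_mul_distrib, Finset.prod_ite_eq']
    simp
  have hne : q.conclusiveProb {j, j'} ≠ 0 := by
    intro h0
    rw [h0, mul_zero] at key
    exact (mul_pos (hpos j) (hpos j')).ne' key
  rw [key, mul_div_cancel_right₀ _ hne]

/-! ### The flag form -/

section Flag

variable {E : I → Type*} [∀ i, Fintype (E i)] {Ψ : ∀ i, N.SourceIdx Q i × E i → ℂ}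

theorem trace_mul_eq_sum_purification (hΨ : q.IsPurification Ψ) (i : I)
    (G : Matrix (N.SourceIdx Q i) (N.SourceIdx Q i) ℂ) :
    (q.ρ i * G).trace =
      ∑ ε, star (fun x => Ψ i (x, ε)) ⬝ᵥ G *ᵥ fun x => Ψ i (x, ε) := by
  simp only [Matrix.trace, Matrix.diag_apply, Matrix.mul_apply, hΨ i, dotProduct, Matrix.mulVec,
    Pi.star_apply, Finset.sum_mul, Finset.mul_sum]
  rw [Finset.sum_congr rfl fun x _ => Finset.sum_comm, Finset.sum_comm]
  refine Finset.sum_congr rfl fun ε _ => ?_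
  rw [Finset.sum_comm]
  exact Finset.sum_congr rfl fun x _ => Finset.sum_congr rfl fun y _ => by ring

theorem flagProj_eq_diagonal (r : ℕ) :
    flagProj r = diagonal fun p => if p.1 = 1 then 1 else 0 := by
  ext ⟨f, k⟩ ⟨f', k'⟩
  simp only [flagProj, Matrix.kroneckerMap_apply, Matrix.single_apply, Matrix.one_apply,
    Matrix.diagonal_apply, Prod.mk.injEq]
  by_cases h : f = f'
  · subst h
    by_cases h1 : f = 1
    · subst h1; simp
    · simp [h1, Ne.symm h1]
  · have : ¬ (1 = f ∧ 1 = f') := fun h' => h (h'.1.symm.trans h'.2)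
    simp [h, this]

theorem tensor_diagonal {κ : Type*} [Fintype κ] [DecidableEq κ] {α : κ → Type*}
    [∀ k, DecidableEq (α k)] (f : ∀ k, α k → ℂ) :
    (tensor fun k => diagonal (f k)) = diagonal fun x => ∏ k, f k (x k) := by
  ext x y
  by_cases h : x = y
  · subst h; simp
  · rw [Matrix.diagonal_apply_ne _ h, tensor_apply]
    obtain ⟨k, hk⟩ := Function.ne_iff.mp h
    exact Finset.prod_eq_zero (Finset.mem_univ k) (Matrix.diagonal_apply_ne _ hk)

theorem IsFlagForm.hasSuccessRates (hΨ : q.IsPurification Ψ) {e : I → ℝ} {r : I → J → ℕ}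
    {V : ∀ i j, Matrix (Fin 2 × Fin (r i j)) (Q i j) ℂ}
    {Ψ₁ Ψ₀ : ∀ i, N.SourceIdx (fun i j => Fin (r i j)) i × E i → ℂ}
    (h : q.IsFlagForm Ψ e r V Ψ₁ Ψ₀) : q.HasSuccessRates fun i => 1 - e i := by
  intro T
  rw [conclusiveProb_eq_expectation, N.expectation_of_product_effects q.ρ_pos q.ρ_trace
    (X := fun i j => (V i j)ᴴ * flagProj (r i j) * V i j) (t := fun i => 1 - e i), Complex.ofReal_re]
  · intro j
    have hm := agreeOnSupport_iff.mp (h.measurement j)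
    have hV : (tensor fun i : N.Sources j => V i j)ᴴ * (tensor fun i : N.Sources j => V i j) = 1 := by
      rw [tensor_conjTranspose, tensor_mul, ← tensor_one]
      congr 1
      funext i
      exact h.isometry _ _ i.2
    have := congrArg (fun M => (tensor fun i : N.Sources j => V i j)ᴴ * M) hm
    beta_reduce at this
    rw [← Matrix.mul_assoc, ← Matrix.mul_assoc, hV, Matrix.one_mul] at this
    rw [this, ← Matrix.mul_assoc, ← Matrix.mul_assoc, tensor_conjTranspose, tensor_mul, tensor_mul]
  · intro i T hT
    let D : (∀ j : N.Parties i, Fin 2 × Fin (r i j)) → ℂ := fun y =>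
      ∏ j : N.Parties i, if j.1 ∈ T then (if (y j).1 = 1 then 1 else 0) else 1
    have hG : (tensor fun j : N.Parties i =>
        if j.1 ∈ T then (V i j)ᴴ * flagProj (r i j) * V i j else 1) =
        (tensor fun j : N.Parties i => V i j)ᴴ * (diagonal D * tensor fun j : N.Parties i => V i j) := by
      have hD : diagonal D = tensor fun j : N.Parties i =>
          if j.1 ∈ T then flagProj (r i j) else 1 := by
        rw [← tensor_diagonal fun (j : N.Parties i) (p : Fin 2 × Fin (r i j)) =>
          if j.1 ∈ T then (if p.1 = 1 then (1 : ℂ) else 0) else 1]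
        congr 1
        funext j
        split_ifs
        · rw [flagProj_eq_diagonal]
        · exact Matrix.diagonal_one
      rw [hD, tensor_conjTranspose, tensor_mul, tensor_mul]
      congr 1
      funext j
      split_ifs
      · rw [Matrix.mul_assoc]
      · rw [Matrix.one_mul, h.isometry _ _ j.2]
    obtain ⟨j₀, hj₀T, hj₀⟩ := hT
    have hterm : ∀ (ε : E i) (y : ∀ j : N.Parties i, Fin 2 × Fin (r i j)),
        star ((tensor fun j : N.Parties i => V i j).mulVec (fun x => Ψ i (x, ε)) y) *
          (D y * (tensor fun j : N.Parties i => V i j).mulVec (fun x => Ψ i (x, ε)) y) =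
        if (∀ j, (y j).1 = 1) then (1 - e i : ℂ) * (‖Ψ₁ i (fun j => (y j).2, ε)‖ ^ 2 : ℝ) else 0 := by
      intro ε y
      rw [h.state]
      by_cases h1 : ∀ j, (y j).1 = 1
      · have h0 : ¬ ∀ j, (y j).1 = 0 := fun h0 => by
          have := (h0 ⟨j₀, hj₀⟩).symm.trans (h1 ⟨j₀, hj₀⟩)
          exact absurd this (by decide)
        have hD : D y = 1 := Finset.prod_eq_one fun j _ => by simp [h1 j]
        have hsq : ((√(1 - e i) : ℝ) : ℂ) * ((√(1 - e i) : ℝ) : ℂ) = 1 - e i := by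
          rw [← Complex.ofReal_mul, Real.mul_self_sqrt (sub_nonneg.mpr (h.rate_mem i).2)]
          push_cast
          rfl
        rw [if_pos h1, if_neg h0, if_pos h1, hD]
        have hn : ((‖Ψ₁ i (fun j => (y j).2, ε)‖ ^ 2 : ℝ) : ℂ) =
            star (Ψ₁ i (fun j => (y j).2, ε)) * Ψ₁ i (fun j => (y j).2, ε) := by
          rw [Complex.star_def, mul_comm, Complex.mul_conj, Complex.normSq_eq_norm_sq]
        rw [hn, ← hsq]
        simp only [mul_one, mul_zero, zero_mul, add_zero, one_mul, star_mul', Complex.star_def,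
          Complex.conj_ofReal]
        ring
      · rw [if_neg h1, if_neg h1]
        by_cases h0 : ∀ j, (y j).1 = 0
        · have hD : D y = 0 := Finset.prod_eq_zero (Finset.mem_univ ⟨j₀, hj₀⟩) (by
            simp [hj₀T, h0 ⟨j₀, hj₀⟩])
          rw [hD]; ring
        · rw [if_neg h0]; simp
    rw [trace_mul_eq_sum_purification hΨ, hG]
    have hsum : ∀ ε, star (fun x => Ψ i (x, ε)) ⬝ᵥ ((tensor fun j : N.Parties i => V i j)ᴴ *
        (diagonal D * tensor fun j : N.Parties i => V i j)) *ᵥ (fun x => Ψ i (x, ε)) =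
        ∑ s, (1 - e i : ℂ) * (‖Ψ₁ i (s, ε)‖ ^ 2 : ℝ) := by
      intro ε
      rw [← Matrix.mulVec_mulVec, Matrix.dotProduct_mulVec, ← Matrix.star_mulVec,
        ← Matrix.mulVec_mulVec, dotProduct]
      simp only [Matrix.mulVec_diagonal, Pi.star_apply, hterm]
      rw [← (piProdEquiv (fun _ : N.Parties i => Fin 2) fun j => Fin (r i j)).symm.sum_comp,
        Fintype.sum_prod_type]
      simp only [piProdEquiv, Equiv.coe_fn_symm_mk]
      rw [Finset.sum_eq_single (fun _ => 1)]
      · simp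
      · intro f _ hf
        refine Finset.sum_eq_zero fun s _ => if_neg fun h' => hf (funext h')
      · simp
    simp only [hsum]
    rw [Finset.sum_comm, ← Fintype.sum_prod_type', ← Finset.mul_sum, ← Complex.ofReal_sum]
    rw [h.unit_one i]
    simp

end Flag

/-! ### The Schmidt form -/

section Schmidt

variable {E : I → J → Type*} [∀ i j, Fintype (E i j)] [∀ i j, DecidableEq (E i j)]
  {Ψ : ∀ i, N.SourceIdx Q i × N.SourceIdx E i → ℂ}

theorem sum_smul_vecMulVec_eq {α D : Type*} [Fintype α] [Fintype D] [DecidableEq D]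
    (χ : D → ℂ) (b : D → α → ℂ) :
    ∑ l, χ l • vecMulVec (b l) (star (b l)) =
      (Matrix.of fun x l => b l x) * diagonal χ * (Matrix.of fun x l => b l x)ᴴ := by
  ext x y
  rw [Matrix.sum_apply, Matrix.mul_apply]
  refine Finset.sum_congr rfl fun l _ => ?_
  simp only [Matrix.smul_apply, vecMulVec_apply, Pi.star_apply, smul_eq_mul, Matrix.mul_diagonal,
    Matrix.of_apply, Matrix.conjTranspose_apply]
  ring

theorem conjTranspose_mul_self_of_orthonormal {α D : Type*} [Fintype α] [DecidableEq D]
    {b : D → α → ℂ} (hb : ∀ l l', star (b l) ⬝ᵥ b l' = if l = l' then 1 else 0) :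
    (Matrix.of fun x l => b l x)ᴴ * (Matrix.of fun x l => b l x) = 1 := by
  ext l l'
  rw [Matrix.one_apply, ← hb]
  rfl

theorem IsSchmidtForm.hasSuccessRates (hΨ : q.IsPurification Ψ) {d : I → ℕ}
    {lam : ∀ i, Fin (d i) → ℝ} {b : ∀ i j, Fin (d i) → Q i j × E i j → ℂ}
    {χ : ∀ i, Fin (d i) → Fin 2} (h : q.IsSchmidtForm Ψ d lam b χ) :
    q.HasSuccessRates fun i => ∑ l, lam i l ^ 2 * ((χ i l : ℕ) : ℝ) := by
  intro T
  set X : ∀ i j, Matrix (Q i j × E i j) (Q i j × E i j) ℂ := fun i j =>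
    ∑ l, ((χ i l : ℕ) : ℂ) • vecMulVec (b i j l) (star (b i j l)) with hX
  have hb : ∀ i j, N.E i j = true →
      (Matrix.of fun x l => b i j l x)ᴴ * (Matrix.of fun x l => b i j l x) = 1 :=
    fun i j hij => conjTranspose_mul_self_of_orthonormal (h.orthonormal i j hij)
  have hvec : ∀ i, absorb Ψ i =
      schmidtVec (lam i) fun j : N.Parties i => Matrix.of fun x l => b i j l x :=
    fun i => funext fun z => h.state i z
  have hinf : (fun j => inflate (fun i : N.Sources j => E i j) (if j ∈ T then q.conclusive j else 1)) =
      fun j => if j ∈ T then q.absorbedConclusive E j else 1 := by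
    funext j
    split_ifs
    · rfl
    · exact inflate_one _
  rw [conclusiveProb_eq_expectation, expectation_absorb hΨ, hinf,
    N.expectation_of_product_effects (Q := fun i j => Q i j × E i j) (σ := absorbState Ψ)
      absorbState_posSemidef (trace_absorbState hΨ) (X := X)
      (t := fun i => ∑ l, lam i l ^ 2 * ((χ i l : ℕ) : ℝ)), Complex.ofReal_re]
  · exact fun j => agreeOnSupport_iff.mp (h.measurement j)
  · intro i T hT
    obtain ⟨j₀, hj₀T, hj₀⟩ := hT
    rw [absorbState, trace_mul_vecMulVec_star, hvec, star_schmidtVec_dotProduct]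
    have hprod : ∀ l l', ∏ j : N.Parties i, ((Matrix.of fun x l => b i j l x)ᴴ *
        (if j.1 ∈ T then X i j else 1) * (Matrix.of fun x l => b i j l x)) l l' =
        if l = l' then ((χ i l : ℕ) : ℂ) else 0 := by
      intro l l'
      have hfac : ∀ j : N.Parties i, (Matrix.of fun x l => b i j l x)ᴴ *
          (if j.1 ∈ T then X i j else 1) * (Matrix.of fun x l => b i j l x) =
          if j.1 ∈ T then diagonal fun l => ((χ i l : ℕ) : ℂ) else 1 := by
        intro j
        split_ifs
        · rw [hX]
          simp only
          rw [sum_smul_vecMulVec_eq, ← Matrix.mul_assoc, ← Matrix.mul_assoc, hb _ _ j.2,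
            Matrix.one_mul, Matrix.mul_assoc, hb _ _ j.2, Matrix.mul_one]
        · rw [Matrix.mul_one, hb _ _ j.2]
      simp only [hfac]
      split_ifs with hl
      · subst hl
        have hval : ∀ j : N.Parties i, (if j.1 ∈ T then diagonal fun l => ((χ i l : ℕ) : ℂ) else 1 :
            Matrix (Fin (d i)) (Fin (d i)) ℂ) l l = if j.1 ∈ T then ((χ i l : ℕ) : ℂ) else 1 := by
          intro j
          split_ifs <;> simp
        simp only [hval]
        have hχ : χ i l = 0 ∨ χ i l = 1 := by
          generalize χ i l = c
          revert c
          decide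
        rcases hχ with hχ | hχ
        · have h0 : (((χ i l : Fin 2) : ℕ) : ℂ) = 0 := by simp [hχ]
          rw [h0]
          exact Finset.prod_eq_zero (Finset.mem_univ (⟨j₀, hj₀⟩ : N.Parties i)) (if_pos hj₀T)
        · rw [hχ]; simp
      · apply Finset.prod_eq_zero (Finset.mem_univ ⟨j₀, hj₀⟩)
        rw [if_pos hj₀T, Matrix.diagonal_apply_ne _ hl]
    simp only [hprod, mul_ite, mul_zero, Finset.sum_ite_eq, Finset.mem_univ, if_true]
    push_cast
    exact Finset.sum_congr rfl fun l _ => by ring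

end Schmidt

end QuantumModel

end FinnerRigidity

namespace FinnerRigidity

open Matrix
open scoped ComplexOrder Kronecker

/-! ### From projections to the flag form and the Schmidt form -/

section Pair

variable {κ : Type*} [Fintype κ] [DecidableEq κ] {α : κ → Type*} [∀ k, Fintype (α k)]
  [∀ k, DecidableEq (α k)]

theorem tensor_eq_site_mul_site {k k' : κ} (hne : k ≠ k') (hcov : ∀ l, l = k ∨ l = k')
    (C : ∀ l, Matrix (α l) (α l) ℂ) : tensor C = site k (C k) * site k' (C k') := by
  rw [site, site, tensor_mul]
  congr 1
  funext l
  rcases hcov l with rfl | rfl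
  · simp [Function.update_of_ne hne]
  · simp [Function.update_of_ne hne.symm]

variable {P : ∀ k, Matrix (α k) (α k) ℂ} {σ : Matrix (∀ k, α k) (∀ k, α k) ℂ} {k k' : κ}

theorem tensor_mul_eq_site_mul (hP : ∀ k, P k * P k = P k)
    (hσ : site k (P k) * σ = site k' (P k') * σ) (hne : k ≠ k') (hcov : ∀ l, l = k ∨ l = k') :
    tensor P * σ = site k (P k) * σ := by
  rw [tensor_eq_site_mul_site hne hcov, Matrix.mul_assoc, ← hσ, ← Matrix.mul_assoc, ← site_mul, hP]

theorem tensor_mul_eq_zero (hP : ∀ k, P k * P k = P k)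
    (hσ : site k (P k) * σ = site k' (P k') * σ) (hne : k ≠ k') (hcov : ∀ l, l = k ∨ l = k')
    {C : ∀ l, Matrix (α l) (α l) ℂ} (hk : C k = P k) (hk' : C k' = 1 - P k') :
    tensor C * σ = 0 := by
  rw [tensor_eq_site_mul_site hne hcov, hk, hk', site_sub, site_one, Matrix.mul_assoc,
    Matrix.sub_mul, Matrix.one_mul, ← hσ, Matrix.mul_sub, ← Matrix.mul_assoc, ← site_mul, hP,
    sub_self]

theorem tensor_mul_add_tensor_mul (hP : ∀ k, P k * P k = P k)
    (hσ : site k (P k) * σ = site k' (P k') * σ) (hne : k ≠ k') (hcov : ∀ l, l = k ∨ l = k') :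
    tensor P * σ + (tensor fun l => 1 - P l) * σ = σ := by
  have hidem : ∀ l, (1 - P l) * (1 - P l) = 1 - P l := fun l =>
    (IsIdempotentElem.one_sub (hP l)).eq
  rw [tensor_mul_eq_site_mul hP hσ hne hcov,
    tensor_mul_eq_site_mul (P := fun l => 1 - P l) hidem _ hne hcov, site_sub, site_one,
    Matrix.sub_mul, Matrix.one_mul, add_sub_cancel]
  simp only [site_sub, site_one, Matrix.sub_mul, hσ]

end Pair

theorem exists_unit_sqrt_mul_eq {ι : Type*} [Fintype ι] [Nonempty ι] (v : ι → ℂ) :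
    ∃ u : ι → ℂ, ∑ z, ‖u z‖ ^ 2 = 1 ∧ ∀ z, ((√(∑ z, ‖v z‖ ^ 2) : ℝ) : ℂ) * u z = v z := by
  classical
  have hnn : 0 ≤ ∑ z, ‖v z‖ ^ 2 := Finset.sum_nonneg fun z _ => by positivity
  by_cases h : ∑ z, ‖v z‖ ^ 2 = 0
  · obtain ⟨z₀⟩ := ‹Nonempty ι›
    refine ⟨Pi.single z₀ 1, ?_, fun z => ?_⟩
    · rw [Finset.sum_eq_single z₀]
      · simp
      · intro z _ hz
        simp [Pi.single_eq_of_ne hz]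
      · simp
    · have hz := (Finset.sum_eq_zero_iff_of_nonneg fun z _ => by positivity).mp h z
        (Finset.mem_univ z)
      have hv : v z = 0 := by simpa using hz
      rw [h, hv]
      simp
  · have hne : ((√(∑ z, ‖v z‖ ^ 2) : ℝ) : ℂ) ≠ 0 :=
      Complex.ofReal_ne_zero.mpr fun h' => h ((Real.sqrt_eq_zero hnn).mp h')
    refine ⟨fun z => v z / (√(∑ z, ‖v z‖ ^ 2) : ℝ), ?_, fun z => mul_div_cancel₀ _ hne⟩
    simp only [norm_div, div_pow, Complex.norm_real, Real.norm_eq_abs, sq_abs, Real.sq_sqrt hnn]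
    rw [← Finset.sum_div, div_self h]

namespace QuantumModel

open BipartiteNetwork

variable {I J : Type*} [Fintype I] [Fintype J] [DecidableEq I] [DecidableEq J]
  {N : BipartiteNetwork I J} {Q : I → J → Type*} {O : J → Type*}
  [∀ i j, Fintype (Q i j)] [∀ i j, DecidableEq (Q i j)] [∀ j, Fintype (O j)]
  {q : QuantumModel N Q O}

section Flag

variable {E : I → Type*} [∀ i, Fintype (E i)] {Ψ : ∀ i, N.SourceIdx Q i × E i → ℂ}

theorem mulVec_purification_eq_zero (hΨ : q.IsPurification Ψ) {i : I}
    {G : Matrix (N.SourceIdx Q i) (N.SourceIdx Q i) ℂ} (hG : G * q.ρ i = 0) (ε : E i) :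
    (G *ᵥ fun x => Ψ i (x, ε)) = 0 := by
  have h := trace_mul_eq_sum_purification hΨ i (Gᴴ * G)
  rw [Matrix.trace_mul_comm, Matrix.mul_assoc, hG, Matrix.mul_zero, Matrix.trace_zero] at h
  simp only [← Matrix.mulVec_mulVec] at h
  simp only [Matrix.dotProduct_mulVec _ Gᴴ, ← Matrix.star_mulVec] at h
  have := (Finset.sum_eq_zero_iff_of_nonneg fun ε _ => dotProduct_star_self_nonneg _).mp h.symm ε
    (Finset.mem_univ ε)
  exact dotProduct_star_self_eq_zero.mp this

theorem sum_norm_mulVec_purification (hΨ : q.IsPurification Ψ) (i : I)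
    {G : Matrix (N.SourceIdx Q i) (N.SourceIdx Q i) ℂ} (hG : G.IsHermitian) (hG' : G * G = G) :
    ((∑ p : N.SourceIdx Q i × E i, ‖(G *ᵥ fun x => Ψ i (x, p.2)) p.1‖ ^ 2 : ℝ) : ℂ) =
      (G * q.ρ i).trace := by
  have hGG : Gᴴ * G = G := by rw [hG.eq, hG']
  rw [Matrix.trace_mul_comm, trace_mul_eq_sum_purification hΨ, Fintype.sum_prod_type, Finset.sum_comm, Complex.ofReal_sum]
  refine Finset.sum_congr rfl fun ε _ => ?_
  nth_rw 2 [← hGG]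
  rw [← Matrix.mulVec_mulVec, Matrix.dotProduct_mulVec, ← Matrix.star_mulVec, dotProduct,
    Complex.ofReal_sum]
  refine Finset.sum_congr rfl fun x _ => ?_
  rw [Pi.star_apply, Complex.star_def, mul_comm, Complex.mul_conj, Complex.normSq_eq_norm_sq]

theorem nonempty_purification (hΨ : q.IsPurification Ψ) (i : I) :
    Nonempty (N.SourceIdx Q i × E i) := by
  by_contra h
  have h1 := trace_mul_eq_sum_purification hΨ i 1
  rw [Matrix.mul_one, q.ρ_trace] at h1
  exact one_ne_zero (h1.trans (Finset.sum_eq_zero fun ε _ =>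
    Finset.sum_eq_zero fun x _ => (h ⟨(x, ε)⟩).elim))

/-- The outcome `f` of the projective measurement `{1 - P, P}`. -/
def flagEffect {α : Type*} [DecidableEq α] (P : Matrix α α ℂ) (f : Fin 2) : Matrix α α ℂ :=
  if f = 1 then P else 1 - P

/-- The isometry `∑_f |f⟩ ⊗ P_f` recording the outcome of the projective measurement `{1 - P, P}`
in a flag. -/
noncomputable def flagIsometry {α : Type*} [Fintype α] [DecidableEq α] (P : Matrix α α ℂ) :
    Matrix (Fin 2 × Fin (Fintype.card α)) α ℂ :=
  Matrix.of fun y x => flagEffect P y.1 ((Fintype.equivFin α).symm y.2) x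

theorem flagIsometry_isometry {α : Type*} [Fintype α] [DecidableEq α] {P : Matrix α α ℂ}
    (hP : P.IsHermitian) (hP' : P * P = P) : (flagIsometry P)ᴴ * flagIsometry P = 1 := by
  have h : (flagIsometry P)ᴴ * flagIsometry P = Pᴴ * P + (1 - P)ᴴ * (1 - P) := by
    ext x y
    rw [Matrix.mul_apply, Fintype.sum_prod_type, Fin.sum_univ_two, add_comm, Matrix.add_apply,
      Matrix.mul_apply, Matrix.mul_apply, ← (Fintype.equivFin α).symm.sum_comp,
      ← (Fintype.equivFin α).symm.sum_comp]
    simp [flagIsometry, flagEffect]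
  rw [h, hP.eq, (Matrix.isHermitian_one.sub hP).eq, hP', (IsIdempotentElem.one_sub hP').eq,
    add_sub_cancel]

theorem flagProj_mul_flagIsometry {α : Type*} [Fintype α] [DecidableEq α] {P : Matrix α α ℂ}
    (hP' : P * P = P) :
    flagProj (Fintype.card α) * flagIsometry P = flagIsometry P * P := by
  rw [flagProj_eq_diagonal]
  ext y x
  have hr : (flagIsometry P * P) y x =
      (flagEffect P y.1 * P) ((Fintype.equivFin α).symm y.2) x := by
    simp only [Matrix.mul_apply, flagIsometry, Matrix.of_apply]
  rw [Matrix.diagonal_mul, hr]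
  by_cases h : y.1 = 1
  · simp [h, flagIsometry, flagEffect, hP']
  · simp [h, flagEffect, Matrix.sub_mul, hP']

theorem IsProjectionForm.exists_isFlagForm {P : ∀ i j, Matrix (Q i j) (Q i j) ℂ}
    (hP : q.IsProjectionForm P) (hΨ : q.IsPurification Ψ) :
    ∃ e r V Ψ₁ Ψ₀, q.IsFlagForm Ψ e r V Ψ₁ Ψ₀ := by
  let r : I → J → ℕ := fun i j => Fintype.card (Q i j)
  let c : ∀ i, N.SourceIdx (fun i j => Fin (r i j)) i ≃ N.SourceIdx Q i := fun i =>
    Equiv.piCongrRight fun j : N.Parties i => (Fintype.equivFin (Q i j)).symm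
  let T : Fin 2 → ∀ i, Matrix (N.SourceIdx Q i) (N.SourceIdx Q i) ℂ := fun f i =>
    tensor fun j : N.Parties i => flagEffect (P i j) f
  let v : Fin 2 → ∀ i, N.SourceIdx (fun i j => Fin (r i j)) i × E i → ℂ := fun f i p =>
    (T f i *ᵥ fun x => Ψ i (x, p.2)) (c i p.1)
  have hidem : ∀ i j, (1 - P i j) * (1 - P i j) = 1 - P i j := fun i j =>
    (IsIdempotentElem.one_sub (hP.idempotent i j)).eq
  have hTH : ∀ f i, (T f i).IsHermitian := by
    intro f i
    rw [Matrix.IsHermitian, tensor_conjTranspose]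
    congr 1
    funext j
    rw [flagEffect]
    split_ifs
    · exact hP.isHermitian _ _
    · exact Matrix.isHermitian_one.sub (hP.isHermitian _ _)
  have hTT : ∀ f i, T f i * T f i = T f i := by
    intro f i
    simp only [T]
    rw [tensor_mul]
    congr 1
    funext j
    rw [flagEffect]
    split_ifs
    · exact hP.idempotent _ _
    · exact hidem _ _
  have hnorm : ∀ f i, ((∑ p, ‖v f i p‖ ^ 2 : ℝ) : ℂ) = (T f i * q.ρ i).trace := by
    intro f i
    rw [← sum_norm_mulVec_purification hΨ i (hTH f i) (hTT f i)]
    congr 1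
    exact ((c i).prodCongr (Equiv.refl (E i))).sum_comp
      fun p : N.SourceIdx Q i × E i => ‖(T f i *ᵥ fun x => Ψ i (x, p.2)) p.1‖ ^ 2
  have hadd : ∀ i, ∑ p, ‖v 1 i p‖ ^ 2 + ∑ p, ‖v 0 i p‖ ^ 2 = 1 := by
    intro i
    obtain ⟨k, k', hne, hcov⟩ := exists_pair_of_card_eq_two (N.two_parties i)
    have h := tensor_mul_add_tensor_mul (P := fun j : N.Parties i => P i j)
      (fun j => hP.idempotent _ _) (hP.state i k k') hne hcov
    have h' := congrArg Matrix.trace h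
    rw [Matrix.trace_add, q.ρ_trace] at h'
    have h1 := hnorm 1 i
    have h0 := hnorm 0 i
    simp only [T, flagEffect, if_true, zero_ne_one, if_false] at h1 h0
    rw [← h1, ← h0] at h'
    exact_mod_cast h'
  have hne : ∀ i, Nonempty (N.SourceIdx (fun i j => Fin (r i j)) i × E i) := fun i =>
    (nonempty_purification hΨ i).map fun p => ((c i).symm p.1, p.2)
  have hunit := fun f i => @exists_unit_sqrt_mul_eq _ _ (hne i) (v f i)
  choose u hu huv using hunit
  refine ⟨fun i => ∑ p, ‖v 0 i p‖ ^ 2, r, fun i j => flagIsometry (P i j), u 1, u 0, ?_, ?_, hu 1,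
    hu 0, ?_, ?_⟩
  · intro i
    have h1 : 0 ≤ ∑ p, ‖v 1 i p‖ ^ 2 := Finset.sum_nonneg fun z _ => by positivity
    have h0 : 0 ≤ ∑ p, ‖v 0 i p‖ ^ 2 := Finset.sum_nonneg fun z _ => by positivity
    exact ⟨h0, by linarith [hadd i]⟩
  · exact fun i j _ => flagIsometry_isometry (hP.isHermitian i j) (hP.idempotent i j)
  · intro i y ε
    obtain ⟨k, k', hne, hcov⟩ := exists_pair_of_card_eq_two (N.two_parties i)
    have hlhs : ((tensor fun j : N.Parties i => flagIsometry (P i j)) *ᵥ fun x => Ψ i (x, ε)) y =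
        ((tensor fun j : N.Parties i => flagEffect (P i j) (y j).1) *ᵥ fun x => Ψ i (x, ε))
          (c i fun j => (y j).2) := rfl
    have hsub : 1 - ∑ p, ‖v 0 i p‖ ^ 2 = ∑ p, ‖v 1 i p‖ ^ 2 := by linarith [hadd i]
    have hcases : ∀ f : Fin 2, f = 0 ∨ f = 1 := by decide
    have hconst : ∀ f : Fin 2, (∀ j, (y j).1 = f) →
        ((tensor fun j : N.Parties i => flagEffect (P i j) (y j).1) *ᵥ fun x => Ψ i (x, ε))
          (c i fun j => (y j).2) = v f i (fun j => (y j).2, ε) := by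
      intro f hf
      simp only [hf]
      rfl
    have hall : ∀ f : Fin 2, (∀ j, (y j).1 = f) ↔ (y k).1 = f ∧ (y k').1 = f := fun f =>
      ⟨fun h => ⟨h k, h k'⟩, fun h j => by rcases hcov j with rfl | rfl; exacts [h.1, h.2]⟩
    rw [hlhs, hsub]
    rcases hcases (y k).1 with hk | hk <;> rcases hcases (y k').1 with hk' | hk'
    · rw [hconst 0 ((hall 0).mpr ⟨hk, hk'⟩), ← huv]
      simp only [hall, hk, hk']
      simp
    · rw [mulVec_purification_eq_zero hΨ (tensor_mul_eq_zero (P := fun j : N.Parties i => P i j)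
        (fun j => hP.idempotent _ _) (hP.state i k' k) hne.symm (fun l => (hcov l).symm)
        (by simp [flagEffect, hk']) (by simp [flagEffect, hk]))]
      simp only [hall, hk, hk']
      simp
    · rw [mulVec_purification_eq_zero hΨ (tensor_mul_eq_zero (P := fun j : N.Parties i => P i j)
        (fun j => hP.idempotent _ _) (hP.state i k k') hne hcov
        (by simp [flagEffect, hk]) (by simp [flagEffect, hk']))]
      simp only [hall, hk, hk']
      simp
    · rw [hconst 1 ((hall 1).mpr ⟨hk, hk'⟩), ← huv]
      simp only [hall, hk, hk']
      simp
  · intro j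
    rw [agreeOnSupport_iff, Matrix.mul_assoc, hP.measurement, ← Matrix.mul_assoc, tensor_mul,
      tensor_mul]
    congr 2
    funext i
    exact (flagProj_mul_flagIsometry (hP.idempotent _ _)).symm

end Flag

section Schmidt

variable {E : I → J → Type*} [∀ i j, Fintype (E i j)] [∀ i j, DecidableEq (E i j)]
  {Ψ : ∀ i, N.SourceIdx Q i × N.SourceIdx E i → ℂ}

theorem site_mulVec_absorb {P : ∀ i j, Matrix (Q i j) (Q i j) ℂ}
    (hP : q.IsProjectionForm P) (hΨ : q.IsPurification Ψ) (i : I) (k k' : N.Parties i) :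
    site k (P i k ⊗ₖ (1 : Matrix (E i k) (E i k) ℂ)) *ᵥ absorb Ψ i =
      site k' (P i k' ⊗ₖ (1 : Matrix (E i k') (E i k') ℂ)) *ᵥ absorb Ψ i := by
  have h := hP.state i k k'
  rw [← sub_eq_zero, ← Matrix.sub_mul, mul_rho_eq_zero_iff hΨ, inflate_sub, inflate_site,
    inflate_site, Matrix.sub_mul, sub_eq_zero, absorbState, Matrix.mul_vecMulVec,
    Matrix.mul_vecMulVec] at h
  have htr := trace_absorbState hΨ i
  have hstar : star (absorb Ψ i) ⬝ᵥ absorb Ψ i = 1 := by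
    rw [← htr, absorbState, Matrix.trace_vecMulVec, dotProduct_comm]
  have := congrArg (fun M => M *ᵥ absorb Ψ i) h
  simp only [Matrix.vecMulVec_mulVec, hstar] at this
  simpa using this

theorem IsProjectionForm.exists_isSchmidtForm {P : ∀ i j, Matrix (Q i j) (Q i j) ℂ}
    (hP : q.IsProjectionForm P) (hΨ : q.IsPurification Ψ) :
    ∃ d lam b χ, q.IsSchmidtForm Ψ d lam b χ := by
  have hschmidt := fun i => exists_schmidt_adapted (N.two_parties i) (absorb Ψ i)
    (P := fun j : N.Parties i => P i j ⊗ₖ (1 : Matrix (E i j) (E i j) ℂ))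
    (fun j => by
      rw [Matrix.IsHermitian, Matrix.conjTranspose_kronecker, (hP.isHermitian _ _).eq,
        Matrix.conjTranspose_one])
    (fun j => by rw [← Matrix.mul_kronecker_mul, hP.idempotent, Matrix.mul_one])
    (site_mulVec_absorb hP hΨ i)
  choose d lam c χ hlam hc hψ hχ using hschmidt
  let b : ∀ i j, Fin (d i) → Q i j × E i j → ℂ := fun i j =>
    if h : N.E i j = true then c i ⟨j, h⟩ else 0
  have hbapp : ∀ i (j : N.Parties i), b i j = c i j := by
    intro i j
    simp only [b]
    rw [dif_pos j.2]
  have horth : ∀ i j, N.E i j = true → ∀ l l',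
      star (b i j l) ⬝ᵥ b i j l' = if l = l' then 1 else 0 := by
    intro i j h l l'
    rw [hbapp i ⟨j, h⟩]
    exact hc i ⟨j, h⟩ l l'
  let B : ∀ i j, Matrix (Q i j × E i j) (Fin (d i)) ℂ := fun i j => Matrix.of fun x l => b i j l x
  have hB : ∀ i j, N.E i j = true → (B i j)ᴴ * B i j = 1 := fun i j h =>
    conjTranspose_mul_self_of_orthonormal (horth i j h)
  have hvec : ∀ i z, absorb Ψ i z = ∑ l, (lam i l : ℂ) * ∏ j : N.Parties i, b i j l (z j) := by
    intro i z
    rw [hψ i z]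
    simp only [hbapp]
  have hstate : absorbState Ψ = N.schmidtState lam B := by
    funext i
    have : absorb Ψ i = schmidtVec (lam i) fun j : N.Parties i => B i j := funext (hvec i)
    rw [absorbState, schmidtState, this]
  have hPB : ∀ i j, N.E i j = true → (P i j ⊗ₖ (1 : Matrix (E i j) (E i j) ℂ)) * B i j =
      (∑ l, ((χ i l : ℕ) : ℂ) • vecMulVec (b i j l) (star (b i j l))) * B i j := by
    intro i j h
    rw [sum_smul_vecMulVec_eq, Matrix.mul_assoc]
    change _ = B i j * diagonal _ * ((B i j)ᴴ * B i j)
    rw [hB i j h, Matrix.mul_one]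
    ext x l
    have h1 := congrFun (hχ i ⟨j, h⟩ l) x
    rw [← hbapp i ⟨j, h⟩] at h1
    rw [Matrix.mul_diagonal, mul_comm]
    exact h1
  refine ⟨d, lam, b, χ, hlam, horth, hvec, fun j => ?_⟩
  rw [agreeOnSupport_iff]
  have hm := hP.measurement j
  rw [← sub_eq_zero, ← Matrix.sub_mul, mul_partyState_eq_zero_iff hΨ, inflate_sub,
    Matrix.sub_mul, sub_eq_zero, inflate_tensor] at hm
  refine hm.trans ?_
  change _ = _ * N.partyState (absorbState Ψ) j
  rw [hstate, partyState_schmidtState N hB, ← Matrix.mul_assoc, ← Matrix.mul_assoc,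
    ← Matrix.mul_assoc, ← Matrix.mul_assoc]
  congr 2
  rw [partyFrame, tensor_mul, tensor_mul]
  congr 1
  funext i
  exact hPB _ _ i.2

end Schmidt

end QuantumModel

end FinnerRigidity

open FinnerRigidity in
theorem theorem3 {I J : Type*} [Fintype I] [Fintype J] [DecidableEq I] [DecidableEq J]
    (N : BipartiteNetwork I J) {Q : I → J → Type*} {O : J → Type*}
    [∀ i j, Fintype (Q i j)] [∀ i j, DecidableEq (Q i j)] [∀ j, Fintype (O j)]
    (q : QuantumModel N Q O) (hpos : ∀ j, 0 < q.conclusiveProb {j}) :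
    -- flag form, for every purification of the sources
    (∀ {E : I → Type*} [∀ i, Fintype (E i)] (Ψ : ∀ i, N.SourceIdx Q i × E i → ℂ),
      q.IsPurification Ψ →
      (q.SaturatesFinner ↔ ∃ e r V Ψ₁ Ψ₀, q.IsFlagForm Ψ e r V Ψ₁ Ψ₀) ∧
      (∀ e r V Ψ₁ Ψ₀, q.IsFlagForm Ψ e r V Ψ₁ Ψ₀ →
        ∀ i j j', j ≠ j' → N.E i j = true → N.E i j' = true →
          1 - e i = q.conclusiveProb {j} * q.conclusiveProb {j'} / q.conclusiveProb {j, j'})) ∧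
    -- Schmidt form, for every purification and every way to absorb the purifying systems
    (∀ {E : I → J → Type*} [∀ i j, Fintype (E i j)] [∀ i j, DecidableEq (E i j)]
      (Ψ : ∀ i, N.SourceIdx Q i × N.SourceIdx E i → ℂ),
      q.IsPurification Ψ →
      (q.SaturatesFinner ↔ ∃ d lam b χ, q.IsSchmidtForm Ψ d lam b χ) ∧
      (∀ d lam b χ, q.IsSchmidtForm Ψ d lam b χ →
        ∀ i j j', j ≠ j' → N.E i j = true → N.E i j' = true →
          ∑ ℓ, lam i ℓ ^ 2 * ((χ i ℓ : ℕ) : ℝ) =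
            q.conclusiveProb {j} * q.conclusiveProb {j'} / q.conclusiveProb {j, j'})) := by
  refine ⟨fun {E} _ Ψ hΨ => ⟨⟨fun hsat => ?_, ?_⟩, ?_⟩,
    fun {E} _ _ Ψ hΨ => ⟨⟨fun hsat => ?_, ?_⟩, ?_⟩⟩
  · obtain ⟨P, hP⟩ := q.exists_projectionForm hpos hsat
    exact hP.exists_isFlagForm hΨ
  · rintro ⟨e, r, V, Ψ₁, Ψ₀, h⟩
    exact (h.hasSuccessRates hΨ).saturatesFinner fun i => sub_nonneg.mpr (h.rate_mem i).2
  · intro e r V Ψ₁ Ψ₀ h i j j' hjj hj hj'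
    exact (h.hasSuccessRates hΨ).rate_eq hpos hjj hj hj'
  · obtain ⟨P, hP⟩ := q.exists_projectionForm hpos hsat
    exact hP.exists_isSchmidtForm hΨ
  · rintro ⟨d, lam, b, χ, h⟩
    exact (h.hasSuccessRates hΨ).saturatesFinner fun i => Finset.sum_nonneg fun l _ => by positivity
  · intro d lam b χ h i j j' hjj hj hj'
    exact (h.hasSuccessRates hΨ).rate_eq hpos hjj hj hj'
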